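/- **Theorem.** A (Beurling) generalized number system is a pair of non-decreasing right continuous functions $N,\Pi:\mathbb R\to\mathbb R$ with support in $[1,\infty)$, $N(1)=1$ and $\Pi(1)=0$, such that $$\zeta(s):=\int_{1^-}^{\infty}x^{-s}\,\mathrm dN(x)=\exp\left(\int_1^\infty x^{-s}\,\mathrm d\Pi(x)\right)$$ on some half-plane $\operatorname{Re}s>\sigma_0$ on which both integrals converge, and such that the integral defining $\zeta(s)$ converges at least for $\operatorname{Re}s>1$. (The system need not be discrete.) For every such system the following four statements are equivalent. (i) For some $a>0$: $\;N(x)=ax+O\!\left(\dfrac{x}{\log^n x}\right)$ as $x\to\infty$, for all $n\in\mathbb N$. (ii) For some $a>0$, the function $G(s)=\zeta(s)-\dfrac{a}{s-1}$, $\operatorname{Re}s>1$, has a $C^\infty$-extension to $\operatorname{Re}s\ge 1$, and there is an $\varepsilon>0$ such that, for all $n\in\mathbb N$, $\;G^{(n)}(1+it)=O(|t|^{\varepsilon})$ as $|t|\to\infty$. (iii) For some $a>0$, the function $G(s)=\zeta(s)-\dfrac{a}{s-1}$ has the following property: for each $\varepsilon>0$ and each $n\in\mathbb N$ there is a constant $C=C_{\varepsilon,n}$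 with $\;|G^{(n)}(\sigma+it)|\le C\,(1+|t|^{\varepsilon})$ for all $\sigma>1$ and $t\in\mathbb R$. (iv) $\;\Pi(x)=\operatorname{Li}(x)+O\!\left(\dfrac{x}{\log^n x}\right)$ as $x\to\infty$, for all $n\in\mathbb N$, where $\operatorname{Li}(x)=\int_2^x\frac{\mathrm dt}{\log t}$. The $O$-constants may depend on $n$; here $\mathbb N$ contains $0$ and $G^{(0)}=G$. -/

import Mathlib

open Filter Asymptotics MeasureTheory
open scoped Topology ContDiff

/-- The Mellin-Stieltjes transform `∫_{1⁻}^∞ x^{-s} dF(x)` of a non-decreasing right continuous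
function `F`; the mass that `dF` may have at the point `1` is included. -/
noncomputable def mellinStieltjes (F : StieltjesFunction ℝ) (s : ℂ) : ℂ :=
  ∫ x in Set.Ici (1 : ℝ), (x : ℂ) ^ (-s) ∂F.measure

/-- Convergence of the integral `∫_{1⁻}^∞ x^{-s} dF(x)`. As `dF` is a positive measure, on an open
half-plane (which contains real points) convergence and absolute convergence are the same. -/
def MellinStieltjesConvergent (F : StieltjesFunction ℝ) (s : ℂ) : Prop :=
  IntegrableOn (fun x : ℝ => (x : ℂ) ^ (-s)) (Set.Ici (1 : ℝ)) F.measure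

/-- A (Beurling) generalized number system, not necessarily discrete: non-decreasing right
continuous functions `N` (generalized integers) and `P` (the Riemann prime distribution function,
usually denoted by a capital pi), supported in `[1, ∞)`, with `N 1 = 1` and `P 1 = 0`, such that
`∫_{1⁻}^∞ x^{-s} dN(x) = exp (∫_1^∞ x^{-s} dP(x))` on some half-plane where the integrals converge,
and such that the zeta function `∫_{1⁻}^∞ x^{-s} dN(x)` converges at least on `Re s > 1`. -/
structure BeurlingSystem where
  N : StieltjesFunction ℝ
  P : StieltjesFunction ℝ
  N_one : N 1 = 1
  P_one : P 1 = 0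
  N_support : ∀ x < 1, N x = 0
  P_support : ∀ x < 1, P x = 0
  exp_relation : ∃ σ₀ : ℝ, ∀ s : ℂ, σ₀ < s.re →
    MellinStieltjesConvergent N s ∧ MellinStieltjesConvergent P s ∧
      mellinStieltjes N s = Complex.exp (mellinStieltjes P s)
  zeta_convergent : ∀ s : ℂ, 1 < s.re → MellinStieltjesConvergent N s

namespace BeurlingSystem

/-- The zeta function of a generalized number system (meaningful for `Re s > 1`). -/
noncomputable def zeta (B : BeurlingSystem) (s : ℂ) : ℂ :=
  mellinStieltjes B.N s

/-- The function `G(s) = ζ(s) - a / (s - 1)` (meaningful for `Re s > 1`). -/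
noncomputable def zetaMinusPole (B : BeurlingSystem) (a : ℝ) (s : ℂ) : ℂ :=
  B.zeta s - (a : ℂ) / (s - 1)

end BeurlingSystem

/-- The logarithmic integral `Li(x) = ∫_2^x dt / log t`. -/
noncomputable def logIntegral (x : ℝ) : ℝ :=
  ∫ t in (2 : ℝ)..x, 1 / Real.log t

/-- The closed half-plane `Re s ≥ 1`. -/
def closedHalfPlane : Set ℂ := {s | 1 ≤ s.re}

/-- `F` is a `C^∞` extension to `Re s ≥ 1` of the function `G` given on `Re s > 1`: it is real
`C^∞` up to the boundary and agrees with `G` on `Re s > 1`. When `G` is holomorphic on `Re s > 1`,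
passing to the limit in the Cauchy-Riemann equations shows that such an `F` has complex derivatives
of all orders within `Re s ≥ 1`, and that these extend the derivatives of `G` continuously. -/
def IsSmoothExtension (G F : ℂ → ℂ) : Prop :=
  ContDiffOn ℝ ∞ F closedHalfPlane ∧ ∀ s : ℂ, 1 < s.re → F s = G s

/-! Put x = e^u. For M = N or M = Π and a main term Q whose transform is A, Fubini
(`mellinStieltjes_sub_eq`) writes f = (transform of dM) - A as s times the Laplace transform, at s -
1, of e^{-u}(M(e^u) - Q(e^u)). For N take Q(x) = a(x - 1), with A = a/(s - 1). For Π take Q(x) =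
∫_1^x (1 - 1/t)/log t dt, which is Li up to O(log x), with A = log(s/(s - 1)). Then (i) and (iv) are
the same assertion about two pairs (M, Q): the normalized remainder is smaller than every power of
1/u.

Abelian half (`subpolyUpTo_of_decay`). Such decay bounds every derivative of the Laplace transform,
so every derivative of f is O(1 + |t|) near the boundary. Positivity of dM also gives f = O(1 + 1/(σ
- 1)), uniformly in t. Moving from s to s + η, with Cauchy's estimate at s + η and the next
derivative controlling the move, interpolates between the two bounds. Iterating drives the exponent
of |t| below any ε (`subpolyUpTo_of_linear_bound`); this is how (iii) comes out with arbitrarily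
small ε.

Tauberian half (`decay_of_smoothExtension`). If f has smooth boundary values whose derivatives all
grow at most like one fixed power, averages of the remainder at scale τ against a nonnegative kernel
of compact Fourier support are, by repeated integration by parts, O(τ^{-K} h^{-n}) for every n with
K fixed. A scale τ that is a negative power of h is therefore affordable. As M increases, such
averages control point values (`tauberian_real`). The exponent must not depend on the order of the
derivative, and that is all (ii) needs to supply.

Between ζ and log ζ one works with L = log((s - 1)ζ(s)/s), `logRemainder`. From ζ to L the task is a
lower bound for |e^L|. Near 1 it comes from a > 0; off the real axis the 3-4-1 inequality is applied
at s + η and carried back to s by the small derivative (`exists_lower_bound_of_abs_im`). From L to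
ζ, growth of L alone would only bound e^L by exp(|t|^ε); instead L' bounds the change of L over a
shift η = (1 + |t|)^{-ε}, and |ζ| is O(1/η) at s + η (`subpolyGrowth_exp_logRemainder`). The pole is
then split off by a divided difference (`subpolyUpTo_div_sub_one`).

The exponential relation is given only on some half-plane. Landau's lemma (`landau_convergent`)
brings it to Re s > 1: ζ is positive on the real axis there, so log ζ is holomorphic near each such
real point and the positive integral of dΠ cannot diverge. -/

open scoped FourierTransform

/-! ### The Mellin-Stieltjes transform -/

/-- The open half-plane `Re s > 1`. -/
def openHalfPlane : Set ℂ := {s | 1 < s.re}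

lemma isOpen_openHalfPlane : IsOpen openHalfPlane :=
  isOpen_lt continuous_const Complex.continuous_re

/-- The measure `dM` restricted to `[1, ∞)`. -/
noncomputable def tailMeasure (M : StieltjesFunction ℝ) : Measure ℝ :=
  M.measure.restrict (Set.Ici 1)

lemma ae_tailMeasure_one_le (M : StieltjesFunction ℝ) : ∀ᵐ x ∂(tailMeasure M), (1 : ℝ) ≤ x :=
  ae_restrict_mem measurableSet_Ici

lemma cpow_neg_eq_exp {x : ℝ} (hx : 1 ≤ x) (s : ℂ) :
    (x : ℂ) ^ (-s) = Complex.exp (s * ((-Real.log x : ℝ) : ℂ)) := by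
  have hx0 : (x : ℂ) ≠ 0 := by
    exact_mod_cast (by linarith : x ≠ 0)
  rw [Complex.cpow_def_of_ne_zero hx0, ← Complex.ofReal_log (by linarith)]
  congr 1
  push_cast
  ring

/-- Since x^{-s} = exp(s · (-log x)), the transform is a complex moment generating function.
Holomorphy and the integral formulas for derivatives are then those of `complexMGF`. -/
lemma mellinStieltjes_eq_complexMGF (M : StieltjesFunction ℝ) (s : ℂ) :
    mellinStieltjes M s
      = ProbabilityTheory.complexMGF (fun x => -Real.log x) (tailMeasure M) s := by
  unfold mellinStieltjes ProbabilityTheory.complexMGF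
  refine integral_congr_ae ?_
  filter_upwards [ae_tailMeasure_one_le M] with x hx
  exact cpow_neg_eq_exp hx s

lemma mellinStieltjesConvergent_iff (M : StieltjesFunction ℝ) (s : ℂ) :
    MellinStieltjesConvergent M s ↔
      s.re ∈ ProbabilityTheory.integrableExpSet (fun x => -Real.log x) (tailMeasure M) := by
  unfold MellinStieltjesConvergent ProbabilityTheory.integrableExpSet IntegrableOn
  change Integrable _ (tailMeasure M) ↔ Integrable _ (tailMeasure M)
  have h1 : (fun x : ℝ => (x : ℂ) ^ (-s)) =ᵐ[tailMeasure M]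
      fun x => Complex.exp (s * ((-Real.log x : ℝ) : ℂ)) := by
    filter_upwards [ae_tailMeasure_one_le M] with x hx
    exact cpow_neg_eq_exp hx s
  rw [integrable_congr h1, ← integrable_norm_iff (by fun_prop)]
  simp [Complex.norm_exp]

lemma MellinStieltjesConvergent.mono {M : StieltjesFunction ℝ} {s s' : ℂ}
    (h : MellinStieltjesConvergent M s) (hs : s.re ≤ s'.re) : MellinStieltjesConvergent M s' := by
  rw [mellinStieltjesConvergent_iff] at h ⊢
  refine Integrable.mono' h (by fun_prop) ?_
  filter_upwards [ae_tailMeasure_one_le M] with x hx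
  have := Real.log_nonneg hx
  rw [Real.norm_eq_abs, abs_of_pos (Real.exp_pos _)]
  refine Real.exp_le_exp.2 ?_
  nlinarith

section HalfPlane

variable {M : StieltjesFunction ℝ} {c : ℝ}

lemma mem_interior_integrableExpSet
    (hM : ∀ s : ℂ, c < s.re → MellinStieltjesConvergent M s) {σ : ℝ} (hσ : c < σ) :
    σ ∈ interior
      (ProbabilityTheory.integrableExpSet (fun x => -Real.log x) (tailMeasure M)) := by
  rw [mem_interior]
  refine ⟨Set.Ioi c, fun r hr => ?_, isOpen_Ioi, hσ⟩
  simpa using (mellinStieltjesConvergent_iff M r).1 (hM r (by simpa using hr))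

lemma differentiableOn_mellinStieltjes
    (hM : ∀ s : ℂ, c < s.re → MellinStieltjesConvergent M s) :
    DifferentiableOn ℂ (mellinStieltjes M) {s | c < s.re} := by
  have h : mellinStieltjes M
      = ProbabilityTheory.complexMGF (fun x => -Real.log x) (tailMeasure M) :=
    funext (mellinStieltjes_eq_complexMGF M)
  rw [h]
  exact ProbabilityTheory.differentiableOn_complexMGF.mono
    fun s hs => mem_interior_integrableExpSet hM hs

lemma mellinStieltjes_ofReal (M : StieltjesFunction ℝ) (σ : ℝ) :
    mellinStieltjes M σ
      = ((ProbabilityTheory.mgf (fun x => -Real.log x) (tailMeasure M) σ : ℝ) : ℂ) := by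
  rw [mellinStieltjes_eq_complexMGF, ProbabilityTheory.complexMGF_ofReal]

lemma mellinStieltjes_ofReal_re (M : StieltjesFunction ℝ) (σ : ℝ) :
    mellinStieltjes M σ = ((mellinStieltjes M σ).re : ℂ) := by
  rw [mellinStieltjes_ofReal, Complex.ofReal_re]

lemma norm_mellinStieltjes_le (M : StieltjesFunction ℝ) (s : ℂ) :
    ‖mellinStieltjes M s‖ ≤ (mellinStieltjes M (s.re : ℂ)).re := by
  rw [mellinStieltjes_ofReal, Complex.ofReal_re, mellinStieltjes_eq_complexMGF]
  exact ProbabilityTheory.norm_complexMGF_le_mgf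

lemma mellinStieltjes_ofReal_re_nonneg (M : StieltjesFunction ℝ) (σ : ℝ) :
    0 ≤ (mellinStieltjes M σ).re := by
  have := norm_mellinStieltjes_le M (σ : ℂ)
  rw [Complex.ofReal_re] at this
  exact (norm_nonneg _).trans this

lemma mellinStieltjes_re_antitone {σ σ' : ℝ} (h : MellinStieltjesConvergent M σ)
    (hσ : σ ≤ σ') : (mellinStieltjes M σ').re ≤ (mellinStieltjes M σ).re := by
  have h' : MellinStieltjesConvergent M σ' := h.mono (by simpa using hσ)
  rw [mellinStieltjesConvergent_iff] at h h'
  rw [mellinStieltjes_ofReal, mellinStieltjes_ofReal, Complex.ofReal_re, Complex.ofReal_re]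
  refine integral_mono_ae h' h ?_
  filter_upwards [ae_tailMeasure_one_le M] with x hx
  have := Real.log_nonneg hx
  refine Real.exp_le_exp.2 ?_
  nlinarith

end HalfPlane

/-! ### Passage from the Stieltjes integral to a Laplace transform. -/

lemma StieltjesFunction.measure_Icc_one {M : StieltjesFunction ℝ} (h0 : ∀ x < 1, M x = 0) (y : ℝ) :
    M.measure (Set.Icc 1 y) = ENNReal.ofReal (M y) := by
  rw [M.measure_Icc]
  have : Function.leftLim M 1 = 0 := by
    have h1 := M.mono.tendsto_leftLim 1
    have h2 : Tendsto M (𝓝[<] 1) (𝓝 0) := by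
      refine tendsto_const_nhds.congr' ?_
      filter_upwards [self_mem_nhdsWithin] with x hx
      exact (h0 x hx).symm
    exact tendsto_nhds_unique h1 h2
  rw [this, sub_zero]

lemma StieltjesFunction.nonneg_of_support {M : StieltjesFunction ℝ} (h0 : ∀ x < 1, M x = 0)
    (x : ℝ) : 0 ≤ M x := by
  rw [← h0 (min x 0) (by simp)]
  exact M.mono (min_le_left _ _)

lemma Ioi_inter_Ici_ae {a : ℝ} (ha : 0 ≤ a) :
    (Set.Ioi (0 : ℝ) ∩ Set.Ici a : Set ℝ) =ᵐ[volume] Set.Ioi a := by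
  have h1 : (Set.Ioi (0 : ℝ) ∩ Set.Ici a : Set ℝ) =ᵐ[volume] (Set.Ici 0 ∩ Set.Ici a : Set ℝ) :=
    Ioi_ae_eq_Ici.inter (ae_eq_refl _)
  refine h1.trans ?_
  rw [Set.Ici_inter_Ici, sup_of_le_right ha]
  exact Ioi_ae_eq_Ici.symm

/-- Integrating the absolute value in u first leaves x^{-σ}/σ, whose integrability is the assumed
convergence. This is the hypothesis of Fubini in the next theorem. -/
lemma integrable_laplace_kernel {M : StieltjesFunction ℝ} {s : ℂ}
    (hs : 0 < s.re) (hM : MellinStieltjesConvergent M s) :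
    Integrable (fun p : ℝ × ℝ => (Set.Ici (Real.log p.1)).indicator
      (fun u : ℝ => Complex.exp (-s * u)) p.2) ((tailMeasure M).prod (volume.restrict (Set.Ioi 0))) := by
  have hmeas : Measurable (fun p : ℝ × ℝ => (Set.Ici (Real.log p.1)).indicator
      (fun u : ℝ => Complex.exp (-s * u)) p.2) := by
    have : (fun p : ℝ × ℝ => (Set.Ici (Real.log p.1)).indicator
      (fun u : ℝ => Complex.exp (-s * u)) p.2) = {p : ℝ × ℝ | Real.log p.1 ≤ p.2}.indicator
        (fun p => Complex.exp (-s * p.2)) := by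
      ext p
      simp [Set.indicator]
    rw [this]
    refine Measurable.indicator (by fun_prop) ?_
    exact measurableSet_le (by fun_prop) (by fun_prop)
  have : SFinite (tailMeasure M) := by unfold tailMeasure; infer_instance
  rw [integrable_prod_iff hmeas.aestronglyMeasurable]
  constructor
  · refine Filter.Eventually.of_forall fun x => ?_
    refine Integrable.indicator (s := Set.Ici (Real.log x)) ?_ measurableSet_Ici
    exact integrableOn_exp_mul_complex_Ioi (by simpa using hs) 0
  · have h1 : (fun x : ℝ => ∫ y in Set.Ioi (0 : ℝ), ‖(Set.Ici (Real.log x)).indicator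
        (fun u : ℝ => Complex.exp (-s * u)) y‖) =ᵐ[tailMeasure M]
        fun x => Real.exp (s.re * -Real.log x) / s.re := by
      filter_upwards [ae_tailMeasure_one_le M] with x hx
      have hl := Real.log_nonneg hx
      simp_rw [norm_indicator_eq_indicator_norm]
      rw [setIntegral_indicator measurableSet_Ici, setIntegral_congr_set (Ioi_inter_Ici_ae hl)]
      simp only [Complex.norm_exp]
      have : ∀ u : ℝ, (-s * u).re = -s.re * u := by intro u; simp
      simp_rw [this]
      rw [integral_exp_mul_Ioi (by linarith)]
      rw [neg_div_neg_eq]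
      congr 2
      ring
    refine (integrable_congr h1).2 ?_
    exact ((mellinStieltjesConvergent_iff M s).1 hM).div_const _

/-- Write x^{-s} = s ∫_{log x}^∞ e^{-su} du and exchange the integrals; for fixed u the inner
integral is the mass of [1, e^u]. This replaces integration by parts and needs no boundary term. -/
theorem mellinStieltjes_eq_laplace {M : StieltjesFunction ℝ} (h0 : ∀ x < 1, M x = 0) {s : ℂ}
    (hs : 0 < s.re) (hM : MellinStieltjesConvergent M s) :
    IntegrableOn (fun u : ℝ => (M (Real.exp u) : ℂ) * Complex.exp (-s * u)) (Set.Ioi 0) ∧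
    mellinStieltjes M s
      = s * ∫ u in Set.Ioi (0 : ℝ), (M (Real.exp u) : ℂ) * Complex.exp (-s * u) := by
  have hs0 : s ≠ 0 := by rintro rfl; simp at hs
  have : SFinite (tailMeasure M) := by unfold tailMeasure; infer_instance
  have hI := integrable_laplace_kernel hs hM
  have hin : ∀ u ∈ Set.Ioi (0 : ℝ), ∫ x, (Set.Ici (Real.log x)).indicator
      (fun u : ℝ => Complex.exp (-s * u)) u ∂(tailMeasure M)
      = (M (Real.exp u) : ℂ) * Complex.exp (-s * u) := by
    intro u hu
    have : ∀ᵐ x ∂(tailMeasure M), (Set.Ici (Real.log x)).indicator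
      (fun u : ℝ => Complex.exp (-s * u)) u
        = (Set.Iic (Real.exp u)).indicator (fun _ => Complex.exp (-s * u)) x := by
      filter_upwards [ae_tailMeasure_one_le M] with x hx
      have : u ∈ Set.Ici (Real.log x) ↔ x ∈ Set.Iic (Real.exp u) := by
        simp only [Set.mem_Ici, Set.mem_Iic]
        exact Real.log_le_iff_le_exp (by linarith)
      by_cases h : x ∈ Set.Iic (Real.exp u)
      · rw [Set.indicator_of_mem h, Set.indicator_of_mem (this.2 h)]
      · rw [Set.indicator_of_notMem h, Set.indicator_of_notMem (fun h' => h (this.1 h'))]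
    rw [integral_congr_ae this, integral_indicator measurableSet_Iic, setIntegral_const]
    rw [Complex.real_smul]
    unfold tailMeasure Measure.real
    rw [Measure.restrict_apply measurableSet_Iic, Set.inter_comm, Set.Ici_inter_Iic, StieltjesFunction.measure_Icc_one h0,
      ENNReal.toReal_ofReal (StieltjesFunction.nonneg_of_support h0 _)]
  have hae : ∀ᵐ u ∂(volume.restrict (Set.Ioi (0 : ℝ))),
      ∫ x, (Set.Ici (Real.log x)).indicator
      (fun u : ℝ => Complex.exp (-s * u)) u ∂(tailMeasure M)
      = (M (Real.exp u) : ℂ) * Complex.exp (-s * u) := by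
    filter_upwards [ae_restrict_mem measurableSet_Ioi] with u hu
    exact hin u hu
  refine ⟨(integrable_congr hae).1 hI.integral_prod_right, ?_⟩
  rw [← integral_congr_ae hae, ← integral_integral_swap hI, ← integral_const_mul]
  unfold mellinStieltjes
  refine integral_congr_ae ?_
  filter_upwards [ae_tailMeasure_one_le M] with x hx
  have hl := Real.log_nonneg hx
  rw [setIntegral_indicator measurableSet_Ici, setIntegral_congr_set (Ioi_inter_Ici_ae hl),
    integral_exp_mul_complex_Ioi (by simpa using hs), cpow_neg_eq_exp hx]
  have : -s * (Real.log x : ℂ) = s * ((-Real.log x : ℝ) : ℂ) := by push_cast; ring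
  rw [this]
  field_simp

/-- Markov's inequality: on [1, e^u] the integrand is at least e^{-σu}. At u = 0 it gives ζ(σ) ≥ 1;
at σ = 1 + 1/u it gives the a priori growth of the counting function. -/
lemma mul_exp_le_mellinStieltjes {M : StieltjesFunction ℝ} (h0 : ∀ x < 1, M x = 0) {σ u : ℝ}
    (hσ : 0 ≤ σ) (hM : MellinStieltjesConvergent M σ) :
    M (Real.exp u) * Real.exp (-σ * u) ≤ (mellinStieltjes M σ).re := by
  have hM' := (mellinStieltjesConvergent_iff M σ).1 hM
  rw [Complex.ofReal_re] at hM'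
  rw [mellinStieltjes_ofReal, Complex.ofReal_re]
  have h1 : ∫ x in Set.Iic (Real.exp u), Real.exp (-σ * u) ∂(tailMeasure M)
      = M (Real.exp u) * Real.exp (-σ * u) := by
    rw [setIntegral_const, smul_eq_mul, Measure.real, tailMeasure,
      Measure.restrict_apply measurableSet_Iic, Set.inter_comm, Set.Ici_inter_Iic,
      StieltjesFunction.measure_Icc_one h0,
      ENNReal.toReal_ofReal (StieltjesFunction.nonneg_of_support h0 _)]
  rw [← h1]
  have hfin : tailMeasure M (Set.Iic (Real.exp u)) ≠ ⊤ := by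
    rw [tailMeasure, Measure.restrict_apply measurableSet_Iic, Set.inter_comm, Set.Ici_inter_Iic,
      StieltjesFunction.measure_Icc_one h0]
    exact ENNReal.ofReal_ne_top
  calc ∫ x in Set.Iic (Real.exp u), Real.exp (-σ * u) ∂(tailMeasure M)
      ≤ ∫ x in Set.Iic (Real.exp u), Real.exp (σ * -Real.log x) ∂(tailMeasure M) := by
        refine integral_mono_ae (integrableOn_const hfin) hM'.integrableOn ?_
        filter_upwards [ae_restrict_of_ae (ae_tailMeasure_one_le M),
          ae_restrict_mem measurableSet_Iic] with x hx hxu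
        have : Real.log x ≤ u := (Real.log_le_iff_le_exp (by linarith)).2 hxu
        refine Real.exp_le_exp.2 ?_
        nlinarith
    _ ≤ _ := setIntegral_le_integral hM' (Filter.Eventually.of_forall fun x => (Real.exp_pos _).le)

/-! ### Landau's lemma and the exponential relation on `Re s > 1` -/

lemma exp_mellinStieltjes_eqOn {M : StieltjesFunction ℝ} {Z : ℂ → ℂ} {c σ₀ : ℝ}
    (hc : ∀ s : ℂ, c < s.re → MellinStieltjesConvergent M s)
    (hZ : DifferentiableOn ℂ Z {s | c < s.re})
    (hexp : ∀ s : ℂ, σ₀ < s.re → Z s = Complex.exp (mellinStieltjes M s)) :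
    ∀ s : ℂ, c < s.re → Z s = Complex.exp (mellinStieltjes M s) := by
  have hopen : IsOpen {s : ℂ | c < s.re} := isOpen_lt continuous_const Complex.continuous_re
  have h1 : AnalyticOnNhd ℂ Z {s | c < s.re} := hZ.analyticOnNhd hopen
  have h2 : AnalyticOnNhd ℂ (fun s => Complex.exp (mellinStieltjes M s)) {s | c < s.re} :=
    (differentiableOn_mellinStieltjes hc).cexp.analyticOnNhd hopen
  have hpre : IsPreconnected {s : ℂ | c < s.re} := (convex_halfSpace_re_gt c).isPreconnected
  have hmem : ((max c σ₀ + 1 : ℝ) : ℂ) ∈ {s : ℂ | c < s.re} := by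
    simp only [Set.mem_ofPred_eq, Complex.ofReal_re]
    linarith [le_max_left c σ₀]
  have hev : Z =ᶠ[𝓝 ((max c σ₀ + 1 : ℝ) : ℂ)] (fun s => Complex.exp (mellinStieltjes M s)) := by
    have ho : IsOpen {s : ℂ | σ₀ < s.re} := isOpen_lt continuous_const Complex.continuous_re
    filter_upwards [ho.mem_nhds (x := ((max c σ₀ + 1 : ℝ) : ℂ))
      (by simp only [Set.mem_ofPred_eq, Complex.ofReal_re]; linarith [le_max_right c σ₀])] with s hs
    exact hexp s hs
  exact fun s hs => h1.eqOn_of_preconnected_of_eventuallyEq h2 hpre hmem hev hs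

/-- If the derivatives of the transform at `c` sum to a convergent Taylor series at distance `d`,
then the transform converges at `c - d`. -/
lemma integrable_of_summable_taylor {M : StieltjesFunction ℝ} {c d : ℝ} (hd : 0 ≤ d)
    (hint : ∀ n : ℕ, Integrable (fun x => Real.log x ^ n * Real.exp (c * -Real.log x))
      (tailMeasure M))
    (hsum : Summable fun n : ℕ => d ^ n / (n.factorial : ℝ) *
      ∫ x, Real.log x ^ n * Real.exp (c * -Real.log x) ∂(tailMeasure M)) :
    MellinStieltjesConvergent M ((c - d : ℝ) : ℂ) := by
  rw [mellinStieltjesConvergent_iff, Complex.ofReal_re]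
  change Integrable (fun x => Real.exp ((c - d) * -Real.log x)) (tailMeasure M)
  refine ⟨by fun_prop, ?_⟩
  rw [hasFiniteIntegral_iff_ofReal (Filter.Eventually.of_forall fun x => (Real.exp_pos _).le)]
  -- Expand e^{d log x}. Since d and log x are nonnegative, all terms are, so sum and integral may
  -- be exchanged in `ENNReal` before anything is known to be finite.
  have key : ∀ᵐ x ∂(tailMeasure M), ENNReal.ofReal (Real.exp ((c - d) * -Real.log x))
      = ∑' n : ℕ, ENNReal.ofReal (d ^ n / (n.factorial : ℝ) *
        (Real.log x ^ n * Real.exp (c * -Real.log x))) := by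
    filter_upwards [ae_tailMeasure_one_le M] with x hx
    have hl := Real.log_nonneg hx
    have hs : HasSum (fun n : ℕ => d ^ n / (n.factorial : ℝ) *
        (Real.log x ^ n * Real.exp (c * -Real.log x))) (Real.exp ((c - d) * -Real.log x)) := by
      have h := (NormedSpace.expSeries_div_hasSum_exp (d * Real.log x)).mul_right
        (Real.exp (c * -Real.log x))
      rw [← Real.exp_eq_exp_ℝ, ← Real.exp_add] at h
      have h1 : d * Real.log x + c * -Real.log x = (c - d) * -Real.log x := by ring
      have h2 : (fun n : ℕ => (d * Real.log x) ^ n / (n.factorial : ℝ) *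
          Real.exp (c * -Real.log x)) = fun n : ℕ => d ^ n / (n.factorial : ℝ) *
          (Real.log x ^ n * Real.exp (c * -Real.log x)) := by
        funext n; rw [mul_pow]; ring
      rwa [h1, h2] at h
    rw [← hs.tsum_eq, ENNReal.ofReal_tsum_of_nonneg (fun n => by positivity) hs.summable]
  rw [lintegral_congr_ae key, lintegral_tsum (fun n => by fun_prop)]
  have h2 : ∀ n : ℕ, ∫⁻ x, ENNReal.ofReal (d ^ n / (n.factorial : ℝ) *
        (Real.log x ^ n * Real.exp (c * -Real.log x))) ∂(tailMeasure M)
      = ENNReal.ofReal (d ^ n / (n.factorial : ℝ) *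
      ∫ x, Real.log x ^ n * Real.exp (c * -Real.log x) ∂(tailMeasure M)) := by
    intro n
    rw [← integral_const_mul, ofReal_integral_eq_lintegral_ofReal ((hint n).const_mul _)]
    filter_upwards [ae_tailMeasure_one_le M] with x hx
    have hl := Real.log_nonneg hx
    simp only [Pi.zero_apply]
    positivity
  simp_rw [h2]
  exact hsum.tsum_ofReal_lt_top

/-- Suppose the abscissa of convergence β exceeds 1. As Z(β) > 0, log Z is holomorphic in a disc
about β and continues the transform. Its Taylor series at a point slightly to the right of β
converges at a point to the left of β, and the terms there are nonnegative moments, so the integral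
converges to the left of β, a contradiction. -/
theorem landau_convergent {M : StieltjesFunction ℝ} {Z : ℂ → ℂ}
    (hZ : DifferentiableOn ℂ Z openHalfPlane)
    (hpos : ∀ σ : ℝ, 1 < σ → ∃ r : ℝ, 0 < r ∧ Z σ = r) {σ₀ : ℝ}
    (hconv : ∀ s : ℂ, σ₀ < s.re → MellinStieltjesConvergent M s)
    (hexp : ∀ s : ℂ, σ₀ < s.re → Z s = Complex.exp (mellinStieltjes M s)) :
    ∀ s : ℂ, 1 < s.re → MellinStieltjesConvergent M s := by
  by_contra! hcon
  obtain ⟨s₁, hs₁, hns₁⟩ := hcon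
  set S : Set ℝ := {σ : ℝ | MellinStieltjesConvergent M (σ : ℂ)} with hS
  have hSne : S.Nonempty := ⟨σ₀ + 1, hconv _ (by simp)⟩
  have hSlb : ∀ σ ∈ S, s₁.re ≤ σ := by
    intro σ hσ
    by_contra! h
    exact hns₁ (MellinStieltjesConvergent.mono hσ (by simpa using h.le))
  have hSbdd : BddBelow S := ⟨s₁.re, hSlb⟩
  set β := sInf S with hβ
  have hβ1 : 1 < β := lt_of_lt_of_le hs₁ (le_csInf hSne hSlb)
  have hβconv : ∀ s : ℂ, β < s.re → MellinStieltjesConvergent M s := by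
    intro s hs
    obtain ⟨σ, hσ, hσs⟩ := exists_lt_of_csInf_lt hSne hs
    exact MellinStieltjesConvergent.mono hσ (by simpa using hσs.le)
  have hβexp : ∀ s : ℂ, β < s.re → Z s = Complex.exp (mellinStieltjes M s) :=
    exp_mellinStieltjes_eqOn hβconv
      (hZ.mono fun s (hs : β < s.re) => (hβ1.trans hs : 1 < s.re)) hexp
  have hβmem : (β : ℂ) ∈ openHalfPlane := by simpa [openHalfPlane] using hβ1
  have hZc : ContinuousAt Z β :=
    (hZ.differentiableAt (isOpen_openHalfPlane.mem_nhds hβmem)).continuousAt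
  have hslit : ∀ᶠ s in 𝓝 (β : ℂ), Z s ∈ Complex.slitPlane := by
    refine hZc.eventually_mem (Complex.isOpen_slitPlane.mem_nhds ?_)
    obtain ⟨r, hr, h⟩ := hpos β hβ1
    rw [h]
    exact Or.inl (by simpa using hr)
  obtain ⟨r, hr, hball⟩ := Metric.eventually_nhds_iff_ball.1
    (hslit.and (isOpen_openHalfPlane.mem_nhds hβmem))
  set g : ℂ → ℂ := fun s => Complex.log (Z s) with hg
  have hgdiff : DifferentiableOn ℂ g (Metric.ball (β : ℂ) r) :=
    (hZ.mono fun s hs => (hball s hs).2).clog fun s hs => (hball s hs).1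
  -- The disc of radius r/2 about c lies in the disc of radius r about β, and it contains c - 3r/8 =
  -- β - r/8 < β.
  set c : ℝ := β + r / 4 with hc
  have hsub : Metric.ball (c : ℂ) (r / 2) ⊆ Metric.ball (β : ℂ) r := by
    refine Metric.ball_subset_ball' ?_
    rw [Complex.dist_of_im_eq (by simp)]
    simp only [Complex.ofReal_re, hc, Real.dist_eq]
    rw [show β + r / 4 - β = r / 4 by ring, abs_of_pos (by linarith)]
    linarith
  have hcmem : (c : ℂ) ∈ Metric.ball (β : ℂ) r := hsub (Metric.mem_ball_self (by linarith))
  have hcβ : β < c := by simp only [hc]; linarith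
  have hTan : AnalyticAt ℂ (mellinStieltjes M) c := by
    refine (differentiableOn_mellinStieltjes hβconv).analyticAt ?_
    exact (isOpen_lt continuous_const Complex.continuous_re).mem_nhds (by simpa using hcβ)
  have hgan : AnalyticAt ℂ g c := hgdiff.analyticAt (Metric.isOpen_ball.mem_nhds hcmem)
  -- At real points the transform is real, so the principal logarithm returns it exactly, without a
  -- multiple of 2πi. The real points to the right of c then suffice for the identity theorem at c.
  have hreal : ∀ σ : ℝ, β < σ → g σ = mellinStieltjes M σ := by
    intro σ hσ
    simp only [hg]
    rw [hβexp σ (by simpa using hσ), mellinStieltjes_ofReal_re, ← Complex.ofReal_exp,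
      ← Complex.ofReal_log (Real.exp_pos _).le, Real.log_exp]
  have hev : g =ᶠ[𝓝 (c : ℂ)] mellinStieltjes M := by
    refine (hgan.frequently_eq_iff_eventually_eq hTan).1 ?_
    have h1 : ∃ᶠ σ : ℝ in 𝓝[>] c, g σ = mellinStieltjes M σ := by
      refine Filter.Eventually.frequently ?_
      filter_upwards [self_mem_nhdsWithin] with σ hσ
      exact hreal σ (hcβ.trans hσ)
    have h2 : Tendsto (fun σ : ℝ => (σ : ℂ)) (𝓝[>] c) (𝓝[≠] (c : ℂ)) := by
      refine tendsto_nhdsWithin_iff.2 ⟨?_, ?_⟩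
      · exact (Complex.continuous_ofReal.tendsto c).mono_left nhdsWithin_le_nhds
      · filter_upwards [self_mem_nhdsWithin] with σ hσ
        simpa using (ne_of_gt hσ)
    exact h2.frequently h1
  have hcint : ((c : ℂ)).re ∈ interior
      (ProbabilityTheory.integrableExpSet (fun x => -Real.log x) (tailMeasure M)) := by
    rw [Complex.ofReal_re]
    exact mem_interior_integrableExpSet hβconv hcβ
  have hder : ∀ n : ℕ, iteratedDeriv n g c
      = (((-1) ^ n * ∫ x, Real.log x ^ n * Real.exp (c * -Real.log x) ∂(tailMeasure M) : ℝ) : ℂ) := by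
    intro n
    rw [hev.iteratedDeriv_eq n, funext (mellinStieltjes_eq_complexMGF M),
      ProbabilityTheory.iteratedDeriv_complexMGF hcint, ← integral_const_mul, ← integral_complex_ofReal]
    congr 1
    ext x
    push_cast
    rw [neg_pow]
    ring
  have hint : ∀ n : ℕ, Integrable (fun x => Real.log x ^ n * Real.exp (c * -Real.log x))
      (tailMeasure M) := by
    intro n
    rw [Complex.ofReal_re] at hcint
    have := ProbabilityTheory.integrable_pow_mul_exp_of_mem_interior_integrableExpSet hcint n
    refine (this.const_mul ((-1) ^ n)).congr (Filter.Eventually.of_forall fun x => ?_)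
    simp only
    rw [← mul_assoc, ← mul_pow]
    simp
  have hz : (((c - 3 * r / 8 : ℝ)) : ℂ) ∈ Metric.ball (c : ℂ) (r / 2) := by
    rw [Metric.mem_ball, Complex.dist_of_im_eq (by simp), Complex.ofReal_re, Complex.ofReal_re,
      Real.dist_eq, show c - 3 * r / 8 - c = -(3 * r / 8) by ring, abs_neg,
      abs_of_pos (by linarith)]
    linarith
  have hsum := (Complex.hasSum_taylorSeries_on_ball (hgdiff.mono hsub) hz).summable
  have hfin : MellinStieltjesConvergent M ((c - 3 * r / 8 : ℝ) : ℂ) := by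
    refine integrable_of_summable_taylor (by linarith) hint ?_
    rw [← Complex.summable_ofReal]
    -- The sign (-1)^n of the derivative cancels that of the displacement (-3r/8)^n.
    refine hsum.congr fun n => ?_
    rw [hder n]
    simp only [smul_eq_mul]
    push_cast
    rw [show (c : ℂ) - 3 * r / 8 - c = (-1) * (3 * r / 8) by ring, mul_pow]
    have : ((-1 : ℂ)) ^ n * (-1) ^ n = 1 := by rw [← mul_pow]; simp
    linear_combination ((n.factorial : ℂ)⁻¹ * (3 * r / 8) ^ n * (∫ x, Real.log x ^ n * Real.exp (c * -Real.log x) ∂(tailMeasure M) : ℝ)) * this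
  have : β ≤ c - 3 * r / 8 := csInf_le hSbdd hfin
  simp only [hc] at this
  linarith

namespace BeurlingSystem

variable (B : BeurlingSystem)

lemma differentiableOn_zeta : DifferentiableOn ℂ B.zeta openHalfPlane :=
  differentiableOn_mellinStieltjes B.zeta_convergent

/-- The atom of mass N(1) = 1 at x = 1 already contributes 1. -/
lemma one_le_zeta_re {σ : ℝ} (hσ : 1 < σ) : 1 ≤ (B.zeta σ).re := by
  have := mul_exp_le_mellinStieltjes B.N_support (u := 0) (by linarith : (0 : ℝ) ≤ σ)
    (B.zeta_convergent σ (by simpa using hσ))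
  simpa [B.N_one, zeta] using this

theorem convergent_P (s : ℂ) (hs : 1 < s.re) : MellinStieltjesConvergent B.P s := by
  obtain ⟨σ₀, h⟩ := B.exp_relation
  refine landau_convergent B.differentiableOn_zeta (fun σ hσ => ?_) (fun s hs => (h s hs).2.1)
    (fun s hs => (h s hs).2.2) s hs
  exact ⟨(B.zeta σ).re, by linarith [B.one_le_zeta_re hσ], mellinStieltjes_ofReal_re _ _⟩

theorem zeta_eq_exp (s : ℂ) (hs : 1 < s.re) :
    B.zeta s = Complex.exp (mellinStieltjes B.P s) := by
  obtain ⟨σ₀, h⟩ := B.exp_relation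
  exact exp_mellinStieltjes_eqOn B.convergent_P B.differentiableOn_zeta
    (fun s hs => (h s hs).2.2) s hs

end BeurlingSystem

/-! ### Smooth extensions to the closed half-plane -/

lemma closure_openHalfPlane : closure openHalfPlane = closedHalfPlane :=
  Complex.closure_setOfPred_lt_re 1

lemma convex_openHalfPlane : Convex ℝ openHalfPlane := convex_halfSpace_re_gt 1

lemma openHalfPlane_subset : openHalfPlane ⊆ closedHalfPlane :=
  fun s (hs : 1 < s.re) => (le_of_lt hs : 1 ≤ s.re)

lemma uniqueDiffOn_closedHalfPlane_real : UniqueDiffOn ℝ closedHalfPlane := by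
  refine uniqueDiffOn_convex (convex_halfSpace_re_ge 1) ?_
  refine ⟨2, interior_mono openHalfPlane_subset ?_⟩
  rw [isOpen_openHalfPlane.interior_eq]
  simp [openHalfPlane]

lemma uniqueDiffOn_closedHalfPlane : UniqueDiffOn ℂ closedHalfPlane :=
  uniqueDiffOn_closedHalfPlane_real.mono_field

lemma differentiableOn_iteratedDeriv {f : ℂ → ℂ} {U : Set ℂ} (hU : IsOpen U)
    (hf : DifferentiableOn ℂ f U) (n : ℕ) : DifferentiableOn ℂ (iteratedDeriv n f) U := by
  induction n with
  | zero => simpa using hf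
  | succ n ih => rw [iteratedDeriv_succ]; exact ih.deriv hU

lemma hasDerivAt_iteratedDeriv {f : ℂ → ℂ} {U : Set ℂ} (hU : IsOpen U)
    (hf : DifferentiableOn ℂ f U) (n : ℕ) {s : ℂ} (hs : s ∈ U) :
    HasDerivAt (iteratedDeriv n f) (iteratedDeriv (n + 1) f s) s := by
  rw [iteratedDeriv_succ]
  exact ((differentiableOn_iteratedDeriv hU hf n).differentiableAt (hU.mem_nhds hs)).hasDerivAt

section Extension

variable {f : ℂ → ℂ}

/-- A bounded derivative on the convex set (half-plane) ∩ (ball about z) makes f Lipschitz there,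
hence Cauchy along the approach to z. -/
lemma exists_tendsto_of_deriv_bound (hf : DifferentiableOn ℂ f openHalfPlane)
    (hb : ∀ T : ℝ, ∃ C : ℝ, ∀ s ∈ openHalfPlane, |s.im| ≤ T → ‖deriv f s‖ ≤ C)
    {z : ℂ} (hz : z ∈ closedHalfPlane) : ∃ y, Tendsto f (𝓝[openHalfPlane] z) (𝓝 y) := by
  obtain ⟨C, hC⟩ := hb (|z.im| + 1)
  set A := openHalfPlane ∩ Metric.ball z 1 with hA
  have hconv : Convex ℝ A := convex_openHalfPlane.inter (convex_ball z 1)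
  have hlip : LipschitzOnWith C.toNNReal f A := by
    refine hconv.lipschitzOnWith_of_nnnorm_hasDerivWithin_le (f' := deriv f) (fun x hx => ?_) (fun x hx => ?_)
    · exact (hf.differentiableAt (isOpen_openHalfPlane.mem_nhds hx.1)).hasDerivAt.hasDerivWithinAt
    · rw [← norm_toNNReal]
      refine Real.toNNReal_le_toNNReal (hC x hx.1 ?_)
      have h1 : |(x - z).im| ≤ ‖x - z‖ := Complex.abs_im_le_norm _
      have h2 : ‖x - z‖ < 1 := by simpa [dist_eq_norm] using hx.2
      have h3 : x.im = (x - z).im + z.im := by simp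
      rw [h3]
      linarith [abs_add_le (x - z).im z.im]
  have hcl : z ∈ closure openHalfPlane := by rwa [closure_openHalfPlane]
  have : (𝓝[openHalfPlane] z).NeBot := mem_closure_iff_nhdsWithin_neBot.1 hcl
  have hca : Cauchy (map f (𝓝[openHalfPlane] z)) := by
    refine Cauchy.map_of_le (cauchy_nhds.mono nhdsWithin_le_nhds) hlip.uniformContinuousOn ?_
    rw [le_principal_iff]
    exact inter_mem_nhdsWithin _ (Metric.ball_mem_nhds z one_pos)
  exact CompleteSpace.complete hca

/-- A holomorphic function on the open half-plane all of whose derivatives are bounded on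
horizontal strips has a smooth extension to the closed half-plane. -/
theorem exists_smoothExtension (hf : DifferentiableOn ℂ f openHalfPlane)
    (hb : ∀ (n : ℕ) (T : ℝ), ∃ C : ℝ, ∀ s ∈ openHalfPlane, |s.im| ≤ T →
      ‖iteratedDeriv n f s‖ ≤ C) :
    ∃ F : ℂ → ℂ, IsSmoothExtension f F ∧ ∀ n : ℕ, ∀ z ∈ closedHalfPlane,
      Tendsto (iteratedDeriv n f) (𝓝[openHalfPlane] z)
        (𝓝 (iteratedDerivWithin n F closedHalfPlane z)) := by
  have hdiff := differentiableOn_iteratedDeriv isOpen_openHalfPlane hf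
  have hlim : ∀ n, ∀ z ∈ closedHalfPlane, ∃ y,
      Tendsto (iteratedDeriv n f) (𝓝[openHalfPlane] z) (𝓝 y) := by
    intro n z hz
    refine exists_tendsto_of_deriv_bound (hdiff n) (fun T => ?_) hz
    obtain ⟨C, hC⟩ := hb (n + 1) T
    exact ⟨C, fun s hs hT => by rw [← iteratedDeriv_succ]; exact hC s hs hT⟩
  set E : ℕ → ℂ → ℂ := fun n => extendFrom openHalfPlane (iteratedDeriv n f) with hE
  have hElim : ∀ n, ∀ z ∈ closedHalfPlane,
      Tendsto (iteratedDeriv n f) (𝓝[openHalfPlane] z) (𝓝 (E n z)) :=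
    fun n z hz => tendsto_extendFrom (hlim n z hz)
  have hEeq : ∀ n, ∀ z ∈ openHalfPlane, E n z = iteratedDeriv n f z := by
    intro n z hz
    refine extendFrom_eq (subset_closure hz) ?_
    exact ((hdiff n).continuousOn z hz)
  have hEcont : ∀ n, ContinuousOn (E n) closedHalfPlane := fun n =>
    continuousOn_extendFrom closure_openHalfPlane.ge (hlim n)
  have hEder : ∀ n, ∀ z ∈ closedHalfPlane,
      HasDerivWithinAt (E n) (E (n + 1) z) closedHalfPlane z := by
    intro n z hz
    have hopenDer : ∀ y ∈ openHalfPlane, HasDerivAt (E n) (iteratedDeriv (n + 1) f y) y := by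
      intro y hy
      refine (hasDerivAt_iteratedDeriv isOpen_openHalfPlane hf n hy).congr_of_eventuallyEq ?_
      filter_upwards [isOpen_openHalfPlane.mem_nhds hy] with w hw using hEeq n w hw
    -- By the mean value inequality, a real differential that converges at the boundary is the
    -- differential of the extension there. Its limit is multiplication by a complex number, so the
    -- derivative is complex.
    have h1 : HasFDerivWithinAt (E n)
        ((ContinuousLinearMap.toSpanSingleton ℂ (E (n + 1) z)).restrictScalars ℝ)
        (closure openHalfPlane) z := by
      refine hasFDerivWithinAt_closure_of_tendsto_fderiv
        (fun y hy => ((hopenDer y hy).differentiableAt.restrictScalars ℝ).differentiableWithinAt)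
        convex_openHalfPlane isOpen_openHalfPlane (fun y hy => ?_) ?_
      · exact ((hEcont n) y (closure_openHalfPlane ▸ hy)).mono openHalfPlane_subset
      · have h2 : ∀ᶠ y in 𝓝[openHalfPlane] z, fderiv ℝ (E n) y
            = (ContinuousLinearMap.toSpanSingleton ℂ (iteratedDeriv (n + 1) f y)).restrictScalars ℝ := by
          filter_upwards [self_mem_nhdsWithin] with y hy
          exact ((hopenDer y hy).hasFDerivAt.restrictScalars ℝ).fderiv
        refine Tendsto.congr' (EventuallyEq.symm h2) ?_
        have hc : Continuous fun w : ℂ =>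
            (ContinuousLinearMap.toSpanSingleton ℂ w).restrictScalars ℝ := by
          have : Continuous fun w : ℂ => (ContinuousLinearMap.toSpanSingletonCLE (𝕜 := ℂ) w) := by
            fun_prop
          exact (ContinuousLinearMap.continuous_restrictScalars ℝ).comp this
        exact (hc.tendsto _).comp (hElim (n + 1) z hz)
    rw [closure_openHalfPlane] at h1
    exact (HasFDerivWithinAt.of_restrictScalars ℝ h1 rfl)
  have hiter : ∀ n, ∀ z ∈ closedHalfPlane,
      iteratedDerivWithin n (E 0) closedHalfPlane z = E n z := by
    intro n
    induction n with
    | zero => intro z _; simp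
    | succ n ih =>
      intro z hz
      rw [iteratedDerivWithin_succ, derivWithin_congr ih (ih z hz)]
      exact (hEder n z hz).derivWithin (uniqueDiffOn_closedHalfPlane z hz)
  refine ⟨E 0, ⟨?_, fun s hs => by simpa using hEeq 0 s hs⟩, fun n z hz => ?_⟩
  · have : ContDiffOn ℂ ∞ (E 0) closedHalfPlane := by
      refine contDiffOn_of_differentiableOn_deriv fun m _ z hz => ?_
      refine ((hEder m z hz).differentiableWithinAt).congr (hiter m) (hiter m z hz)
    exact this.restrict_scalars ℝ
  · rw [hiter n z hz]
    exact hElim n z hz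

end Extension

/-- The Cauchy-Riemann equations, complex linearity of the real differential, form a closed
condition and so pass from the interior to the boundary. The last two conclusions are the hypotheses
for the derivative of F, so that the lemma can be iterated. -/
lemma differentiableOn_of_contDiffOn_real {F : ℂ → ℂ} (hF : ContDiffOn ℝ ∞ F closedHalfPlane)
    (hd : DifferentiableOn ℂ F openHalfPlane) :
    DifferentiableOn ℂ F closedHalfPlane ∧
      ContDiffOn ℝ ∞ (derivWithin F closedHalfPlane) closedHalfPlane ∧
      DifferentiableOn ℂ (derivWithin F closedHalfPlane) openHalfPlane := by
  set L := fderivWithin ℝ F closedHalfPlane with hL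
  have hLc : ContDiffOn ℝ ∞ L closedHalfPlane :=
    hF.fderivWithin uniqueDiffOn_closedHalfPlane_real (by simp)
  have hLF : ∀ z ∈ closedHalfPlane, HasFDerivWithinAt F (L z) closedHalfPlane z := fun z hz =>
    ((hF.differentiableOn (by simp)) z hz).hasFDerivWithinAt
  have hopenL : ∀ z ∈ openHalfPlane, ∀ w : ℂ, L z w = w * L z 1 := by
    intro z hz w
    have h1 : HasFDerivAt F (L z) z :=
      (hLF z (openHalfPlane_subset hz)).hasFDerivAt
        (Filter.mem_of_superset (isOpen_openHalfPlane.mem_nhds hz) openHalfPlane_subset)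
    have h2 := ((hd.differentiableAt
      (isOpen_openHalfPlane.mem_nhds hz)).hasDerivAt.hasFDerivAt.restrictScalars ℝ)
    rw [h1.unique h2]
    simp
  have hlin : ∀ z ∈ closedHalfPlane, ∀ w : ℂ, L z w = w * L z 1 := by
    intro z hz w
    have hcl : z ∈ closure openHalfPlane := by rwa [closure_openHalfPlane]
    have : (𝓝[openHalfPlane] z).NeBot := mem_closure_iff_nhdsWithin_neBot.1 hcl
    have hc : ContinuousWithinAt L openHalfPlane z :=
      (hLc.continuousOn z hz).mono openHalfPlane_subset
    have h1 : Tendsto (fun y => L y w) (𝓝[openHalfPlane] z) (𝓝 (L z w)) :=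
      hc.clm_apply continuousWithinAt_const
    have h2 : Tendsto (fun y => w * L y 1) (𝓝[openHalfPlane] z) (𝓝 (w * L z 1)) :=
      Tendsto.const_mul w (hc.clm_apply continuousWithinAt_const)
    refine tendsto_nhds_unique (h1.congr' ?_) h2
    filter_upwards [self_mem_nhdsWithin] with y hy using hopenL y hy w
  have hder : ∀ z ∈ closedHalfPlane, HasDerivWithinAt F (L z 1) closedHalfPlane z := by
    intro z hz
    refine HasFDerivWithinAt.of_restrictScalars ℝ (hLF z hz)
      (f' := ContinuousLinearMap.toSpanSingleton ℂ (L z 1)) ?_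
    ext w
    simp [hlin z hz w]
  have hdW : ∀ z ∈ closedHalfPlane, derivWithin F closedHalfPlane z = L z 1 := fun z hz =>
    (hder z hz).derivWithin (uniqueDiffOn_closedHalfPlane z hz)
  refine ⟨fun z hz => (hder z hz).differentiableWithinAt, ?_, ?_⟩
  · exact (hLc.clm_apply contDiffOn_const).congr hdW
  · refine (hd.deriv isOpen_openHalfPlane).congr fun z hz => ?_
    exact derivWithin_of_mem_nhds
      (Filter.mem_of_superset (isOpen_openHalfPlane.mem_nhds hz) openHalfPlane_subset)

theorem IsSmoothExtension.differentiableOn_iteratedDerivWithin {G F : ℂ → ℂ}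
    (h : IsSmoothExtension G F) (hG : DifferentiableOn ℂ G openHalfPlane) (n : ℕ) :
    DifferentiableOn ℂ (iteratedDerivWithin n F closedHalfPlane) closedHalfPlane := by
  have key : ContDiffOn ℝ ∞ (iteratedDerivWithin n F closedHalfPlane) closedHalfPlane ∧
      DifferentiableOn ℂ (iteratedDerivWithin n F closedHalfPlane) openHalfPlane := by
    induction n with
    | zero =>
      rw [iteratedDerivWithin_zero]
      exact ⟨h.1, hG.congr h.2⟩
    | succ n ih =>
      have h1 : iteratedDerivWithin (n + 1) F closedHalfPlane
          = derivWithin (iteratedDerivWithin n F closedHalfPlane) closedHalfPlane := by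
        ext z; rw [iteratedDerivWithin_succ]
      rw [h1]
      exact (differentiableOn_of_contDiffOn_real ih.1 ih.2).2
  exact (differentiableOn_of_contDiffOn_real key.1 key.2).1

theorem IsSmoothExtension.hasDerivAt_vertical {G F : ℂ → ℂ}
    (h : IsSmoothExtension G F) (hG : DifferentiableOn ℂ G openHalfPlane) (n : ℕ) (c ξ : ℝ) :
    HasDerivAt (fun ξ : ℝ => iteratedDerivWithin n F closedHalfPlane
        (1 + ((c * ξ : ℝ) : ℂ) * Complex.I))
      (c * Complex.I * iteratedDerivWithin (n + 1) F closedHalfPlane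
        (1 + ((c * ξ : ℝ) : ℂ) * Complex.I)) ξ := by
  have hmem : ∀ ξ : ℝ, (1 + ((c * ξ : ℝ) : ℂ) * Complex.I) ∈ closedHalfPlane := by
    intro ξ; simp [closedHalfPlane]
  have h1 : HasDerivWithinAt (iteratedDerivWithin n F closedHalfPlane)
      (iteratedDerivWithin (n + 1) F closedHalfPlane (1 + ((c * ξ : ℝ) : ℂ) * Complex.I))
      closedHalfPlane (1 + ((c * ξ : ℝ) : ℂ) * Complex.I) := by
    rw [iteratedDerivWithin_succ]
    exact (h.differentiableOn_iteratedDerivWithin hG n _ (hmem ξ)).hasDerivWithinAt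
  have h2 : HasDerivAt (fun ξ : ℝ => 1 + ((c * ξ : ℝ) : ℂ) * Complex.I) (c * Complex.I) ξ := by
    have : HasDerivAt (fun ξ : ℝ => ((c * ξ : ℝ) : ℂ)) (c : ℂ) ξ := by
      have := ((hasDerivAt_id ξ).const_mul c).ofReal_comp
      simpa using this
    simpa using (this.mul_const Complex.I).const_add 1
  have h3 := HasDerivWithinAt.scomp (s := Set.univ) ξ h1 h2.hasDerivWithinAt (fun ξ _ => hmem ξ)
  simpa [hasDerivWithinAt_univ, Function.comp_def] using h3

/-- Turns complex derivatives on the boundary line into derivatives in the frequency variable; the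
scale c will be 2π, matching the normalization of the Fourier transform. -/
theorem IsSmoothExtension.vertical {G F : ℂ → ℂ}
    (h : IsSmoothExtension G F) (hG : DifferentiableOn ℂ G openHalfPlane) (c : ℝ) :
    ContDiff ℝ ∞ (fun ξ : ℝ => F (1 + ((c * ξ : ℝ) : ℂ) * Complex.I)) ∧
    ∀ n : ℕ, ∀ ξ : ℝ, iteratedDeriv n (fun ξ : ℝ => F (1 + ((c * ξ : ℝ) : ℂ) * Complex.I)) ξ
      = (c * Complex.I) ^ n * iteratedDerivWithin n F closedHalfPlane
        (1 + ((c * ξ : ℝ) : ℂ) * Complex.I) := by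
  have hiter : ∀ n : ℕ, iteratedDeriv n (fun ξ : ℝ => F (1 + ((c * ξ : ℝ) : ℂ) * Complex.I))
      = fun ξ : ℝ => (c * Complex.I) ^ n * iteratedDerivWithin n F closedHalfPlane
        (1 + ((c * ξ : ℝ) : ℂ) * Complex.I) := by
    intro n
    induction n with
    | zero => ext ξ; simp
    | succ n ih =>
      rw [iteratedDeriv_succ, ih]
      ext ξ
      rw [((h.hasDerivAt_vertical hG n c ξ).const_mul _).deriv]
      ring
  refine ⟨?_, fun n ξ => congrFun (hiter n) ξ⟩
  refine contDiff_of_differentiable_iteratedDeriv fun n _ => ?_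
  rw [hiter n]
  exact fun ξ => ((h.hasDerivAt_vertical hG n c ξ).const_mul _).differentiableAt

/-! ### The Tauberian argument: from smoothed averages to pointwise values -/

section TauberReal

variable {E m φ : ℝ → ℝ} {K : ℕ} {C₀ Cm : ℝ}

lemma integrable_comp_mul_kernel {g : ℝ → ℝ} (hg : Measurable g) (hφi : Integrable φ)
    (hφ1 : Integrable fun v => |v| * φ v) (hgrow : ∀ u, |g u| ≤ C₀ * (1 + |u|)) (h τ : ℝ) :
    Integrable fun v => g (h + τ * v) * φ v := by
  have hC : 0 ≤ C₀ := by
    have := (abs_nonneg _).trans (hgrow 0)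
    simpa using this
  refine Integrable.mono' (((hφi.norm.const_mul (C₀ * (1 + |h|)))).add
    (hφ1.norm.const_mul (C₀ * |τ|))) ?_ (Filter.Eventually.of_forall fun v => ?_)
  · exact (hg.comp (by fun_prop)).aestronglyMeasurable.mul hφi.aestronglyMeasurable
  · simp only [Pi.add_apply, norm_mul, Real.norm_eq_abs, abs_abs]
    have h1 := hgrow (h + τ * v)
    have h2 : |h + τ * v| ≤ |h| + |τ| * |v| := (abs_add_le _ _).trans (by rw [abs_mul])
    have h3 : |g (h + τ * v)| ≤ C₀ * (1 + (|h| + |τ| * |v|)) :=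
      h1.trans (mul_le_mul_of_nonneg_left (by linarith) hC)
    calc |g (h + τ * v)| * |φ v| ≤ C₀ * (1 + (|h| + |τ| * |v|)) * |φ v| :=
          mul_le_mul_of_nonneg_right h3 (abs_nonneg _)
      _ = _ := by ring

/-- As E(u)e^u increases, E(h) is at most e^{2η} times any value of E on [h, h + 2η] and at least
e^{-2η} times any value on [h - 2η, h]. So E(h) is compared with averages centred at h + η and h - η
on the scale τ = η², much finer than η. With η = h^{-q} every error is O(η): the smoothing bound
holds for all n, while the exponent K of 1/τ stays fixed. -/
theorem tauberian_real (hφ0 : ∀ v, 0 ≤ φ v) (hφi : Integrable φ)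
    (hφ1 : Integrable fun v => |v| * φ v) (hI : 0 < ∫ v, φ v)
    (hE0 : ∀ u, 0 ≤ E u) (hEneg : ∀ u < 0, E u = 0) (hEm : Measurable E)
    (hmono : ∀ u v, u ≤ v → E u * Real.exp u ≤ E v * Real.exp v)
    (hgrow : ∀ u, E u ≤ C₀ * (1 + |u|))
    (hm : ∀ u, |m u| ≤ Cm) (hmL : ∀ u v, |m u - m v| ≤ Cm * |u - v|)
    (hA : ∀ n : ℕ, ∃ C : ℝ, ∀ τ h : ℝ, 0 < τ → τ ≤ 1 → 0 < h →
      τ ^ K * h ^ n * |∫ v, (E (h + τ * v) - m (h + τ * v)) * φ v| ≤ C) (p : ℕ) :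
    ∃ C : ℝ, ∀ u : ℝ, 1 ≤ u → u ^ p * |E u - m u| ≤ C := by
  have hCm : 0 ≤ Cm := (abs_nonneg _).trans (hm 0)
  have hmm : Measurable m := by
    have : LipschitzWith Cm.toNNReal m := by
      refine LipschitzWith.of_dist_le_mul fun u v => ?_
      rw [Real.dist_eq, Real.dist_eq, Real.coe_toNNReal _ hCm]
      exact hmL u v
    exact this.continuous.measurable
  set I := ∫ v, φ v with hIdef
  set J := ∫ v, |v| * φ v with hJdef
  have hJ : 0 ≤ J := integral_nonneg fun v => mul_nonneg (abs_nonneg _) (hφ0 v)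
  have hEint : ∀ h τ : ℝ, Integrable fun v => E (h + τ * v) * φ v :=
    integrable_comp_mul_kernel hEm hφi hφ1 (fun u => by rw [abs_of_nonneg (hE0 u)]; exact hgrow u)
  have hmint : ∀ h τ : ℝ, Integrable fun v => m (h + τ * v) * φ v :=
    integrable_comp_mul_kernel (C₀ := Cm) hmm hφi hφ1
      (fun u => (hm u).trans (by nlinarith [abs_nonneg u]))
  have hmavg : ∀ h h' τ : ℝ, 0 ≤ τ →
      |(∫ v, m (h' + τ * v) * φ v) - m h * I| ≤ Cm * (|h' - h| * I + τ * J) := by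
    intro h h' τ hτ
    have h1 : (∫ v, m (h' + τ * v) * φ v) - m h * I
        = ∫ v, (m (h' + τ * v) - m h) * φ v := by
      rw [hIdef, ← integral_const_mul, ← integral_sub (hmint h' τ) (hφi.const_mul _)]
      congr 1; ext v; ring
    have h2 : Integrable fun v => Cm * |h' - h| * φ v + Cm * τ * (|v| * φ v) :=
      (hφi.const_mul _).add (hφ1.const_mul _)
    rw [h1, ← Real.norm_eq_abs (∫ v, _)]
    refine (norm_integral_le_of_norm_le h2 (Filter.Eventually.of_forall fun v => ?_)).trans
      (le_of_eq ?_)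
    · rw [Real.norm_eq_abs, abs_mul, abs_of_nonneg (hφ0 v)]
      have h3 : |h' + τ * v - h| ≤ |h' - h| + τ * |v| := by
        have : h' + τ * v - h = (h' - h) + τ * v := by ring
        rw [this]
        refine (abs_add_le _ _).trans ?_
        rw [abs_mul, abs_of_nonneg hτ]
      have h4 := (hmL (h' + τ * v) h).trans (mul_le_mul_of_nonneg_left h3 hCm)
      calc |m (h' + τ * v) - m h| * φ v ≤ Cm * (|h' - h| + τ * |v|) * φ v :=
            mul_le_mul_of_nonneg_right h4 (hφ0 v)
        _ = _ := by ring
    · rw [integral_add (hφi.const_mul _) (hφ1.const_mul _), integral_const_mul, integral_const_mul]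
      ring
  -- the smoothed comparison at distance at most `η` from `h`
  have hsmooth : ∀ q : ℕ, ∃ C : ℝ, 0 ≤ C ∧ ∀ h h' η : ℝ, 1 ≤ h → h / 2 ≤ h' → η = (1 / h) ^ q →
      |h' - h| ≤ η →
      |(∫ v, E (h' + η ^ 2 * v) * φ v) - m h * I| ≤ C * η := by
    intro q
    -- With τ = η² and η = h^{-q}, this exponent gives τ^K h^{(2K+1)q} = 1/η, hence an averaged
    -- error O(η). Replacing h' by h/2 costs the power of 2.
    obtain ⟨C, hC⟩ := hA ((2 * K + 1) * q)
    refine ⟨2 ^ ((2 * K + 1) * q) * |C| + Cm * (I + J), by positivity, ?_⟩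
    intro h h' η hh hh' hη hd
    have hh0 : 0 < h := by linarith
    have hη0 : 0 < η := by rw [hη]; positivity
    have hη1 : η ≤ 1 := by
      rw [hη]
      exact pow_le_one₀ (by positivity) (by rw [div_le_one hh0]; exact hh)
    have hηh : η * h ^ q = 1 := by
      rw [hη, ← mul_pow, one_div, inv_mul_cancel₀ hh0.ne', one_pow]
    have h1 := hC (η ^ 2) h' (by positivity) (by nlinarith) (by linarith)
    have h2 := hmavg h h' (η ^ 2) (by positivity)
    set S := ∫ v, (E (h' + η ^ 2 * v) - m (h' + η ^ 2 * v)) * φ v with hS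
    have hSeq : S = (∫ v, E (h' + η ^ 2 * v) * φ v) - ∫ v, m (h' + η ^ 2 * v) * φ v := by
      rw [← integral_sub (hEint _ _) (hmint _ _), hS]
      congr 1; ext v; ring
    have hSb : |S| ≤ 2 ^ ((2 * K + 1) * q) * |C| * η := by
      have h3 : (h / 2) ^ ((2 * K + 1) * q) ≤ h' ^ ((2 * K + 1) * q) :=
        pow_le_pow_left₀ (by positivity) hh' _
      have h4 : (η ^ 2) ^ K * (h / 2) ^ ((2 * K + 1) * q) * |S| ≤ |C| := by
        refine le_trans ?_ (h1.trans (le_abs_self C))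
        gcongr
      have h5 : (η ^ 2) ^ K * h ^ ((2 * K + 1) * q) * η = 1 := by
        calc (η ^ 2) ^ K * h ^ ((2 * K + 1) * q) * η = (η * h ^ q) ^ (2 * K + 1) := by
              rw [mul_pow, ← pow_mul, ← pow_mul, mul_comm q (2 * K + 1), pow_succ η (2 * K)]
              ring
          _ = 1 := by rw [hηh, one_pow]
      have h6 : |S| = 2 ^ ((2 * K + 1) * q) *
          ((η ^ 2) ^ K * (h / 2) ^ ((2 * K + 1) * q) * |S|) * η := by
        rw [div_pow]
        have h2p : (2 : ℝ) ^ ((2 * K + 1) * q) ≠ 0 := by positivity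
        field_simp
        linear_combination (-|S|) * h5
      rw [h6]
      gcongr
    have h7 : (∫ v, E (h' + η ^ 2 * v) * φ v) - m h * I
        = S + ((∫ v, m (h' + η ^ 2 * v) * φ v) - m h * I) := by rw [hSeq]; ring
    rw [h7]
    refine (abs_add_le _ _).trans ?_
    have h8 : Cm * (|h' - h| * I + η ^ 2 * J) ≤ Cm * (η * I + η * J) := by
      have : η ^ 2 ≤ η := by nlinarith
      gcongr
    nlinarith
  have hηfacts : ∀ (q : ℕ) (h : ℝ), 1 ≤ h → 0 < (1 / h) ^ q ∧ (1 / h) ^ q ≤ 1 := by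
    intro q h hh
    exact ⟨by positivity, pow_le_one₀ (by positivity) (by rw [div_le_one (by linarith)]; exact hh)⟩
  have hupper : ∀ q : ℕ, ∃ C : ℝ, 0 ≤ C ∧ ∀ h : ℝ, 1 ≤ h →
      E h * (I - (1 / h) ^ q * (J + 2 * I)) ≤ m h * I + C * (1 / h) ^ q := by
    intro q
    obtain ⟨C, hC0, hC⟩ := hsmooth q
    refine ⟨C, hC0, fun h hh => ?_⟩
    obtain ⟨hη0, hη1⟩ := hηfacts q h hh
    set η := (1 / h) ^ q with hη
    have h1 := hC h (h + η) η hh (by linarith) hη (by rw [add_sub_cancel_left, abs_of_pos hη0])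
    -- For |v| ≤ 1/η the argument lies in [h, h + 2η], where monotonicity applies. Beyond that, φ -
    -- η|v|φ is nonpositive and E ≥ 0 is enough. Hence one first moment of φ suffices and the tail
    -- costs only ηJ.
    have h2 : E h * Real.exp (-(2 * η)) * (I - η * J) ≤ ∫ v, E (h + η + η ^ 2 * v) * φ v := by
      have h3 : E h * Real.exp (-(2 * η)) * (I - η * J)
          = ∫ v, E h * Real.exp (-(2 * η)) * (φ v - η * (|v| * φ v)) := by
        rw [integral_const_mul, integral_sub hφi (hφ1.const_mul _), integral_const_mul]
      rw [h3]
      refine integral_mono ((hφi.sub (hφ1.const_mul _)).const_mul _) (hEint _ _) fun v => ?_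
      have hE' : 0 ≤ E h * Real.exp (-(2 * η)) := mul_nonneg (hE0 h) (Real.exp_pos _).le
      change E h * Real.exp (-(2 * η)) * (φ v - η * (|v| * φ v)) ≤ E (h + η + η ^ 2 * v) * φ v
      by_cases hv : η * |v| ≤ 1
      · have h4 : |η ^ 2 * v| ≤ η := by
          rw [abs_mul, abs_of_pos (by positivity)]
          nlinarith
        have h5 := abs_le.1 h4
        have h6 := hmono h (h + η + η ^ 2 * v) (by linarith)
        have h7 : E h * Real.exp (-(2 * η)) ≤ E (h + η + η ^ 2 * v) := by
          have h8 : E h * Real.exp h ≤ E (h + η + η ^ 2 * v) * Real.exp (h + 2 * η) :=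
            h6.trans (mul_le_mul_of_nonneg_left (Real.exp_le_exp.2 (by linarith)) (hE0 _))
          have h9 : Real.exp h = Real.exp (-(2 * η)) * Real.exp (h + 2 * η) := by
            rw [← Real.exp_add]; congr 1; ring
          rw [h9, ← mul_assoc] at h8
          exact le_of_mul_le_mul_right h8 (Real.exp_pos _)
        have h10 : φ v - η * (|v| * φ v) ≤ φ v := by
          have := mul_nonneg hη0.le (mul_nonneg (abs_nonneg v) (hφ0 v))
          linarith
        exact (mul_le_mul_of_nonneg_left h10 hE').trans (mul_le_mul_of_nonneg_right h7 (hφ0 v))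
      · push Not at hv
        have h4 : φ v - η * (|v| * φ v) ≤ 0 := by
          have := mul_nonneg (sub_nonneg.2 hv.le) (hφ0 v)
          nlinarith
        exact (mul_nonpos_of_nonneg_of_nonpos hE' h4).trans (mul_nonneg (hE0 _) (hφ0 v))
    have h3 : E h * (I - η * (J + 2 * I)) ≤ E h * Real.exp (-(2 * η)) * (I - η * J) := by
      rw [mul_assoc]
      refine mul_le_mul_of_nonneg_left ?_ (hE0 h)
      have e1 : 1 - 2 * η ≤ Real.exp (-(2 * η)) := by
        have := Real.add_one_le_exp (-(2 * η)); linarith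
      have e2 : Real.exp (-(2 * η)) ≤ 1 := Real.exp_le_one_iff.2 (by linarith)
      have e3 : 0 ≤ η * J := mul_nonneg hη0.le hJ
      nlinarith
    have := (abs_le.1 h1).2
    linarith
  -- The upper estimate with q = 1 already bounds E: beyond h₀ the factor of E(h) is at least I/2.
  -- The lower estimate needs this bound, since there the tail of the average must be bounded from
  -- above.
  have hbdd : ∃ CE : ℝ, 0 ≤ CE ∧ ∀ u, E u ≤ CE := by
    obtain ⟨C, hC0, hC⟩ := hupper 1
    have hJI : 0 < J + 2 * I := by linarith
    set h₀ := max 1 (2 * (J + 2 * I) / I) with hh₀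
    have hh₀1 : 1 ≤ h₀ := le_max_left _ _
    have hC₀ : 0 ≤ C₀ := by
      have := (hE0 0).trans (hgrow 0)
      simpa using this
    have hlarge : ∀ h, h₀ ≤ h → E h ≤ 2 * (Cm + C / I) := by
      intro h hh
      have hh1 : 1 ≤ h := hh₀1.trans hh
      have h1 := hC h hh1
      rw [pow_one] at h1
      have h2 : 1 / h * (J + 2 * I) ≤ I / 2 := by
        have h3 : 2 * (J + 2 * I) / I ≤ h := (le_max_right _ _).trans hh
        rw [div_le_iff₀ hI] at h3
        rw [one_div, inv_mul_le_iff₀ (by linarith)]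
        linarith
      have h4 : E h * (I / 2) ≤ Cm * I + C := by
        have h5 : E h * (I / 2) ≤ E h * (I - 1 / h * (J + 2 * I)) :=
          mul_le_mul_of_nonneg_left (by linarith) (hE0 h)
        have h6 : m h * I ≤ Cm * I := mul_le_mul_of_nonneg_right ((le_abs_self _).trans (hm h)) hI.le
        have h7 : C * (1 / h) ≤ C := by
          refine mul_le_of_le_one_right hC0 ?_
          rw [div_le_one (by linarith)]; exact hh1
        linarith
      have h8 : 2 * (Cm + C / I) * (I / 2) = Cm * I + C := by field_simp
      rw [← h8] at h4
      exact le_of_mul_le_mul_right h4 (by linarith)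
    refine ⟨2 * (Cm + C / I) * Real.exp h₀ + C₀ * (1 + h₀) * Real.exp h₀, by positivity, fun u => ?_⟩
    have he : 1 ≤ Real.exp h₀ := Real.one_le_exp (by linarith)
    have t1 : 0 ≤ 2 * (Cm + C / I) := by positivity
    have t2 : 0 ≤ C₀ * (1 + h₀) := by positivity
    rcases le_total h₀ u with hu | hu
    · have := hlarge u hu
      nlinarith
    · rcases lt_or_ge u 0 with hu0 | hu0
      · rw [hEneg u hu0]
        positivity
      · have h9 : |u| ≤ h₀ := by rwa [abs_of_nonneg hu0]
        have h10 := hgrow u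
        have h11 : C₀ * (1 + |u|) ≤ C₀ * (1 + h₀) := by gcongr
        nlinarith
  obtain ⟨CE, hCE0, hCE⟩ := hbdd
  obtain ⟨C₁, hC₁0, hC₁⟩ := hupper p
  obtain ⟨C₂, hC₂0, hC₂⟩ := hsmooth p
  have hup : ∀ h : ℝ, 1 ≤ h →
      (E h - m h) * I ≤ (C₁ + CE * (J + 2 * I)) * (1 / h) ^ p := by
    intro h hh
    obtain ⟨hη0, hη1⟩ := hηfacts p h hh
    have h1 := hC₁ h hh
    have h2 : E h * ((1 / h) ^ p * (J + 2 * I)) ≤ CE * ((1 / h) ^ p * (J + 2 * I)) :=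
      mul_le_mul_of_nonneg_right (hCE h) (by positivity)
    nlinarith
  -- The restriction h ≥ 2 ensures h - η ≥ h/2, as η ≤ 1.
  have hlow : ∀ h : ℝ, 2 ≤ h →
      (m h - E h) * I ≤ (C₂ + CE * (J + 16 * I)) * (1 / h) ^ p := by
    intro h hh
    obtain ⟨hη0, hη1⟩ := hηfacts p h (by linarith)
    set η := (1 / h) ^ p with hη
    have h1 := hC₂ h (h - η) η (by linarith) (by linarith) hη
      (by rw [sub_sub_cancel_left, abs_neg, abs_of_pos hη0])
    have h2 : ∫ v, E (h - η + η ^ 2 * v) * φ v ≤ E h * Real.exp (2 * η) * I + CE * η * J := by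
      have h3 : E h * Real.exp (2 * η) * I + CE * η * J
          = ∫ v, (E h * Real.exp (2 * η) * φ v + CE * η * (|v| * φ v)) := by
        rw [integral_add (hφi.const_mul _) (hφ1.const_mul _), integral_const_mul,
          integral_const_mul]
      rw [h3]
      refine integral_mono (hEint _ _) ((hφi.const_mul _).add (hφ1.const_mul _)) fun v => ?_
      change E (h - η + η ^ 2 * v) * φ v
        ≤ E h * Real.exp (2 * η) * φ v + CE * η * (|v| * φ v)
      by_cases hv : η * |v| ≤ 1
      · have h4 : |η ^ 2 * v| ≤ η := by
          rw [abs_mul, abs_of_pos (by positivity)]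
          nlinarith
        have h5 := abs_le.1 h4
        have h6 := hmono (h - η + η ^ 2 * v) h (by linarith)
        have h7 : E (h - η + η ^ 2 * v) ≤ E h * Real.exp (2 * η) := by
          have h8 : E (h - η + η ^ 2 * v) * Real.exp (h - 2 * η) ≤ E h * Real.exp h :=
            (mul_le_mul_of_nonneg_left (Real.exp_le_exp.2 (by linarith)) (hE0 _)).trans h6
          have h9 : Real.exp h = Real.exp (2 * η) * Real.exp (h - 2 * η) := by
            rw [← Real.exp_add]; congr 1; ring
          rw [h9, ← mul_assoc] at h8
          exact le_of_mul_le_mul_right h8 (Real.exp_pos _)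
        have h10 : 0 ≤ CE * η * (|v| * φ v) :=
          mul_nonneg (by positivity) (mul_nonneg (abs_nonneg v) (hφ0 v))
        have := mul_le_mul_of_nonneg_right h7 (hφ0 v)
        linarith
      · push Not at hv
        have h4 : E (h - η + η ^ 2 * v) * φ v ≤ CE * φ v :=
          mul_le_mul_of_nonneg_right (hCE _) (hφ0 v)
        have h5 : CE * φ v * 1 ≤ CE * φ v * (η * |v|) :=
          mul_le_mul_of_nonneg_left hv.le (mul_nonneg hCE0 (hφ0 v))
        have h6 : 0 ≤ E h * Real.exp (2 * η) * φ v :=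
          mul_nonneg (mul_nonneg (hE0 h) (Real.exp_pos _).le) (hφ0 v)
        nlinarith
    -- From e^{2η} ≤ 1 + 2η e^{2η} and e^{2η} ≤ e² ≤ 8.
    have h3 : Real.exp (2 * η) ≤ 1 + 16 * η := by
      have e1 : Real.exp (2 * η) ≤ 1 + 2 * η * Real.exp (2 * η) := by
        have := Real.add_one_le_exp (-(2 * η))
        have e2 : Real.exp (-(2 * η)) * Real.exp (2 * η) = 1 := by
          rw [← Real.exp_add]; simp
        have e3 := mul_le_mul_of_nonneg_right this (Real.exp_pos (2 * η)).le
        rw [e2] at e3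
        linarith
      have e4 : Real.exp (2 * η) ≤ 8 := by
        have e5 : Real.exp (2 * η) ≤ Real.exp 1 * Real.exp 1 := by
          rw [← Real.exp_add]
          exact Real.exp_le_exp.2 (by linarith)
        have e6 := Real.exp_one_lt_d9
        have e7 := Real.exp_pos 1
        nlinarith
      nlinarith
    have h4 : E h * Real.exp (2 * η) * I ≤ E h * I + CE * (16 * η * I) := by
      have h5 : E h * Real.exp (2 * η) ≤ E h * (1 + 16 * η) :=
        mul_le_mul_of_nonneg_left h3 (hE0 h)
      have h6 : E h * (16 * η) ≤ CE * (16 * η) :=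
        mul_le_mul_of_nonneg_right (hCE h) (by positivity)
      have h7 : E h * Real.exp (2 * η) ≤ E h + CE * (16 * η) := by linarith
      have := mul_le_mul_of_nonneg_right h7 hI.le
      linarith
    have := (abs_le.1 h1).1
    linarith
  set A := (C₁ + CE * (J + 2 * I)) + (C₂ + CE * (J + 16 * I)) with hAdef
  have hA1 : 0 ≤ C₁ + CE * (J + 2 * I) := by positivity
  have hA2 : 0 ≤ C₂ + CE * (J + 16 * I) := by positivity
  refine ⟨max (A / I) (2 ^ p * (CE + Cm)), fun h hh => ?_⟩
  rcases le_total 2 h with h2 | h2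
  · refine le_trans ?_ (le_max_left _ _)
    have hp : (0 : ℝ) < h ^ p := by positivity
    have hη : h ^ p * (1 / h) ^ p = 1 := by
      rw [← mul_pow, mul_one_div_cancel (by linarith), one_pow]
    have hη0 : 0 < (1 / h) ^ p := (hηfacts p h hh).1
    have h3 : |E h - m h| * I ≤ A * (1 / h) ^ p := by
      rcases abs_cases (E h - m h) with ⟨h4, _⟩ | ⟨h4, _⟩
      · rw [h4, hAdef]
        have := hup h hh
        nlinarith
      · rw [h4, hAdef]
        have := hlow h h2
        nlinarith
    rw [le_div_iff₀ hI]
    calc h ^ p * |E h - m h| * I = h ^ p * (|E h - m h| * I) := by ring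
      _ ≤ h ^ p * (A * (1 / h) ^ p) := by gcongr
      _ = A * (h ^ p * (1 / h) ^ p) := by ring
      _ = A := by rw [hη, mul_one]
  · refine le_trans ?_ (le_max_right _ _)
    have h3 : |E h - m h| ≤ CE + Cm := by
      refine (abs_sub _ _).trans ?_
      rw [abs_of_nonneg (hE0 h)]
      exact add_le_add (hCE h) (hm h)
    gcongr

end TauberReal

/-! ### Smoothing with a kernel of compact Fourier support -/

lemma fourier_real_of_even {b : ℝ → ℝ} (hb : ∀ x, b (-x) = b x) (v : ℝ) :
    𝓕 (fun x => (b x : ℂ)) v = ((𝓕 (fun x => (b x : ℂ)) v).re : ℂ) := by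
  refine (Complex.conj_eq_iff_re.1 ?_).symm
  rw [Real.fourier_real_eq_integral_exp_smul, ← integral_conj, ← integral_neg_eq_self]
  congr 1
  ext x
  simp only [smul_eq_mul, map_mul, Complex.conj_ofReal, hb, ← Complex.exp_conj, Complex.conj_I]
  congr 2
  push_cast
  ring

/-- Take χ = b * b for an even real bump b. The transform of b is real by evenness, so that of χ is
a square; χ is Schwartz with compact support, and φ(0) = (∫ b)² > 0 makes the integral of φ
positive. -/
lemma exists_fourier_kernel : ∃ (χ : SchwartzMap ℝ ℂ) (φ : ℝ → ℝ), HasCompactSupport χ ∧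
    (∀ v, 0 ≤ φ v) ∧ (∀ v, 𝓕 (χ : ℝ → ℂ) v = φ v) ∧ Integrable φ ∧
    Integrable (fun v => |v| * φ v) ∧ 0 < ∫ v, φ v := by
  let b₀ : ContDiffBump (0 : ℝ) := ⟨1, 2, one_pos, one_lt_two⟩
  have hbs : ContDiff ℝ ∞ (fun x => (b₀ x : ℂ)) := Complex.ofRealCLM.contDiff.comp b₀.contDiff
  have hbc : HasCompactSupport (fun x => (b₀ x : ℂ)) :=
    b₀.hasCompactSupport.comp_left (g := fun r : ℝ => (r : ℂ)) (by simp)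
  let b : SchwartzMap ℝ ℂ := hbc.toSchwartzMap hbs
  have hbcoe : (b : ℝ → ℂ) = fun x => (b₀ x : ℂ) := rfl
  let χ : SchwartzMap ℝ ℂ := SchwartzMap.convolution (ContinuousLinearMap.mul ℂ ℂ) b b
  have hχ : ∀ v, 𝓕 (χ : ℝ → ℂ) v = ((((𝓕 (fun x => (b₀ x : ℂ)) v).re) ^ 2 : ℝ) : ℂ) := by
    intro v
    rw [← SchwartzMap.fourier_coe, SchwartzMap.fourier_convolution, SchwartzMap.pairing_apply_apply,
      SchwartzMap.fourier_coe, hbcoe]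
    simp only [ContinuousLinearMap.mul_apply']
    rw [fourier_real_of_even b₀.neg v]
    push_cast
    simp [sq]
  have hnorm : ∀ v, ‖(𝓕 χ) v‖ = ((𝓕 (fun x => (b₀ x : ℂ)) v).re) ^ 2 := by
    intro v
    rw [SchwartzMap.fourier_coe, hχ v, Complex.norm_real, Real.norm_eq_abs, abs_of_nonneg (sq_nonneg _)]
  have hint : Integrable fun v => ((𝓕 (fun x => (b₀ x : ℂ)) v).re) ^ 2 := by
    have := (SchwartzMap.integrable_pow_mul volume (𝓕 χ) 0)
    simpa [hnorm] using this
  refine ⟨χ, fun v => ((𝓕 (fun x => (b₀ x : ℂ)) v).re) ^ 2, ?_, fun v => sq_nonneg _, hχ, hint,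
    ?_, ?_⟩
  · have : (χ : ℝ → ℂ) = convolution (b : ℝ → ℂ) b (ContinuousLinearMap.mul ℂ ℂ) volume := by
      ext x
      exact SchwartzMap.convolution_apply _ b b x
    rw [this]
    exact HasCompactSupport.convolution _ hbc hbc
  · have := (SchwartzMap.integrable_pow_mul volume (𝓕 χ) 1)
    simpa [hnorm] using this
  · have hcont : Continuous fun v => ((𝓕 (fun x => (b₀ x : ℂ)) v).re) ^ 2 := by
      have : Continuous ((𝓕 b : SchwartzMap ℝ ℂ) : ℝ → ℂ) := SchwartzMap.continuous _
      rw [SchwartzMap.fourier_coe, hbcoe] at this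
      fun_prop
    refine integral_pos_of_integrable_nonneg_nonzero (x := 0) hcont hint (fun v => sq_nonneg _) ?_
    have h0 : 𝓕 (fun x => (b₀ x : ℂ)) 0 = ((∫ x, b₀ x : ℝ) : ℂ) := by
      rw [Real.fourier_real_eq_integral_exp_smul, ← integral_complex_ofReal]
      simp
    rw [h0, Complex.ofReal_re]
    exact pow_ne_zero 2 b₀.integral_pos.ne'

/-- Smooth functions on the line whose derivatives all grow at most like a fixed power. -/
def PolyBound (k : ℕ) (l : ℝ → ℂ) : Prop :=
  ContDiff ℝ ∞ l ∧ ∀ n : ℕ, ∃ C : ℝ, ∀ ξ : ℝ, ‖iteratedDeriv n l ξ‖ ≤ C * (1 + |ξ|) ^ k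

lemma PolyBound.mul {k j : ℕ} {f g : ℝ → ℂ} (hf : PolyBound k f) (hg : PolyBound j g) :
    PolyBound (k + j) (f * g) := by
  refine ⟨hf.1.mul hg.1, fun n => ?_⟩
  choose C hC using hf.2
  choose C' hC' using hg.2
  refine ⟨∑ i ∈ Finset.range (n + 1), n.choose i * C i * C' (n - i), fun ξ => ?_⟩
  rw [iteratedDeriv_mul (hf.1.contDiffAt.of_le (by exact_mod_cast le_top))
    (hg.1.contDiffAt.of_le (by exact_mod_cast le_top)), Finset.sum_mul]
  refine norm_sum_le_of_le _ fun i _ => ?_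
  rw [norm_mul, norm_mul, Complex.norm_natCast]
  have h1 := hC i ξ
  have h2 := hC' (n - i) ξ
  have h3 := (norm_nonneg _).trans h1
  calc (n.choose i : ℝ) * ‖iteratedDeriv i f ξ‖ * ‖iteratedDeriv (n - i) g ξ‖
      ≤ (n.choose i : ℝ) * (C i * (1 + |ξ|) ^ k) * (C' (n - i) * (1 + |ξ|) ^ j) := by gcongr
    _ = _ := by rw [pow_add]; ring

section Cutoff

variable {χ : SchwartzMap ℝ ℂ} {l : ℝ → ℂ} {k : ℕ}

lemma exists_support_bound (hχ : HasCompactSupport χ) :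
    ∃ R : ℝ, 0 < R ∧ ∀ x, R < |x| → χ x = 0 := by
  obtain ⟨R, hR⟩ := hχ.isCompact.isBounded.subset_closedBall (0 : ℝ)
  refine ⟨max R 1, by positivity, fun x hx => ?_⟩
  by_contra h
  have := hR (subset_tsupport _ h)
  rw [Metric.mem_closedBall, dist_zero_right, Real.norm_eq_abs] at this
  exact absurd hx (not_lt.2 (this.trans (le_max_left _ _)))

/-- Integrate by parts n times. The integrand lives on |ξ| ≤ R/τ, where the derivatives of l are
O((1 + R/τ)^k); the length of this interval costs one more factor 1/τ. Derivatives falling on χ(τξ)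
only gain factors τ ≤ 1, so the exponent k + 1 does not depend on n. -/
lemma cutoff_fourier_bound (hχ : HasCompactSupport χ) (hl : PolyBound k l) (n : ℕ) :
    ∃ C : ℝ, ∀ τ h : ℝ, 0 < τ → τ ≤ 1 → 0 < h →
      τ ^ (k + 1) * h ^ n * ‖𝓕 (fun ξ => χ (τ * ξ) * l ξ) (-h)‖ ≤ C := by
  obtain ⟨R, hR0, hR⟩ := exists_support_bound hχ
  have hχb : ∀ j : ℕ, ∃ C : ℝ, ∀ x, ‖iteratedDeriv j χ x‖ ≤ C := by
    intro j
    obtain ⟨C, _, hC⟩ := χ.decay 0 j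
    refine ⟨C, fun x => ?_⟩
    have := hC x
    rwa [pow_zero, one_mul, norm_iteratedFDeriv_eq_norm_iteratedDeriv] at this
  choose A hA using hχb
  choose B hB using hl.2
  have hA0 : ∀ j, 0 ≤ A j := fun j => (norm_nonneg _).trans (hA j 0)
  have hB0 : ∀ j, 0 ≤ B j := by
    intro j
    have := (norm_nonneg _).trans (hB j 0)
    simpa using this
  set S : ℕ → ℝ := fun n => ∑ i ∈ Finset.range (n + 1), n.choose i * A i * B (n - i) with hS
  have hS0 : ∀ n, 0 ≤ S n := fun n => Finset.sum_nonneg fun i _ =>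
    mul_nonneg (mul_nonneg (by positivity) (hA0 _)) (hB0 _)
  refine ⟨S n * (1 + R) ^ k * (2 * R), fun τ h hτ hτ1 hh => ?_⟩
  set w : ℝ → ℂ := (fun ξ => χ (τ * ξ)) * l with hw
  have hχτ : ContDiff ℝ ∞ (fun ξ => χ (τ * ξ)) := χ.smooth'.comp (contDiff_const.mul contDiff_id)
  have hwC : ContDiff ℝ ∞ w := hχτ.mul hl.1
  have hw0 : ∀ j ξ, R / τ < |ξ| → iteratedDeriv j w ξ = 0 := by
    intro j ξ hξ
    have hopen : IsOpen {ξ : ℝ | R / τ < |ξ|} := isOpen_lt continuous_const continuous_abs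
    have : w =ᶠ[𝓝 ξ] fun _ => 0 := by
      filter_upwards [hopen.mem_nhds hξ] with y hy
      have : R < |τ * y| := by
        rw [abs_mul, abs_of_pos hτ, mul_comm]
        exact (div_lt_iff₀ hτ).1 hy
      simp [hw, hR _ this]
    rw [this.iteratedDeriv_eq j]
    simp
  have hwb : ∀ j ξ, ‖iteratedDeriv j w ξ‖ ≤ (Set.Icc (-(R / τ)) (R / τ)).indicator
      (fun _ => S j * (1 + R / τ) ^ k) ξ := by
    intro j ξ
    by_cases hξ : ξ ∈ Set.Icc (-(R / τ)) (R / τ)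
    · rw [Set.indicator_of_mem hξ]
      have hξ' : |ξ| ≤ R / τ := abs_le.2 hξ
      rw [hw, iteratedDeriv_mul (hχτ.contDiffAt.of_le (by exact_mod_cast le_top))
        (hl.1.contDiffAt.of_le (by exact_mod_cast le_top)), hS, Finset.sum_mul]
      refine norm_sum_le_of_le _ fun i _ => ?_
      rw [norm_mul, norm_mul, Complex.norm_natCast]
      have h1 : ‖iteratedDeriv i (fun ξ => χ (τ * ξ)) ξ‖ ≤ A i := by
        have hs : ContDiff ℝ i (χ : ℝ → ℂ) := χ.smooth'.of_le (by exact_mod_cast le_top)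
        rw [iteratedDeriv_comp_const_smul hs]
        rw [norm_smul, norm_pow, Real.norm_eq_abs, abs_of_pos hτ]
        calc τ ^ i * ‖iteratedDeriv i χ (τ * ξ)‖ ≤ 1 * A i := by
              gcongr
              · exact pow_le_one₀ hτ.le hτ1
              · exact hA i _
          _ = A i := one_mul _
      have h2 : ‖iteratedDeriv (j - i) l ξ‖ ≤ B (j - i) * (1 + R / τ) ^ k :=
        (hB (j - i) ξ).trans (mul_le_mul_of_nonneg_left
          (pow_le_pow_left₀ (by positivity) (by linarith) _) (hB0 _))
      calc (j.choose i : ℝ) * ‖iteratedDeriv i (fun ξ => χ (τ * ξ)) ξ‖ * ‖iteratedDeriv (j - i) l ξ‖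
          ≤ (j.choose i : ℝ) * A i * (B (j - i) * (1 + R / τ) ^ k) := by
            have := hA0 i
            gcongr
        _ = _ := by ring
    · rw [Set.indicator_of_notMem hξ, hw0 j ξ, norm_zero]
      by_contra hc
      exact hξ (abs_le.1 (not_lt.1 hc))
  have hindint : ∀ j, Integrable ((Set.Icc (-(R / τ)) (R / τ)).indicator
      (fun _ => S j * (1 + R / τ) ^ k)) := fun j =>
    (integrable_indicator_iff measurableSet_Icc).2 (integrableOn_const (by simp))
  have hwint : ∀ j : ℕ, Integrable (iteratedDeriv j w) := fun j =>
    Integrable.mono' (hindint j)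
      (hwC.continuous_iteratedDeriv j (by exact_mod_cast le_top)).aestronglyMeasurable
      (Filter.Eventually.of_forall (hwb j))
  have hF := congrFun (Real.fourier_iteratedDeriv (N := ⊤) hwC (fun j _ => hwint j)
    (n := n) le_top) (-h)
  have hn1 : ‖𝓕 (iteratedDeriv n w) (-h)‖ ≤ S n * (1 + R / τ) ^ k * (2 * (R / τ)) := by
    refine (VectorFourier.norm_fourierIntegral_le_integral_norm _ _ _ _ _).trans ?_
    refine (integral_mono (hwint n).norm (hindint n) (hwb n)).trans (le_of_eq ?_)
    rw [integral_indicator_const _ measurableSet_Icc, Measure.real, Real.volume_Icc,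
      ENNReal.toReal_ofReal (by have : 0 < R / τ := by positivity
                                linarith), smul_eq_mul]
    ring
  have hn2 : h ^ n * ‖𝓕 w (-h)‖ ≤ ‖𝓕 (iteratedDeriv n w) (-h)‖ := by
    rw [hF]
    simp only [norm_smul, norm_pow, norm_mul, Complex.norm_I, Complex.norm_real, Complex.norm_ofNat,
      Real.norm_eq_abs, abs_neg, abs_of_pos hh, abs_of_pos Real.pi_pos]
    have : 1 ≤ 2 * Real.pi := by linarith [Real.pi_gt_three]
    gcongr
    nlinarith
  have hR1 : (1 + R / τ) * τ ≤ 1 + R := by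
    rw [add_mul, div_mul_cancel₀ _ hτ.ne']
    linarith
  calc τ ^ (k + 1) * h ^ n * ‖𝓕 w (-h)‖ = τ ^ (k + 1) * (h ^ n * ‖𝓕 w (-h)‖) := by ring
    _ ≤ τ ^ (k + 1) * (S n * (1 + R / τ) ^ k * (2 * (R / τ))) := by
        exact mul_le_mul_of_nonneg_left (hn2.trans hn1) (by positivity)
    _ = S n * ((1 + R / τ) * τ) ^ k * (2 * R) := by
        rw [mul_pow, pow_succ]
        field_simp
    _ ≤ S n * (1 + R) ^ k * (2 * R) := by
        have := hS0 n
        gcongr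

end Cutoff

section Smoothing

variable {D : ℝ → ℝ} {C₀ : ℝ} {χ : SchwartzMap ℝ ℂ} {φ : ℝ → ℝ} {l : ℝ → ℂ}

lemma integrable_damped (hDm : Measurable D) (hD : ∀ u, |D u| ≤ C₀ * (1 + |u|))
    (hD0 : ∀ u < 0, D u = 0) {δ : ℝ} (hδ : 0 < δ) :
    Integrable fun u => ((D u * Real.exp (-δ * u) : ℝ) : ℂ) := by
  suffices h : Integrable fun u => D u * Real.exp (-δ * u) from h.ofReal
  have hC : 0 ≤ C₀ := by simpa using (abs_nonneg _).trans (hD 0)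
  have hint : Integrable ((Set.Ici (0 : ℝ)).indicator
      fun u => C₀ * (1 + 2 / δ) * Real.exp (-(δ / 2) * u)) := by
    rw [integrable_indicator_iff measurableSet_Ici, integrableOn_Ici_iff_integrableOn_Ioi]
    exact (exp_neg_integrableOn_Ioi 0 (by positivity)).const_mul _
  refine Integrable.mono' hint (by fun_prop) (Filter.Eventually.of_forall fun u => ?_)
  rcases lt_or_ge u 0 with hu | hu
  · rw [hD0 u hu, zero_mul, norm_zero]
    exact Set.indicator_nonneg (fun u _ => by positivity) u
  · rw [Set.indicator_of_mem (by exact hu), norm_mul, Real.norm_eq_abs, Real.norm_eq_abs, Real.abs_exp]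
    have h1 := hD u
    rw [abs_of_nonneg hu] at h1
    have h2 : 1 + u ≤ (1 + 2 / δ) * Real.exp (δ / 2 * u) := by
      have h3 := Real.add_one_le_exp (δ / 2 * u)
      have h4 : u = 2 / δ * (δ / 2 * u) := by field_simp
      have h5 : 2 / δ * (δ / 2 * u) ≤ 2 / δ * Real.exp (δ / 2 * u) := by
        gcongr; linarith
      have h6 : 1 ≤ Real.exp (δ / 2 * u) := Real.one_le_exp (by positivity)
      linarith
    have h7 : Real.exp (δ / 2 * u) * Real.exp (-δ * u) = Real.exp (-(δ / 2) * u) := by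
      rw [← Real.exp_add]; congr 1; ring
    calc |D u| * Real.exp (-δ * u)
        ≤ C₀ * ((1 + 2 / δ) * Real.exp (δ / 2 * u)) * Real.exp (-δ * u) := by
          gcongr
          exact h1.trans (by gcongr)
      _ = C₀ * (1 + 2 / δ) * (Real.exp (δ / 2 * u) * Real.exp (-δ * u)) := by ring
      _ = _ := by rw [h7]

lemma integral_comp_affine (F : ℝ → ℂ) (h : ℝ) {τ : ℝ} (hτ : 0 < τ) :
    (τ : ℂ) * ∫ v, F (h + τ * v) = ∫ u, F u := by
  rw [Measure.integral_comp_mul_left (fun v => F (h + v)) τ, integral_add_left_eq_self,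
    abs_of_pos (inv_pos.2 hτ), Complex.real_smul, ← mul_assoc, ← Complex.ofReal_mul,
    mul_inv_cancel₀ hτ.ne', Complex.ofReal_one, one_mul]

/-- The multiplication formula ∫ χ̂ g = ∫ χ ĝ, followed by the affine change of variable: the scale
τ passes to χ and the shift h becomes a phase. -/
lemma integral_fourier_mul_comp_affine (χ : SchwartzMap ℝ ℂ) {g : ℝ → ℂ} (hg : Integrable g)
    (h : ℝ) {τ : ℝ} (hτ : 0 < τ) :
    ∫ v, 𝓕 (χ : ℝ → ℂ) v * g (h + τ * v)
      = ∫ ξ, χ (τ * ξ) * (Complex.exp (((2 * Real.pi * h * ξ : ℝ) : ℂ) * Complex.I) * 𝓕 g ξ) := by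
  have hg' : Integrable fun v => g (h + τ * v) := (hg.comp_add_left h).comp_mul_left' hτ.ne'
  have h1 : ∫ v, 𝓕 (χ : ℝ → ℂ) v * g (h + τ * v)
      = ∫ ξ, χ ξ * 𝓕 (fun v => g (h + τ * v)) ξ := by
    simpa using! (VectorFourier.integral_fourierIntegral_smul_eq_flip (L := innerₗ ℝ)
      Real.continuous_fourierChar continuous_inner (χ.integrable (μ := volume)) hg')
  rw [h1, ← integral_comp_affine _ 0 hτ, ← integral_const_mul]
  congr 1
  ext ξ
  rw [zero_add, mul_left_comm]
  congr 1
  rw [Real.fourier_real_eq_integral_exp_smul, Real.fourier_real_eq_integral_exp_smul]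
  conv_rhs => rw [← integral_comp_affine _ h hτ, mul_left_comm]
  congr 1
  rw [← integral_const_mul]
  congr 1
  ext v
  simp only [smul_eq_mul]
  conv_rhs => rw [← mul_assoc, ← Complex.exp_add]
  congr 2
  push_cast
  ring

/-- D need not be integrable, so the identity is proved for D(u)e^{-δu} and δ tends to 0 from the
right. On the left the damping is at most 1 wherever D is nonzero; on the right χ restricts to a
bounded range of frequencies, where the transforms are uniformly bounded. -/
theorem smoothing_identity (hχ : HasCompactSupport χ) (hφ : ∀ v, 𝓕 (χ : ℝ → ℂ) v = φ v)
    (hφi : Integrable φ) (hφ1 : Integrable fun v => |v| * φ v)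
    (hDm : Measurable D) (hD : ∀ u, |D u| ≤ C₀ * (1 + |u|)) (hD0 : ∀ u < 0, D u = 0)
    (hlim : ∀ ξ : ℝ, Tendsto (fun δ : ℝ => 𝓕 (fun u => ((D u * Real.exp (-δ * u) : ℝ) : ℂ)) ξ)
      (𝓝[>] 0) (𝓝 (l ξ)))
    (hbdd : ∀ R : ℝ, ∃ C : ℝ, ∀ᶠ δ in 𝓝[>] (0 : ℝ), ∀ ξ : ℝ, |ξ| ≤ R →
      ‖𝓕 (fun u => ((D u * Real.exp (-δ * u) : ℝ) : ℂ)) ξ‖ ≤ C)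
    (h : ℝ) {τ : ℝ} (hτ : 0 < τ) :
    ((∫ v, D (h + τ * v) * φ v : ℝ) : ℂ) = 𝓕 (fun ξ => χ (τ * ξ) * l ξ) (-h) := by
  have hL : Tendsto (fun δ : ℝ => ∫ v, 𝓕 (χ : ℝ → ℂ) v *
      ((D (h + τ * v) * Real.exp (-δ * (h + τ * v)) : ℝ) : ℂ)) (𝓝[>] 0)
      (𝓝 (∫ v, ((D (h + τ * v) * φ v : ℝ) : ℂ))) := by
    have hφm := hφi.aestronglyMeasurable
    refine tendsto_integral_filter_of_dominated_convergence (fun v => ‖D (h + τ * v) * φ v‖)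
      (Filter.Eventually.of_forall fun δ => ?_) ?_
      (integrable_comp_mul_kernel hDm hφi hφ1 hD h τ).norm ?_
    · simp_rw [hφ]
      refine AEStronglyMeasurable.mul ?_ ?_
      · exact Complex.continuous_ofReal.comp_aestronglyMeasurable hφm
      · have : Measurable fun v : ℝ => D (h + τ * v) := hDm.comp (by fun_prop)
        refine Measurable.aestronglyMeasurable ?_
        fun_prop
    · filter_upwards [self_mem_nhdsWithin] with δ hδ
      refine Filter.Eventually.of_forall fun v => ?_
      rw [hφ, ← Complex.ofReal_mul, Complex.norm_real]
      rcases lt_or_ge (h + τ * v) 0 with hv | hv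
      · simp [hD0 _ hv]
      · rw [norm_mul, norm_mul, norm_mul, Real.norm_eq_abs (Real.exp _), Real.abs_exp]
        have : Real.exp (-δ * (h + τ * v)) ≤ 1 := by
          rw [Real.exp_le_one_iff]
          have : 0 < δ := hδ
          nlinarith
        calc ‖φ v‖ * (‖D (h + τ * v)‖ * Real.exp (-δ * (h + τ * v)))
            ≤ ‖φ v‖ * (‖D (h + τ * v)‖ * 1) := by gcongr
          _ = _ := by ring
    · refine Filter.Eventually.of_forall fun v => ?_
      have hc : Continuous fun δ : ℝ => 𝓕 (χ : ℝ → ℂ) v *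
          ((D (h + τ * v) * Real.exp (-δ * (h + τ * v)) : ℝ) : ℂ) := by fun_prop
      have := (hc.tendsto 0).mono_left (nhdsWithin_le_nhds (s := Set.Ioi 0))
      refine this.trans_eq ?_
      rw [hφ]
      congr 1
      push_cast
      simp [mul_comm]
  have hRt : Tendsto (fun δ : ℝ => ∫ ξ, χ (τ * ξ) *
      (Complex.exp (((2 * Real.pi * h * ξ : ℝ) : ℂ) * Complex.I) *
        𝓕 (fun u => ((D u * Real.exp (-δ * u) : ℝ) : ℂ)) ξ)) (𝓝[>] 0)
      (𝓝 (∫ ξ, χ (τ * ξ) * (Complex.exp (((2 * Real.pi * h * ξ : ℝ) : ℂ) * Complex.I) * l ξ))) := by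
    obtain ⟨R, hR0, hR⟩ := exists_support_bound hχ
    obtain ⟨C, hC⟩ := hbdd (R / τ)
    obtain ⟨A, hA0, hA⟩ := χ.decay 0 0
    have hA' : ∀ x, ‖χ x‖ ≤ A := fun x => by simpa using hA x
    refine tendsto_integral_filter_of_dominated_convergence
      ((Set.Icc (-(R / τ)) (R / τ)).indicator (fun _ => A * C)) ?_ ?_ ?_ ?_
    · filter_upwards [self_mem_nhdsWithin] with δ hδ
      have hcont : Continuous (𝓕 (fun u => ((D u * Real.exp (-δ * u) : ℝ) : ℂ))) :=
        VectorFourier.fourierIntegral_continuous Real.continuous_fourierChar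
          (by exact continuous_inner) (integrable_damped hDm hD hD0 hδ)
      have := χ.continuous
      exact Continuous.aestronglyMeasurable (by fun_prop)
    · filter_upwards [hC] with δ hδ
      refine Filter.Eventually.of_forall fun ξ => ?_
      by_cases hξ : ξ ∈ Set.Icc (-(R / τ)) (R / τ)
      · rw [Set.indicator_of_mem hξ, norm_mul, norm_mul, Complex.norm_exp_ofReal_mul_I, one_mul]
        exact mul_le_mul (hA' _) (hδ ξ (abs_le.2 hξ)) (norm_nonneg _) hA0.le
      · have hξ' : R < |τ * ξ| := by
          rw [abs_mul, abs_of_pos hτ, mul_comm]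
          refine (div_lt_iff₀ hτ).1 ?_
          by_contra hc
          exact hξ (abs_le.1 (not_lt.1 hc))
        rw [Set.indicator_of_notMem hξ, hR _ hξ', zero_mul, norm_zero]
    · exact (integrable_indicator_iff measurableSet_Icc).2 (integrableOn_const (by simp))
    · exact Filter.Eventually.of_forall fun ξ => ((hlim ξ).const_mul _).const_mul _
  have heq : (fun δ : ℝ => ∫ v, 𝓕 (χ : ℝ → ℂ) v *
      ((D (h + τ * v) * Real.exp (-δ * (h + τ * v)) : ℝ) : ℂ)) =ᶠ[𝓝[>] 0]
      (fun δ : ℝ => ∫ ξ, χ (τ * ξ) *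
      (Complex.exp (((2 * Real.pi * h * ξ : ℝ) : ℂ) * Complex.I) *
        𝓕 (fun u => ((D u * Real.exp (-δ * u) : ℝ) : ℂ)) ξ)) := by
    filter_upwards [self_mem_nhdsWithin] with δ hδ
    exact integral_fourier_mul_comp_affine χ (integrable_damped hDm hD hD0 hδ) h hτ
  rw [← integral_complex_ofReal, tendsto_nhds_unique hL (hRt.congr' heq.symm),
    Real.fourier_real_eq_integral_exp_smul]
  congr 1
  ext ξ
  simp only [smul_eq_mul]
  rw [mul_left_comm]
  congr 3
  push_cast
  ring

/-- A Tauberian theorem with remainder `O(u^{-p})` for every `p`: the transform of `E - m` extends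
to the boundary as a smooth function all of whose derivatives grow at most like a fixed power. -/
theorem tauberian {E m : ℝ → ℝ} {Cm : ℝ} {k : ℕ}
    (hE0 : ∀ u, 0 ≤ E u) (hEneg : ∀ u < 0, E u = 0) (hEm : Measurable E)
    (hmono : ∀ u v, u ≤ v → E u * Real.exp u ≤ E v * Real.exp v)
    (hgrow : ∀ u, E u ≤ C₀ * (1 + |u|)) (hmneg : ∀ u < 0, m u = 0)
    (hm : ∀ u, |m u| ≤ Cm) (hmL : ∀ u v, |m u - m v| ≤ Cm * |u - v|) (hl : PolyBound k l)
    (hlim : ∀ ξ : ℝ, Tendsto (fun δ : ℝ =>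
      𝓕 (fun u => (((E u - m u) * Real.exp (-δ * u) : ℝ) : ℂ)) ξ) (𝓝[>] 0) (𝓝 (l ξ)))
    (hbdd : ∀ R : ℝ, ∃ C : ℝ, ∀ᶠ δ in 𝓝[>] (0 : ℝ), ∀ ξ : ℝ, |ξ| ≤ R →
      ‖𝓕 (fun u => (((E u - m u) * Real.exp (-δ * u) : ℝ) : ℂ)) ξ‖ ≤ C) (p : ℕ) :
    ∃ C : ℝ, ∀ u : ℝ, 1 ≤ u → u ^ p * |E u - m u| ≤ C := by
  obtain ⟨χ, φ, hχ, hφ0, hφ, hφi, hφ1, hI⟩ := exists_fourier_kernel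
  have hCm : 0 ≤ Cm := (abs_nonneg _).trans (hm 0)
  have hmm : Measurable m := by
    have : LipschitzWith Cm.toNNReal m := by
      refine LipschitzWith.of_dist_le_mul fun u v => ?_
      rw [Real.dist_eq, Real.dist_eq, Real.coe_toNNReal _ hCm]
      exact hmL u v
    exact this.continuous.measurable
  refine tauberian_real (K := k + 1) hφ0 hφi hφ1 hI hE0 hEneg hEm hmono hgrow hm hmL (fun n => ?_) p
  obtain ⟨C, hC⟩ := cutoff_fourier_bound hχ hl n
  refine ⟨C, fun τ h hτ hτ1 hh => ?_⟩
  have hD : ∀ u, |E u - m u| ≤ (C₀ + Cm) * (1 + |u|) := by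
    intro u
    have h1 := abs_sub (E u) (m u)
    rw [abs_of_nonneg (hE0 u)] at h1
    have h2 := hgrow u
    have h3 := hm u
    have : 0 ≤ Cm * |u| := mul_nonneg hCm (abs_nonneg _)
    linarith
  have key := smoothing_identity (D := fun u => E u - m u) hχ hφ hφi hφ1 (hEm.sub hmm) hD
    (fun u hu => by rw [hEneg u hu, hmneg u hu, sub_zero]) hlim hbdd h hτ
  have := hC τ h hτ hτ1 hh
  rwa [← key, Complex.norm_real] at this

end Smoothing

/-! ### Functions of subpolynomial growth on the half-plane -/

/-- `f` grows slower than every positive power of the imaginary part, uniformly on `Re s > 1`. -/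
def SubpolyGrowth (f : ℂ → ℂ) : Prop :=
  ∀ ε : ℝ, 0 < ε → ∃ C : ℝ, ∀ s ∈ openHalfPlane, ‖f s‖ ≤ C * (1 + |s.im|) ^ ε

/-- The derivatives of `f` up to order `n` have subpolynomial growth. -/
def SubpolyUpTo (n : ℕ) (f : ℂ → ℂ) : Prop := ∀ j ≤ n, SubpolyGrowth (iteratedDeriv j f)

lemma one_le_one_add_abs_rpow (t : ℝ) {ε : ℝ} (hε : 0 ≤ ε) : 1 ≤ (1 + |t|) ^ ε :=
  Real.one_le_rpow (by linarith [abs_nonneg t]) hε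

namespace SubpolyGrowth

variable {f g : ℂ → ℂ}

lemma exists_nonneg (hf : SubpolyGrowth f) {ε : ℝ} (hε : 0 < ε) :
    ∃ C : ℝ, 0 ≤ C ∧ ∀ s ∈ openHalfPlane, ‖f s‖ ≤ C * (1 + |s.im|) ^ ε := by
  obtain ⟨C, hC⟩ := hf ε hε
  refine ⟨|C|, abs_nonneg _, fun s hs => (hC s hs).trans ?_⟩
  gcongr
  exact le_abs_self C

lemma congr (hf : SubpolyGrowth f) (h : Set.EqOn f g openHalfPlane) : SubpolyGrowth g := by
  intro ε hε
  obtain ⟨C, hC⟩ := hf ε hε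
  exact ⟨C, fun s hs => by rw [← h hs]; exact hC s hs⟩

lemma of_bounded {C : ℝ} (h : ∀ s ∈ openHalfPlane, ‖f s‖ ≤ C) : SubpolyGrowth f := by
  intro ε hε
  refine ⟨|C|, fun s hs => ?_⟩
  have := one_le_one_add_abs_rpow s.im hε.le
  have h1 := (h s hs).trans (le_abs_self C)
  nlinarith [abs_nonneg C]

lemma mul (hf : SubpolyGrowth f) (hg : SubpolyGrowth g) : SubpolyGrowth fun s => f s * g s := by
  intro ε hε
  obtain ⟨C, hC0, hC⟩ := hf.exists_nonneg (half_pos hε)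
  obtain ⟨C', hC0', hC'⟩ := hg.exists_nonneg (half_pos hε)
  refine ⟨C * C', fun s hs => ?_⟩
  have hp : 0 < 1 + |s.im| := by positivity
  rw [norm_mul]
  calc ‖f s‖ * ‖g s‖ ≤ (C * (1 + |s.im|) ^ (ε / 2)) * (C' * (1 + |s.im|) ^ (ε / 2)) :=
        mul_le_mul (hC s hs) (hC' s hs) (norm_nonneg _) (by positivity)
    _ = C * C' * ((1 + |s.im|) ^ (ε / 2) * (1 + |s.im|) ^ (ε / 2)) := by ring
    _ = _ := by rw [← Real.rpow_add hp, add_halves]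

lemma add (hf : SubpolyGrowth f) (hg : SubpolyGrowth g) : SubpolyGrowth fun s => f s + g s := by
  intro ε hε
  obtain ⟨C, hC⟩ := hf ε hε
  obtain ⟨C', hC'⟩ := hg ε hε
  refine ⟨C + C', fun s hs => ?_⟩
  rw [add_mul]
  exact (norm_add_le _ _).trans (add_le_add (hC s hs) (hC' s hs))

end SubpolyGrowth

namespace SubpolyUpTo

variable {f g : ℂ → ℂ} {n : ℕ}

lemma zero_iff : SubpolyUpTo 0 f ↔ SubpolyGrowth f := by
  unfold SubpolyUpTo
  simp

/-- Lets the closure properties below go by induction through the first-order differentiation rules,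
without formulas for higher derivatives. -/
lemma succ_iff : SubpolyUpTo (n + 1) f ↔ SubpolyGrowth f ∧ SubpolyUpTo n (deriv f) := by
  unfold SubpolyUpTo
  constructor
  · intro h
    refine ⟨by simpa using h 0 (Nat.zero_le _), fun j hj => ?_⟩
    rw [← iteratedDeriv_succ']
    exact h (j + 1) (by omega)
  · rintro ⟨h0, h⟩ j hj
    cases j with
    | zero => simpa using h0
    | succ j => rw [iteratedDeriv_succ']; exact h j (by omega)

lemma mono {m : ℕ} (hf : SubpolyUpTo n f) (h : m ≤ n) : SubpolyUpTo m f :=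
  fun j hj => hf j (hj.trans h)

lemma growth (hf : SubpolyUpTo n f) : SubpolyGrowth f := by
  simpa using hf 0 (Nat.zero_le _)

lemma congr (hf : SubpolyUpTo n f) (h : Set.EqOn f g openHalfPlane) : SubpolyUpTo n g :=
  fun j hj => (hf j hj).congr (h.iteratedDeriv_of_isOpen isOpen_openHalfPlane j)

lemma add (hfd : DifferentiableOn ℂ f openHalfPlane) (hgd : DifferentiableOn ℂ g openHalfPlane)
    (hf : SubpolyUpTo n f) (hg : SubpolyUpTo n g) : SubpolyUpTo n fun s => f s + g s := by
  induction n generalizing f g with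
  | zero =>
    rw [zero_iff] at *
    exact hf.add hg
  | succ n ih =>
    have hd := ih (hfd.deriv isOpen_openHalfPlane) (hgd.deriv isOpen_openHalfPlane)
      (succ_iff.1 hf).2 (succ_iff.1 hg).2
    refine succ_iff.2 ⟨hf.growth.add hg.growth, hd.congr fun s hs => ?_⟩
    have hs' := isOpen_openHalfPlane.mem_nhds hs
    exact (deriv_fun_add (hfd.differentiableAt hs') (hgd.differentiableAt hs')).symm

lemma mul (hfd : DifferentiableOn ℂ f openHalfPlane) (hgd : DifferentiableOn ℂ g openHalfPlane)
    (hf : SubpolyUpTo n f) (hg : SubpolyUpTo n g) : SubpolyUpTo n fun s => f s * g s := by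
  induction n generalizing f g with
  | zero =>
    rw [zero_iff] at *
    exact hf.mul hg
  | succ n ih =>
    have hfd' := hfd.deriv isOpen_openHalfPlane
    have hgd' := hgd.deriv isOpen_openHalfPlane
    have h1 := ih hfd' hgd (succ_iff.1 hf).2 (hg.mono n.le_succ)
    have h2 := ih hfd hgd' (hf.mono n.le_succ) (succ_iff.1 hg).2
    have hd := add (hfd'.mul hgd) (hfd.mul hgd') h1 h2
    refine succ_iff.2 ⟨hf.growth.mul hg.growth, hd.congr fun s hs => ?_⟩
    have hs' := isOpen_openHalfPlane.mem_nhds hs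
    exact (deriv_fun_mul (hfd.differentiableAt hs') (hgd.differentiableAt hs')).symm

lemma const (c : ℂ) : SubpolyUpTo n fun _ => c := by
  induction n generalizing c with
  | zero => exact zero_iff.2 (SubpolyGrowth.of_bounded (C := ‖c‖) fun s _ => le_rfl)
  | succ n ih =>
    refine succ_iff.2 ⟨SubpolyGrowth.of_bounded (C := ‖c‖) fun s _ => le_rfl, ?_⟩
    exact (ih 0).congr fun s _ => by simp

lemma const_mul (hfd : DifferentiableOn ℂ f openHalfPlane) (hf : SubpolyUpTo n f) (c : ℂ) :
    SubpolyUpTo n fun s => c * f s :=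
  mul (differentiableOn_const c) hfd (const c) hf

/-- Growth of e^f must be a hypothesis: |f| = O(|t|^ε) only yields exp(O(|t|^ε)). The derivatives
then follow from (e^f)' = f' e^f. -/
lemma exp (hfd : DifferentiableOn ℂ f openHalfPlane) (hf : SubpolyUpTo n f)
    (he : SubpolyGrowth fun s => Complex.exp (f s)) : SubpolyUpTo n fun s => Complex.exp (f s) := by
  induction n with
  | zero => exact zero_iff.2 he
  | succ n ih =>
    refine succ_iff.2 ⟨he, (mul (hfd.deriv isOpen_openHalfPlane) hfd.cexp (succ_iff.1 hf).2
      (ih (hf.mono n.le_succ))).congr fun s hs => ?_⟩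
    have h := (hfd.differentiableAt (isOpen_openHalfPlane.mem_nhds hs)).hasDerivAt.cexp
    simp only
    rw [h.deriv, mul_comm]

lemma inv (hfd : DifferentiableOn ℂ f openHalfPlane) (h0 : ∀ s ∈ openHalfPlane, f s ≠ 0)
    (hf : SubpolyUpTo n f) (hi : SubpolyGrowth fun s => (f s)⁻¹) :
    SubpolyUpTo n fun s => (f s)⁻¹ := by
  have hid : DifferentiableOn ℂ (fun s => (f s)⁻¹) openHalfPlane := hfd.fun_inv h0
  induction n with
  | zero => exact zero_iff.2 hi
  | succ n ih =>
    have h1 := ih (hf.mono n.le_succ)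
    have h2 := mul hid hid h1 h1
    have hfd' := hfd.deriv isOpen_openHalfPlane
    have h3 := const_mul (hfd'.mul (hid.mul hid)) (mul hfd' (hid.mul hid) (succ_iff.1 hf).2 h2) (-1)
    refine succ_iff.2 ⟨hi, h3.congr fun s hs => ?_⟩
    have h := (hfd.differentiableAt (isOpen_openHalfPlane.mem_nhds hs)).hasDerivAt.fun_inv (h0 s hs)
    rw [h.deriv]
    simp only [Pi.mul_apply]
    have := h0 s hs
    field_simp

end SubpolyUpTo

/-! ### Elementary bounds, Cauchy estimates and interpolation on the half-plane. -/

lemma norm_ge_of_mem_openHalfPlane {s : ℂ} (hs : s ∈ openHalfPlane) : 1 < ‖s‖ := by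
  have h1 : 1 < s.re := hs
  exact h1.trans_le ((le_abs_self _).trans (Complex.abs_re_le_norm s))

lemma ne_zero_of_mem_openHalfPlane {s : ℂ} (hs : s ∈ openHalfPlane) : s ≠ 0 :=
  norm_pos_iff.1 (zero_lt_one.trans (norm_ge_of_mem_openHalfPlane hs))

lemma sub_one_ne_zero_of_mem_openHalfPlane {s : ℂ} (hs : s ∈ openHalfPlane) : s - 1 ≠ 0 := by
  have h1 : 1 < s.re := hs
  intro h
  rw [sub_eq_zero] at h
  rw [h] at h1
  simp at h1

lemma differentiableOn_inv_openHalfPlane : DifferentiableOn ℂ (fun s : ℂ => s⁻¹) openHalfPlane :=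
  differentiableOn_id.fun_inv fun _ hs => ne_zero_of_mem_openHalfPlane hs

lemma subpolyUpTo_inv_id (n : ℕ) : SubpolyUpTo n fun s : ℂ => s⁻¹ := by
  have hb : SubpolyGrowth fun s : ℂ => s⁻¹ := by
    refine SubpolyGrowth.of_bounded (C := 1) fun s hs => ?_
    rw [norm_inv]
    exact inv_le_one_of_one_le₀ (norm_ge_of_mem_openHalfPlane hs).le
  induction n with
  | zero => exact SubpolyUpTo.zero_iff.2 hb
  | succ n ih =>
    have hd := differentiableOn_inv_openHalfPlane
    refine SubpolyUpTo.succ_iff.2 ⟨hb, (SubpolyUpTo.const_mul (hd.mul hd)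
      (SubpolyUpTo.mul hd hd ih ih) (-1)).congr fun s hs => ?_⟩
    rw [deriv_inv]
    have := ne_zero_of_mem_openHalfPlane hs
    simp only [Pi.mul_apply]
    field_simp

/-- Comparison of values at two points of the same horizontal line. -/
lemma norm_le_norm_add_horizontal {g : ℂ → ℂ} (hg : DifferentiableOn ℂ g openHalfPlane) {s : ℂ}
    (hs : s ∈ openHalfPlane) {C : ℝ} (hC : ∀ z ∈ openHalfPlane, z.im = s.im → ‖deriv g z‖ ≤ C)
    {η : ℝ} (hη : 0 ≤ η) : ‖g (s + η) - g s‖ ≤ C * η := by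
  have hs1 : 1 < s.re := hs
  set A : Set ℂ := openHalfPlane ∩ ({z | z.im ≤ s.im} ∩ {z | s.im ≤ z.im}) with hA
  have hconv : Convex ℝ A :=
    convex_openHalfPlane.inter ((convex_halfSpace_im_le _).inter (convex_halfSpace_im_ge _))
  have h := hconv.norm_image_sub_le_of_norm_hasDerivWithin_le (f := g) (f' := deriv g) (C := C)
    (fun z hz => (hg.differentiableAt
      (isOpen_openHalfPlane.mem_nhds hz.1)).hasDerivAt.hasDerivWithinAt)
    (fun z hz => hC z hz.1 (le_antisymm hz.2.1 hz.2.2))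
    (x := s) ⟨hs, le_refl s.im, le_refl s.im⟩ (y := s + η)
    ⟨by change 1 < (s + η).re; simp; linarith, by simp, by simp⟩
  refine h.trans (le_of_eq ?_)
  rw [add_sub_cancel_left, Complex.norm_real, Real.norm_eq_abs, abs_of_nonneg hη]

/-- Cauchy estimates for a function with a simple pole type bound at the boundary. -/
lemma norm_iteratedDeriv_le_of_pole_bound {f : ℂ → ℂ} (hf : DifferentiableOn ℂ f openHalfPlane)
    {B : ℝ} (hB : ∀ s ∈ openHalfPlane, ‖f s‖ ≤ B * (1 + 1 / (s.re - 1))) (n : ℕ) {s : ℂ} {η : ℝ}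
    (hη : 0 < η) (hη1 : η ≤ 1) (hs : 1 + η ≤ s.re) :
    ‖iteratedDeriv n f s‖ ≤ (n.factorial * 2 ^ n * (3 * B)) * (η⁻¹) ^ (n + 1) := by
  have hB0 : 0 ≤ B := by
    have h2 := (norm_nonneg _).trans (hB 2 (by simp [openHalfPlane]))
    norm_num at h2
    linarith
  have hre : ∀ z ∈ Metric.closedBall s (η / 2), 1 + η / 2 ≤ z.re := by
    intro z hz
    have h1 : |(z - s).re| ≤ η / 2 := (Complex.abs_re_le_norm _).trans (by simpa [dist_eq_norm] using hz)
    have h2 := (abs_le.1 h1).1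
    simp only [Complex.sub_re] at h2
    linarith
  have hsub : Metric.closedBall s (η / 2) ⊆ openHalfPlane := fun z hz => by
    have := hre z hz
    change 1 < z.re
    linarith
  -- On the circle of radius η/2 one has Re z - 1 ≥ η/2, so 1 + 1/(Re z - 1) ≤ 3/η.
  have h := Complex.norm_iteratedDeriv_le_of_forall_mem_sphere_norm_le (f := f) (c := s)
    (R := η / 2) (C := 3 * B * η⁻¹) n (by positivity) ?_ ?_
  · refine h.trans (le_of_eq ?_)
    rw [div_pow, pow_succ, inv_pow]
    field_simp
  · exact (hf.mono hsub).diffContOnCl_ball subset_rfl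
  · intro z hz
    have hz' := hre z (Metric.sphere_subset_closedBall hz)
    refine (hB z (hsub (Metric.sphere_subset_closedBall hz))).trans ?_
    rw [mul_assoc, mul_comm 3, mul_assoc]
    refine mul_le_mul_of_nonneg_left ?_ hB0
    have h1 : 1 / (z.re - 1) ≤ 2 * η⁻¹ := by
      rw [show 2 * η⁻¹ = 1 / (η / 2) by field_simp]
      exact one_div_le_one_div_of_le (by positivity) (by linarith)
    have h2 : 1 ≤ η⁻¹ := (one_le_inv₀ hη).2 hη1
    linarith

/-- If all derivatives are `O(1 + |t|)` and `f` is `O(1 + 1 / (σ - 1))`, then `f` and its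
derivatives have subpolynomial growth. -/
theorem subpolyUpTo_of_linear_bound {f : ℂ → ℂ} (hf : DifferentiableOn ℂ f openHalfPlane) {B : ℝ}
    (hB : ∀ s ∈ openHalfPlane, ‖f s‖ ≤ B * (1 + 1 / (s.re - 1)))
    (hlin : ∀ n : ℕ, ∃ C : ℝ, ∀ s ∈ openHalfPlane, s.re ≤ 2 →
      ‖iteratedDeriv n f s‖ ≤ C * (1 + |s.im|)) (n : ℕ) :
    SubpolyUpTo n f := by
  have hB0 : 0 ≤ B := by
    have h2 := (norm_nonneg _).trans (hB 2 (by simp [openHalfPlane]))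
    norm_num at h2
    linarith
  -- At stage k the n-th derivative has exponent (n + 1)/(n + k + 1): this is 1 for k = 0, the
  -- linear bound, and tends to 0 as k grows.
  have key : ∀ k n : ℕ, ∃ C : ℝ, 0 ≤ C ∧ ∀ s ∈ openHalfPlane,
      ‖iteratedDeriv n f s‖ ≤ C * (1 + |s.im|) ^ (((n : ℝ) + 1) / (n + k + 1)) := by
    intro k
    induction k with
    | zero =>
      intro n
      obtain ⟨C, hC⟩ := hlin n
      refine ⟨|C| + n.factorial * 2 ^ n * (3 * B), by positivity, fun s hs => ?_⟩
      have hp : 1 ≤ 1 + |s.im| := by linarith [abs_nonneg s.im]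
      rw [Nat.cast_zero, add_zero, div_self (by positivity), Real.rpow_one]
      rcases le_total s.re 2 with h2 | h2
      · have h3 := hC s hs h2
        have h4 : C * (1 + |s.im|) ≤ |C| * (1 + |s.im|) := by gcongr; exact le_abs_self C
        have h5 : 0 ≤ n.factorial * 2 ^ n * (3 * B) * (1 + |s.im|) := by positivity
        linarith
      · have h3 := norm_iteratedDeriv_le_of_pole_bound hf hB n one_pos le_rfl
          (by linarith : 1 + 1 ≤ s.re)
        rw [inv_one, one_pow, mul_one] at h3
        have h4 : 0 ≤ n.factorial * 2 ^ n * (3 * B) := by positivity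
        have h5 : 0 ≤ |C| * (1 + |s.im|) := by positivity
        nlinarith
    | succ k ih =>
      intro n
      obtain ⟨C, hC0, hC⟩ := ih (n + 1)
      refine ⟨n.factorial * 2 ^ n * (3 * B) + C, by positivity, fun s hs => ?_⟩
      have hs1 : 1 < s.re := hs
      set P := 1 + |s.im| with hP
      have hP1 : 1 ≤ P := by rw [hP]; linarith [abs_nonneg s.im]
      have hP0 : 0 < P := by linarith
      set q : ℝ := (n : ℝ) + k + 2 with hq
      have hq0 : 0 < q := by positivity
      -- This balances the two errors: Cauchy's estimate at s + η gives η^{-(n+1)}, and the move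
      -- back to s costs η times the stage-k bound P^{(n+2)/q} for the next derivative. Both equal
      -- P^{(n+1)/q}.
      set η : ℝ := P ^ (-(1 / q)) with hη
      have hη0 : 0 < η := Real.rpow_pos_of_pos hP0 _
      have hη1 : η ≤ 1 := Real.rpow_le_one_of_one_le_of_nonpos hP1
        (by have : 0 < 1 / q := by positivity
            linarith)
      have h1 := norm_iteratedDeriv_le_of_pole_bound hf hB n hη0 hη1
        (s := s + η) (by simp; linarith)
      have h2 := norm_le_norm_add_horizontal
        (differentiableOn_iteratedDeriv isOpen_openHalfPlane hf n) hs
        (C := C * P ^ (((n : ℝ) + 2) / q)) (fun z hz him => by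
          have := hC z hz
          rw [him, iteratedDeriv_succ] at this
          convert this using 3
          push_cast
          rw [hq]
          congr 1 <;> ring) hη0.le
      have h3 : (η⁻¹) ^ (n + 1) = P ^ (((n : ℝ) + 1) / q) := by
        rw [hη, Real.rpow_neg hP0.le, inv_inv, ← Real.rpow_natCast, ← Real.rpow_mul hP0.le]
        congr 1
        push_cast
        ring
      have h4 : P ^ (((n : ℝ) + 2) / q) * η = P ^ (((n : ℝ) + 1) / q) := by
        rw [hη, ← Real.rpow_add hP0]
        congr 1
        ring
      have h5 : ((n : ℝ) + 1) / (n + (k + 1 : ℕ) + 1) = (n + 1) / q := by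
        rw [hq]; push_cast; congr 1; ring
      rw [h5]
      rw [h3] at h1
      rw [mul_assoc, h4] at h2
      have h6 : ‖iteratedDeriv n f s‖ ≤ ‖iteratedDeriv n f (s + η)‖
          + ‖iteratedDeriv n f (s + η) - iteratedDeriv n f s‖ := by
        have := norm_sub_le (iteratedDeriv n f (s + η)) (iteratedDeriv n f (s + η) - iteratedDeriv n f s)
        rwa [sub_sub_cancel] at this
      rw [add_mul]
      linarith
  intro j _ ε hε
  obtain ⟨k, hk⟩ := exists_nat_gt (((j : ℝ) + 1) / ε)
  obtain ⟨C, hC0, hC⟩ := key k j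
  refine ⟨C, fun s hs => (hC s hs).trans ?_⟩
  refine mul_le_mul_of_nonneg_left ?_ hC0
  refine Real.rpow_le_rpow_of_exponent_le (by linarith [abs_nonneg s.im]) ?_
  rw [div_le_iff₀ (by positivity)]
  rw [div_lt_iff₀ hε] at hk
  nlinarith [mul_pos (by positivity : (0 : ℝ) < j + 1) hε]

/-! ### Laplace transforms and the Abelian and Tauberian theorems for Stieltjes functions -/

/-- The Laplace transform of `D` on `(0, ∞)`, at the point `s - 1`. -/
noncomputable def laplaceShift (D : ℝ → ℝ) (s : ℂ) : ℂ :=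
  ∫ u in Set.Ioi (0 : ℝ), (D u : ℂ) * Complex.exp (-(s - 1) * u)

lemma norm_laplace_kernel_le {s : ℂ} (hs : s ∈ openHalfPlane) {u : ℝ} (hu : 0 < u) :
    ‖Complex.exp (-(s - 1) * u)‖ ≤ 1 := by
  have h1 : 1 < s.re := hs
  rw [Complex.norm_exp, Real.exp_le_one_iff]
  simp
  nlinarith

lemma norm_laplaceShift_le {D : ℝ → ℝ} (hD : IntegrableOn D (Set.Ioi 0)) {s : ℂ}
    (hs : s ∈ openHalfPlane) : ‖laplaceShift D s‖ ≤ ∫ u in Set.Ioi (0 : ℝ), |D u| := by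
  refine norm_integral_le_of_norm_le hD.norm ?_
  filter_upwards [ae_restrict_mem measurableSet_Ioi] with u hu
  rw [norm_mul, Complex.norm_real]
  exact mul_le_of_le_one_right (norm_nonneg _) (norm_laplace_kernel_le hs hu)

lemma hasDerivAt_laplaceShift {D : ℝ → ℝ} (hD : IntegrableOn D (Set.Ioi 0))
    (hD1 : IntegrableOn (fun u => -u * D u) (Set.Ioi 0)) {s : ℂ} (hs : s ∈ openHalfPlane) :
    HasDerivAt (laplaceShift D) (laplaceShift (fun u => -u * D u) s) s := by
  have hm : ∀ (D : ℝ → ℝ), IntegrableOn D (Set.Ioi 0) → ∀ z : ℂ, AEStronglyMeasurable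
      (fun u : ℝ => (D u : ℂ) * Complex.exp (-(z - 1) * u)) (volume.restrict (Set.Ioi 0)) := by
    intro D hD z
    refine (Complex.continuous_ofReal.comp_aestronglyMeasurable hD.aestronglyMeasurable).mul ?_
    exact Continuous.aestronglyMeasurable (by fun_prop)
  refine (hasDerivAt_integral_of_dominated_loc_of_deriv_le
    (F := fun (z : ℂ) (u : ℝ) => (D u : ℂ) * Complex.exp (-(z - 1) * u))
    (F' := fun (z : ℂ) (u : ℝ) => ((-u * D u : ℝ) : ℂ) * Complex.exp (-(z - 1) * u))
    (isOpen_openHalfPlane.mem_nhds hs) (bound := fun u => ‖-u * D u‖)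
    (Filter.Eventually.of_forall (hm D hD)) ?_ (hm _ hD1 s) ?_ hD1.norm ?_).2
  · refine Integrable.mono' hD.norm (hm D hD s) ?_
    filter_upwards [ae_restrict_mem measurableSet_Ioi] with u hu
    rw [norm_mul, Complex.norm_real]
    exact mul_le_of_le_one_right (norm_nonneg _) (norm_laplace_kernel_le hs hu)
  · filter_upwards [ae_restrict_mem measurableSet_Ioi] with u hu z hz
    rw [norm_mul, Complex.norm_real]
    exact mul_le_of_le_one_right (norm_nonneg _) (norm_laplace_kernel_le hz hu)
  · filter_upwards with u z hz
    have h1 : HasDerivAt (fun z : ℂ => -(z - 1) * (u : ℂ)) (-(u : ℂ)) z := by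
      simpa using (((hasDerivAt_id z).sub_const 1).neg.mul_const (u : ℂ))
    refine (h1.cexp.const_mul (D u : ℂ)).congr_deriv ?_
    push_cast
    ring

section Moments

variable {D : ℝ → ℝ} (hD : ∀ n : ℕ, IntegrableOn (fun u => (-u) ^ n * D u) (Set.Ioi 0))

include hD in
lemma iteratedDeriv_laplaceShift (n : ℕ) {s : ℂ} (hs : s ∈ openHalfPlane) :
    iteratedDeriv n (laplaceShift D) s = laplaceShift (fun u => (-u) ^ n * D u) s := by
  induction n generalizing s with
  | zero => simp
  | succ n ih =>
    have h1 : iteratedDeriv n (laplaceShift D) =ᶠ[𝓝 s] laplaceShift (fun u => (-u) ^ n * D u) := by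
      filter_upwards [isOpen_openHalfPlane.mem_nhds hs] with z hz using ih hz
    rw [iteratedDeriv_succ, h1.deriv_eq]
    have h2 : (fun u => (-u) ^ (n + 1) * D u) = fun u => -u * ((-u) ^ n * D u) := by
      ext u; ring
    have h3 := hD (n + 1)
    rw [h2] at h3
    rw [h2]
    exact (hasDerivAt_laplaceShift (hD n) h3 hs).deriv

include hD in
lemma differentiableOn_laplaceShift : DifferentiableOn ℂ (laplaceShift D) openHalfPlane := by
  intro s hs
  have h0 := hD 0
  have h1 := hD 1
  simp only [pow_zero, one_mul, pow_one] at h0 h1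
  exact (hasDerivAt_laplaceShift h0 h1 hs).differentiableAt.differentiableWithinAt

/-- At n = 0 the truncated index n - 1 does no harm, because its coefficient is n. -/
lemma iteratedDeriv_id_mul {J : ℂ → ℂ} (hJ : DifferentiableOn ℂ J openHalfPlane) (n : ℕ) :
    ∀ s ∈ openHalfPlane, iteratedDeriv n (fun s => s * J s) s
      = s * iteratedDeriv n J s + n * iteratedDeriv (n - 1) J s := by
  induction n with
  | zero => intro s _; simp
  | succ n ih =>
    intro s hs
    have h1 : iteratedDeriv n (fun s => s * J s) =ᶠ[𝓝 s]
        fun s => s * iteratedDeriv n J s + n * iteratedDeriv (n - 1) J s := by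
      filter_upwards [isOpen_openHalfPlane.mem_nhds hs] with z hz using ih z hz
    rw [iteratedDeriv_succ, h1.deriv_eq]
    have h2 := hasDerivAt_iteratedDeriv isOpen_openHalfPlane hJ n hs
    have h3 := hasDerivAt_iteratedDeriv isOpen_openHalfPlane hJ (n - 1) hs
    rw [(((hasDerivAt_id' s).fun_mul h2).fun_add (h3.const_mul (n : ℂ))).deriv]
    rcases n with _ | n
    · simp [add_comm]
    · simp only [Nat.add_sub_cancel]
      push_cast
      ring

-- Finite moments bound every derivative of the Laplace transform, so the only growth comes from the
-- factor s.
include hD in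
lemma exists_linear_bound (n : ℕ) : ∃ C : ℝ, ∀ s ∈ openHalfPlane, s.re ≤ 2 →
    ‖iteratedDeriv n (fun s => s * laplaceShift D s) s‖ ≤ C * (1 + |s.im|) := by
  set I : ℕ → ℝ := fun n => ∫ u in Set.Ioi (0 : ℝ), |(-u) ^ n * D u| with hI
  have hI0 : ∀ n, 0 ≤ I n := fun n => integral_nonneg fun u => abs_nonneg _
  have hb : ∀ n, ∀ s ∈ openHalfPlane, ‖iteratedDeriv n (laplaceShift D) s‖ ≤ I n := by
    intro n s hs
    rw [iteratedDeriv_laplaceShift hD n hs]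
    exact norm_laplaceShift_le (hD n) hs
  refine ⟨2 * I n + n * I (n - 1), fun s hs h2 => ?_⟩
  have h1 : 1 < s.re := hs
  rw [iteratedDeriv_id_mul (differentiableOn_laplaceShift hD) n s hs]
  have h3 : ‖s‖ ≤ 2 * (1 + |s.im|) := by
    have := Complex.norm_le_abs_re_add_abs_im s
    rw [abs_of_pos (by linarith)] at this
    linarith [abs_nonneg s.im]
  refine (norm_add_le _ _).trans ?_
  rw [norm_mul, norm_mul, Complex.norm_natCast]
  have h4 : ‖s‖ * ‖iteratedDeriv n (laplaceShift D) s‖ ≤ 2 * (1 + |s.im|) * I n :=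
    mul_le_mul h3 (hb n s hs) (norm_nonneg _) (by positivity)
  have h5 : (n : ℝ) * ‖iteratedDeriv (n - 1) (laplaceShift D) s‖ ≤ n * I (n - 1) :=
    mul_le_mul_of_nonneg_left (hb _ s hs) (by positivity)
  have h6 : 0 ≤ (n : ℝ) * I (n - 1) * |s.im| :=
    mul_nonneg (mul_nonneg (by positivity) (hI0 _)) (abs_nonneg _)
  linarith

end Moments

/-- The function `e^{-u} M(e^u)`. -/
noncomputable def normalizedCount (M : StieltjesFunction ℝ) (u : ℝ) : ℝ :=
  M (Real.exp u) * Real.exp (-u)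

/-- `m` is a bounded Lipschitz function supported on `[0, ∞)`, and `A s / s` is its Laplace
transform at `s - 1`. In the applications `m u = e^{-u} Q(e^u)`, where `Q` is a main term and `A`
its Mellin-Stieltjes transform. -/
structure IsMainTerm (m : ℝ → ℝ) (A : ℂ → ℂ) : Prop where
  zero_of_neg : ∀ u < 0, m u = 0
  bounded_lipschitz : ∃ C : ℝ, (∀ u, |m u| ≤ C) ∧ ∀ u v, |m u - m v| ≤ C * |u - v|
  eq_laplace : ∀ s ∈ openHalfPlane, A s = s * laplaceShift m s
  differentiableOn : DifferentiableOn ℂ A openHalfPlane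
  pole_bound : ∃ C : ℝ, ∀ s ∈ openHalfPlane, ‖A s‖ ≤ C / (s.re - 1)

section Count

variable {M : StieltjesFunction ℝ} {m : ℝ → ℝ} {A : ℂ → ℂ}

lemma measurable_normalizedCount : Measurable (normalizedCount M) :=
  (M.mono.measurable.comp (by fun_prop)).mul (by fun_prop)

lemma IsMainTerm.continuous (hm : IsMainTerm m A) : Continuous m := by
  obtain ⟨C, hC, hL⟩ := hm.bounded_lipschitz
  have : LipschitzWith C.toNNReal m := by
    refine LipschitzWith.of_dist_le_mul fun u v => ?_
    rw [Real.dist_eq, Real.dist_eq, Real.coe_toNNReal _ ((abs_nonneg _).trans (hC 0))]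
    exact hL u v
  exact this.continuous

lemma integrableOn_of_bounded_laplace {m : ℝ → ℝ} (hm : Continuous m) {C : ℝ} (hC : ∀ u, |m u| ≤ C)
    {s : ℂ} (hs : s ∈ openHalfPlane) :
    IntegrableOn (fun u : ℝ => (m u : ℂ) * Complex.exp (-(s - 1) * u)) (Set.Ioi 0) := by
  have h1 : 1 < s.re := hs
  have h2 : IntegrableOn (fun u : ℝ => Complex.exp (-(s - 1) * u)) (Set.Ioi 0) :=
    integrableOn_exp_mul_complex_Ioi (by simpa using h1) 0
  refine Integrable.bdd_mul (c := C) h2 ?_ ?_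
  · exact Continuous.aestronglyMeasurable (by fun_prop)
  · exact Filter.Eventually.of_forall fun u => by rw [Complex.norm_real]; exact hC u

variable (hM0 : ∀ x < 1, M x = 0) (hconv : ∀ s : ℂ, 1 < s.re → MellinStieltjesConvergent M s)
  (hm : IsMainTerm m A)

include hM0 hconv in
lemma mellinStieltjes_eq_laplaceShift {s : ℂ} (hs : s ∈ openHalfPlane) :
    IntegrableOn (fun u : ℝ => (normalizedCount M u : ℂ) * Complex.exp (-(s - 1) * u)) (Set.Ioi 0) ∧
    mellinStieltjes M s = s * laplaceShift (normalizedCount M) s := by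
  have h1 : 1 < s.re := hs
  obtain ⟨h2, h3⟩ := mellinStieltjes_eq_laplace hM0 (by linarith) (hconv s h1)
  have h4 : (fun u : ℝ => (normalizedCount M u : ℂ) * Complex.exp (-(s - 1) * u))
      = fun u : ℝ => (M (Real.exp u) : ℂ) * Complex.exp (-s * u) := by
    ext u
    unfold normalizedCount
    rw [Complex.ofReal_mul, mul_assoc, Complex.ofReal_exp, ← Complex.exp_add]
    congr 2
    push_cast
    ring
  unfold laplaceShift
  rw [h4]
  exact ⟨h2, h3⟩

include hM0 hconv hm in
lemma mellinStieltjes_sub_eq {s : ℂ} (hs : s ∈ openHalfPlane) :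
    mellinStieltjes M s - A s = s * laplaceShift (fun u => normalizedCount M u - m u) s := by
  obtain ⟨C, hC, _⟩ := hm.bounded_lipschitz
  obtain ⟨h1, h2⟩ := mellinStieltjes_eq_laplaceShift hM0 hconv hs
  have h3 := integrableOn_of_bounded_laplace hm.continuous hC hs
  rw [h2, hm.eq_laplace s hs, ← mul_sub]
  congr 1
  unfold laplaceShift
  rw [← integral_sub h1 h3]
  congr 1
  ext u
  push_cast
  ring

include hconv hm in
lemma differentiableOn_mellinStieltjes_sub :
    DifferentiableOn ℂ (fun s => mellinStieltjes M s - A s) openHalfPlane :=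
  (differentiableOn_mellinStieltjes hconv).sub hm.differentiableOn

lemma integrableOn_moment_of_decay {D : ℝ → ℝ} (hDm : Measurable D)
    (hD : ∀ p : ℕ, ∃ C : ℝ, ∀ u : ℝ, 0 ≤ u → (1 + u) ^ p * |D u| ≤ C) (n : ℕ) :
    IntegrableOn (fun u => (-u) ^ n * D u) (Set.Ioi 0) := by
  obtain ⟨C, hC⟩ := hD (n + 2)
  have hint : Integrable fun u : ℝ => C * (1 + u ^ 2)⁻¹ := integrable_inv_one_add_sq.const_mul C
  refine Integrable.mono' hint.integrableOn (by fun_prop) ?_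
  filter_upwards [ae_restrict_mem measurableSet_Ioi] with u hu
  have hu0 : 0 < u := hu
  rw [norm_mul, norm_pow, norm_neg, Real.norm_eq_abs, Real.norm_eq_abs, abs_of_pos hu0,
    ← div_eq_mul_inv, le_div_iff₀ (by positivity)]
  refine le_trans ?_ (hC u hu0.le)
  have h1 : u ^ n * (1 + u ^ 2) ≤ (1 + u) ^ (n + 2) := by
    rw [pow_add]
    have : u ^ n ≤ (1 + u) ^ n := pow_le_pow_left₀ hu0.le (by linarith) _
    have h2 : 1 + u ^ 2 ≤ (1 + u) ^ 2 := by nlinarith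
    gcongr
  calc u ^ n * |D u| * (1 + u ^ 2) = u ^ n * (1 + u ^ 2) * |D u| := by ring
    _ ≤ _ := by gcongr

include hM0 in
lemma normalizedCount_nonneg (u : ℝ) : 0 ≤ normalizedCount M u :=
  mul_nonneg (StieltjesFunction.nonneg_of_support hM0 _) (Real.exp_pos _).le

include hM0 in
lemma normalizedCount_of_neg {u : ℝ} (hu : u < 0) : normalizedCount M u = 0 := by
  unfold normalizedCount
  rw [hM0 _ (Real.exp_lt_one_iff.2 hu), zero_mul]

include hM0 in
lemma normalizedCount_le_of_le {u v : ℝ} (hu : 0 ≤ u) (huv : u ≤ v) :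
    normalizedCount M u ≤ M (Real.exp v) := by
  unfold normalizedCount
  have h1 : Real.exp (-u) ≤ 1 := Real.exp_le_one_iff.2 (by linarith)
  have h2 : M (Real.exp u) ≤ M (Real.exp v) := M.mono (Real.exp_le_exp.2 huv)
  have h3 := StieltjesFunction.nonneg_of_support hM0 (Real.exp u)
  nlinarith

include hM0 hconv hm in
/-- The Abelian direction: a remainder smaller than every power of `1 / u` gives subpolynomial
growth of the transform and all its derivatives. -/
theorem subpolyUpTo_of_decay
    (hD : ∀ p : ℕ, ∃ C : ℝ, ∀ u : ℝ, 1 ≤ u → u ^ p * |normalizedCount M u - m u| ≤ C) (n : ℕ) :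
    SubpolyUpTo n fun s => mellinStieltjes M s - A s := by
  obtain ⟨Cm, hCm, _⟩ := hm.bounded_lipschitz
  have hCm0 : 0 ≤ Cm := (abs_nonneg _).trans (hCm 0)
  obtain ⟨CA, hCA⟩ := hm.pole_bound
  have hdecay : ∀ p : ℕ, ∃ C : ℝ, ∀ u : ℝ, 0 ≤ u →
      (1 + u) ^ p * |normalizedCount M u - m u| ≤ C := by
    intro p
    obtain ⟨C, hC⟩ := hD p
    refine ⟨2 ^ p * (max C (M (Real.exp 1) + Cm)), fun u hu => ?_⟩
    rcases le_total 1 u with h1 | h1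
    · have h2 : (1 + u) ^ p ≤ 2 ^ p * u ^ p := by
        rw [← mul_pow]
        exact pow_le_pow_left₀ (by linarith) (by linarith) _
      calc (1 + u) ^ p * |normalizedCount M u - m u|
          ≤ 2 ^ p * u ^ p * |normalizedCount M u - m u| := by gcongr
        _ = 2 ^ p * (u ^ p * |normalizedCount M u - m u|) := by ring
        _ ≤ _ := by
          gcongr
          exact (hC u h1).trans (le_max_left _ _)
    · have h2 : (1 + u) ^ p ≤ 2 ^ p := pow_le_pow_left₀ (by linarith) (by linarith) _
      have h3 : |normalizedCount M u - m u| ≤ M (Real.exp 1) + Cm := by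
        refine (abs_sub _ _).trans ?_
        rw [abs_of_nonneg (normalizedCount_nonneg hM0 u)]
        exact add_le_add (normalizedCount_le_of_le hM0 hu h1) (hCm u)
      have h4 := h3.trans (le_max_right C _)
      gcongr
  have hmom := integrableOn_moment_of_decay
    (measurable_normalizedCount.sub hm.continuous.measurable) hdecay
  set f : ℂ → ℂ := fun s => mellinStieltjes M s - A s with hf
  have heq : Set.EqOn f (fun s => s * laplaceShift (fun u => normalizedCount M u - m u) s)
      openHalfPlane := fun s hs => mellinStieltjes_sub_eq hM0 hconv hm hs
  have hlin : ∀ n : ℕ, ∃ C : ℝ, ∀ s ∈ openHalfPlane, s.re ≤ 2 →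
      ‖iteratedDeriv n f s‖ ≤ C * (1 + |s.im|) := by
    intro n
    obtain ⟨C, hC⟩ := exists_linear_bound hmom n
    refine ⟨C, fun s hs h2 => ?_⟩
    rw [heq.iteratedDeriv_of_isOpen isOpen_openHalfPlane n hs]
    exact hC s hs h2
  obtain ⟨C₀, hC₀⟩ := hlin 0
  -- Only the real axis needs to be treated: by positivity of dM the modulus at s is at most the
  -- value at Re s, which gives the pole bound uniformly in the imaginary part.
  have hreal : ∀ σ : ℝ, 1 < σ → (mellinStieltjes M σ).re
      ≤ |C₀| + |CA| / (σ - 1) + (mellinStieltjes M (2 : ℝ)).re := by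
    intro σ hσ
    have hσ' : (σ : ℂ) ∈ openHalfPlane := by simpa [openHalfPlane] using hσ
    have h0 : 0 ≤ |CA| / (σ - 1) := div_nonneg (abs_nonneg _) (by linarith)
    rcases le_total σ 2 with h2 | h2
    · have h3 := hC₀ σ hσ' (by simpa using h2)
      simp only [iteratedDeriv_zero, Complex.ofReal_im, abs_zero, add_zero, mul_one] at h3
      have h4 := hCA σ hσ'
      rw [Complex.ofReal_re] at h4
      have h5 : CA / (σ - 1) ≤ |CA| / (σ - 1) :=
        div_le_div_of_nonneg_right (le_abs_self _) (by linarith)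
      have h6 : (mellinStieltjes M σ).re ≤ ‖f σ‖ + ‖A σ‖ := by
        refine (Complex.re_le_norm _).trans ?_
        have : mellinStieltjes M σ = f σ + A σ := by simp [hf]
        rw [this]
        exact norm_add_le _ _
      have h7 := mellinStieltjes_ofReal_re_nonneg M 2
      linarith [le_abs_self C₀]
    · have := mellinStieltjes_re_antitone (hconv (2 : ℝ) (by norm_num)) h2
      linarith [abs_nonneg C₀]
  refine subpolyUpTo_of_linear_bound (differentiableOn_mellinStieltjes_sub hconv hm)
    (B := |C₀| + (mellinStieltjes M (2 : ℝ)).re + 2 * |CA|) (fun s hs => ?_) hlin n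
  have hs1 : 1 < s.re := hs
  have h1 := norm_mellinStieltjes_le M s
  have h2 := hreal s.re hs1
  have h3 := hCA s hs
  have h5 : CA / (s.re - 1) ≤ |CA| / (s.re - 1) :=
        div_le_div_of_nonneg_right (le_abs_self _) (by linarith)
  have h7 := mellinStieltjes_ofReal_re_nonneg M 2
  have h8 : 0 < 1 / (s.re - 1) := one_div_pos.2 (by linarith)
  have h9 : |CA| / (s.re - 1) = |CA| * (1 / (s.re - 1)) := by ring
  have h10 : 0 ≤ (|C₀| + (mellinStieltjes M (2 : ℝ)).re) * (1 / (s.re - 1)) := by positivity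
  have h11 := abs_nonneg CA
  refine (norm_sub_le _ _).trans ?_
  nlinarith

end Count

section CountTauberian

variable {M : StieltjesFunction ℝ} {m : ℝ → ℝ} {A : ℂ → ℂ}

lemma one_add_mul_I_ne_zero (t : ℝ) : (1 + (t : ℂ) * Complex.I) ≠ 0 := by
  intro h
  have := congrArg Complex.re h
  simp at this

/-- The Laplace transform of the remainder is f(s)/s, so the factor 1/s on the boundary line must be
smooth with bounded derivatives. -/
lemma polyBound_inv_vertical (c : ℝ) :
    PolyBound 0 fun ξ : ℝ => (1 + ((c * ξ : ℝ) : ℂ) * Complex.I)⁻¹ := by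
  have hd : ∀ (n : ℕ) (ξ : ℝ), HasDerivAt
      (fun ξ : ℝ => ((-1) ^ n * n.factorial * (c * Complex.I) ^ n : ℂ) *
        ((1 + ((c * ξ : ℝ) : ℂ) * Complex.I)⁻¹) ^ (n + 1))
      (((-1) ^ (n + 1) * (n + 1).factorial * (c * Complex.I) ^ (n + 1) : ℂ) *
        ((1 + ((c * ξ : ℝ) : ℂ) * Complex.I)⁻¹) ^ (n + 1 + 1)) ξ := by
    intro n ξ
    have h2 : HasDerivAt (fun ξ : ℝ => 1 + ((c * ξ : ℝ) : ℂ) * Complex.I) (c * Complex.I) ξ := by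
      have : HasDerivAt (fun ξ : ℝ => ((c * ξ : ℝ) : ℂ)) (c : ℂ) ξ := by
        have := ((hasDerivAt_id ξ).const_mul c).ofReal_comp
        simpa using this
      simpa using (this.mul_const Complex.I).const_add 1
    have h3 := ((h2.fun_inv (one_add_mul_I_ne_zero _)).fun_pow (n + 1)).const_mul
      ((-1) ^ n * n.factorial * (c * Complex.I) ^ n : ℂ)
    refine h3.congr_deriv ?_
    rw [Nat.factorial_succ, div_eq_mul_inv, ← inv_pow, Nat.add_sub_cancel]
    generalize (1 + ((c * ξ : ℝ) : ℂ) * Complex.I)⁻¹ = w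
    push_cast
    ring
  have hiter : ∀ n : ℕ, iteratedDeriv n (fun ξ : ℝ => (1 + ((c * ξ : ℝ) : ℂ) * Complex.I)⁻¹)
      = fun ξ : ℝ => ((-1) ^ n * n.factorial * (c * Complex.I) ^ n : ℂ) *
        ((1 + ((c * ξ : ℝ) : ℂ) * Complex.I)⁻¹) ^ (n + 1) := by
    intro n
    induction n with
    | zero => ext ξ; simp
    | succ n ih =>
      rw [iteratedDeriv_succ, ih]
      ext ξ
      exact (hd n ξ).deriv
  refine ⟨contDiff_of_differentiable_iteratedDeriv fun n _ => ?_, fun n => ?_⟩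
  · rw [hiter n]
    exact fun ξ => (hd n ξ).differentiableAt
  · refine ⟨‖((-1) ^ n * n.factorial * (c * Complex.I) ^ n : ℂ)‖, fun ξ => ?_⟩
    rw [hiter n, norm_mul, pow_zero, norm_pow, norm_inv]
    refine mul_le_mul_of_nonneg_left (pow_le_one₀ (by positivity) (inv_le_one_of_one_le₀ ?_))
      (norm_nonneg _)
    have := Complex.abs_re_le_norm (1 + ((c * ξ : ℝ) : ℂ) * Complex.I)
    simpa using this

lemma isCompact_box (T : ℝ) : IsCompact (Set.Icc (1 : ℝ) 2 ×ℂ Set.Icc (-T) T) :=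
  isCompact_Icc.reProdIm isCompact_Icc

variable (hM0 : ∀ x < 1, M x = 0) (hconv : ∀ s : ℂ, 1 < s.re → MellinStieltjesConvergent M s)
  (hm : IsMainTerm m A)

-- In Markov's inequality take σ = 1 + 1/u, so that e^{-σu} = e^{-u}/e. The transform at σ is at
-- most a constant plus a multiple of 1/(σ - 1) = u, since F is bounded on the real segment [1, 2].
include hM0 hconv hm in
lemma normalizedCount_growth {F : ℂ → ℂ} (hFc : ContinuousOn F closedHalfPlane)
    (hF : ∀ s : ℂ, 1 < s.re → F s = mellinStieltjes M s - A s) :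
    ∃ C : ℝ, ∀ u, normalizedCount M u ≤ C * (1 + |u|) := by
  obtain ⟨CA, hCA⟩ := hm.pole_bound
  obtain ⟨C₁, hC₁⟩ := (isCompact_box 0).exists_bound_of_continuousOn
    (hFc.mono fun s hs => (Complex.mem_reProdIm.1 hs).1.1)
  refine ⟨Real.exp 1 * (|C₁| + |CA|) + M (Real.exp 1), fun u => ?_⟩
  have hMe := StieltjesFunction.nonneg_of_support hM0 (Real.exp 1)
  have hbase : 0 ≤ Real.exp 1 * (|C₁| + |CA|) := by positivity
  rcases lt_or_ge u 0 with hu | hu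
  · rw [normalizedCount_of_neg hM0 hu]; positivity
  rw [abs_of_nonneg hu]
  rcases le_total u 1 with h1 | h1
  · have := normalizedCount_le_of_le hM0 hu h1
    nlinarith [mul_nonneg hbase hu, mul_nonneg hMe hu]
  · set σ : ℝ := 1 + 1 / u with hσ
    have hu0 : 0 < u := by linarith
    have hσ1 : 1 < σ := by rw [hσ]; have : 0 < 1 / u := by positivity
                           linarith
    have hσ2 : σ ≤ 2 := by rw [hσ]; have : 1 / u ≤ 1 := by rw [div_le_one hu0]; exact h1
                           linarith
    have hσ' : (σ : ℂ) ∈ openHalfPlane := by simpa [openHalfPlane] using hσ1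
    have h2 := mul_exp_le_mellinStieltjes hM0 (u := u) (by linarith : 0 ≤ σ)
      (hconv σ (by simpa using hσ1))
    have h3 : normalizedCount M u = Real.exp 1 * (M (Real.exp u) * Real.exp (-σ * u)) := by
      unfold normalizedCount
      rw [mul_left_comm, ← Real.exp_add]
      congr 2
      rw [hσ]
      field_simp
      ring
    have h4 : (mellinStieltjes M σ).re ≤ |C₁| + |CA| * u := by
      have h5 : mellinStieltjes M σ = F σ + A σ := by
        rw [hF σ (by simpa using hσ1)]; ring
      have h6 : ‖F σ‖ ≤ C₁ := hC₁ σ (by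
        rw [Complex.mem_reProdIm]; simp [hσ1.le, hσ2])
      have h7 := hCA σ hσ'
      rw [Complex.ofReal_re, hσ, add_sub_cancel_left, div_div_eq_mul_div, div_one] at h7
      have h8 : CA * u ≤ |CA| * u := by gcongr; exact le_abs_self _
      calc (mellinStieltjes M σ).re ≤ ‖mellinStieltjes M σ‖ := Complex.re_le_norm _
        _ ≤ ‖F σ‖ + ‖A σ‖ := by rw [h5]; exact norm_add_le _ _
        _ ≤ _ := add_le_add (h6.trans (le_abs_self _)) (h7.trans h8)
    rw [h3]
    have h9 : Real.exp 1 * (M (Real.exp u) * Real.exp (-σ * u))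
        ≤ Real.exp 1 * (|C₁| + |CA| * u) := by
      gcongr
      exact h2.trans h4
    have e1 := Real.exp_pos 1
    have e2 : 0 ≤ Real.exp 1 * |C₁| * u := by positivity
    have e3 : 0 ≤ Real.exp 1 * |CA| := by positivity
    nlinarith [mul_nonneg hMe hu]

lemma fourier_damped_eq {D : ℝ → ℝ} (hD0 : ∀ u < 0, D u = 0) (δ ξ : ℝ) :
    𝓕 (fun u => ((D u * Real.exp (-δ * u) : ℝ) : ℂ)) ξ
      = laplaceShift D (1 + δ + ((2 * Real.pi * ξ : ℝ) : ℂ) * Complex.I) := by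
  rw [Real.fourier_real_eq_integral_exp_smul, laplaceShift, ← integral_Ici_eq_integral_Ioi,
    ← integral_indicator measurableSet_Ici]
  congr 1
  ext u
  by_cases hu : u ∈ Set.Ici (0 : ℝ)
  · rw [Set.indicator_of_mem hu, smul_eq_mul, Complex.ofReal_mul (D u), Complex.ofReal_exp,
      mul_left_comm, ← Complex.exp_add]
    congr 2
    push_cast
    ring
  · rw [Set.indicator_of_notMem hu, hD0 u (not_le.1 hu)]
    simp

include hM0 hconv hm in
/-- The Tauberian direction: smooth boundary values whose derivatives all grow at most like a
fixed power give a remainder smaller than every power of `1 / u`. -/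
theorem decay_of_smoothExtension {F : ℂ → ℂ}
    (hF : IsSmoothExtension (fun s => mellinStieltjes M s - A s) F) {k : ℕ}
    (hb : ∀ n : ℕ, ∃ C : ℝ, ∀ t : ℝ,
      ‖iteratedDerivWithin n F closedHalfPlane (1 + (t : ℂ) * Complex.I)‖ ≤ C * (1 + |t|) ^ k)
    (p : ℕ) : ∃ C : ℝ, ∀ u : ℝ, 1 ≤ u → u ^ p * |normalizedCount M u - m u| ≤ C := by
  obtain ⟨Cm, hCm, hmL⟩ := hm.bounded_lipschitz
  have hdiff := differentiableOn_mellinStieltjes_sub hconv hm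
  have hFc : ContinuousOn F closedHalfPlane := hF.1.continuousOn
  obtain ⟨C₀, hC₀⟩ := normalizedCount_growth hM0 hconv hm hFc hF.2
  set l : ℝ → ℂ := (fun ξ : ℝ => F (1 + ((2 * Real.pi * ξ : ℝ) : ℂ) * Complex.I)) *
    fun ξ : ℝ => (1 + ((2 * Real.pi * ξ : ℝ) : ℂ) * Complex.I)⁻¹ with hl
  have hpi := Real.pi_pos
  have hlb : PolyBound (k + 0) l := by
    refine PolyBound.mul ⟨(hF.vertical hdiff _).1, fun n => ?_⟩ (polyBound_inv_vertical _)
    obtain ⟨C, hC⟩ := hb n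
    refine ⟨(2 * Real.pi) ^ n * (|C| * (1 + 2 * Real.pi) ^ k), fun ξ => ?_⟩
    rw [(hF.vertical hdiff _).2 n ξ, norm_mul, norm_pow, norm_mul, Complex.norm_I, mul_one,
      Complex.norm_real, Real.norm_eq_abs, abs_of_pos (by positivity), mul_assoc ((2 * Real.pi) ^ n)]
    refine mul_le_mul_of_nonneg_left ((hC _).trans ?_) (by positivity)
    rw [mul_assoc |C|, ← mul_pow]
    have h1 : 1 + |2 * Real.pi * ξ| ≤ (1 + 2 * Real.pi) * (1 + |ξ|) := by
      rw [abs_mul, abs_of_pos (by positivity : 0 < 2 * Real.pi)]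
      nlinarith [abs_nonneg ξ]
    calc C * (1 + |2 * Real.pi * ξ|) ^ k ≤ |C| * (1 + |2 * Real.pi * ξ|) ^ k := by
          gcongr; exact le_abs_self C
      _ ≤ _ := by gcongr
  have hDneg : ∀ u < 0, normalizedCount M u - m u = 0 := fun u hu => by
    rw [normalizedCount_of_neg hM0 hu, hm.zero_of_neg u hu, sub_zero]
  have hval : ∀ δ ξ : ℝ, 0 < δ →
      𝓕 (fun u => (((normalizedCount M u - m u) * Real.exp (-δ * u) : ℝ) : ℂ)) ξ
        = F (1 + δ + ((2 * Real.pi * ξ : ℝ) : ℂ) * Complex.I) *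
          (1 + δ + ((2 * Real.pi * ξ : ℝ) : ℂ) * Complex.I)⁻¹ := by
    intro δ ξ hδ
    have hs : (1 + (δ : ℂ) + ((2 * Real.pi * ξ : ℝ) : ℂ) * Complex.I) ∈ openHalfPlane := by
      simp [openHalfPlane, hδ]
    have hne := ne_zero_of_mem_openHalfPlane hs
    rw [fourier_damped_eq hDneg, hF.2 _ hs]
    simp only
    rw [mellinStieltjes_sub_eq hM0 hconv hm hs, mul_comm _ (laplaceShift _ _),
      mul_assoc (laplaceShift _ _), mul_inv_cancel₀ hne, mul_one]
  refine tauberian (normalizedCount_nonneg hM0) (fun u hu => normalizedCount_of_neg hM0 hu)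
    measurable_normalizedCount ?_ hC₀ hm.zero_of_neg hCm hmL hlb ?_ ?_ p
  · intro u v huv
    unfold normalizedCount
    rw [mul_assoc, mul_assoc, ← Real.exp_add, ← Real.exp_add]
    simpa using M.mono (Real.exp_le_exp.2 huv)
  · intro ξ
    have hpath : Tendsto (fun δ : ℝ => (1 + (δ : ℂ) + ((2 * Real.pi * ξ : ℝ) : ℂ) * Complex.I))
        (𝓝[>] 0) (𝓝[closedHalfPlane] (1 + ((2 * Real.pi * ξ : ℝ) : ℂ) * Complex.I)) := by
      refine tendsto_nhdsWithin_iff.2 ⟨?_, ?_⟩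
      · have hc : Continuous fun δ : ℝ =>
            (1 + (δ : ℂ) + ((2 * Real.pi * ξ : ℝ) : ℂ) * Complex.I) := by fun_prop
        have := (hc.tendsto 0).mono_left (nhdsWithin_le_nhds (s := Set.Ioi 0))
        simpa using this
      · filter_upwards [self_mem_nhdsWithin] with δ hδ
        have : 0 < δ := hδ
        simp [closedHalfPlane, this.le]
    have h1 : Tendsto F (𝓝[closedHalfPlane] (1 + ((2 * Real.pi * ξ : ℝ) : ℂ) * Complex.I))
        (𝓝 (F (1 + ((2 * Real.pi * ξ : ℝ) : ℂ) * Complex.I))) :=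
      hFc _ (by simp [closedHalfPlane])
    have h2 := (h1.comp hpath).mul ((hpath.mono_right nhdsWithin_le_nhds).inv₀
      (one_add_mul_I_ne_zero _))
    refine h2.congr' ?_
    filter_upwards [self_mem_nhdsWithin] with δ hδ
    exact (hval δ ξ hδ).symm
  · intro R
    obtain ⟨C, hC⟩ := (isCompact_box (2 * Real.pi * R)).exists_bound_of_continuousOn
      (hFc.mono fun s hs => (Complex.mem_reProdIm.1 hs).1.1)
    refine ⟨C, ?_⟩
    filter_upwards [Ioo_mem_nhdsGT (zero_lt_one' ℝ)] with δ hδ ξ hξ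
    have hs : (1 + (δ : ℂ) + ((2 * Real.pi * ξ : ℝ) : ℂ) * Complex.I) ∈ openHalfPlane := by
      simp [openHalfPlane, hδ.1]
    rw [hval δ ξ hδ.1, norm_mul, norm_inv]
    have h1 : ‖F (1 + (δ : ℂ) + ((2 * Real.pi * ξ : ℝ) : ℂ) * Complex.I)‖ ≤ C := by
      refine hC _ ?_
      rw [Complex.mem_reProdIm]
      have h2 := abs_le.1 hξ
      have h3 : 0 < 2 * Real.pi := by positivity
      refine ⟨⟨?_, ?_⟩, ⟨?_, ?_⟩⟩
      · simp [hδ.1.le]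
      · simp; linarith [hδ.2]
      · simp; nlinarith
      · simp; nlinarith
    exact (mul_le_of_le_one_right (norm_nonneg _)
      (inv_le_one_of_one_le₀ (norm_ge_of_mem_openHalfPlane hs).le)).trans h1

end CountTauberian

/-! ### Main terms -/

/-- The normalized primitive `exp (-u) * ∫ v in 0..u, w v` of a density, extended by zero. -/
noncomputable def mainTerm (w : ℝ → ℝ) (u : ℝ) : ℝ :=
  Real.exp (-(max u 0)) * ∫ v in (0 : ℝ)..max u 0, w v

/-- The Laplace transform of a density. -/
noncomputable def densityTransform (w : ℝ → ℝ) (s : ℂ) : ℂ :=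
  ∫ v in Set.Ioi (0 : ℝ), (w v : ℂ) * Complex.exp (-s * v)

lemma integrableOn_mul_exp_neg {δ : ℝ} (hδ : 0 < δ) :
    IntegrableOn (fun u : ℝ => u * Real.exp (-δ * u)) (Set.Ioi 0) := by
  simpa using integrableOn_rpow_mul_exp_neg_mul_rpow (s := 1) (p := 1) (by norm_num) one_pos hδ

section Density

variable {w : ℝ → ℝ} (hwc : Continuous w) {C : ℝ} (hw : ∀ v, 0 ≤ v → |w v| ≤ C * Real.exp v)

include hw in
lemma abs_primitive_le {u : ℝ} (hu : 0 ≤ u) : |∫ v in (0 : ℝ)..u, w v| ≤ C * Real.exp u := by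
  have hC : 0 ≤ C := by
    have := (abs_nonneg _).trans (hw 0 le_rfl)
    simpa using this
  have h := intervalIntegral.norm_integral_le_of_norm_le (μ := volume) (f := w) hu
    (g := fun v => C * Real.exp v)
    (Filter.Eventually.of_forall fun v hv => hw v hv.1.le)
    (Continuous.intervalIntegrable (by fun_prop) _ _)
  rw [Real.norm_eq_abs] at h
  refine h.trans ?_
  rw [intervalIntegral.integral_const_mul, integral_exp]
  refine mul_le_mul_of_nonneg_left ?_ hC
  linarith [Real.exp_pos 0]

include hwc hw in
lemma integrableOn_density_mul_exp {s : ℂ} (hs : s ∈ openHalfPlane) :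
    IntegrableOn (fun v : ℝ => (w v : ℂ) * Complex.exp (-s * v)) (Set.Ioi 0) := by
  have h1 : 1 < s.re := hs
  refine Integrable.mono' ((integrableOn_exp_mul_Ioi (a := -(s.re - 1)) (by linarith) 0).const_mul C)
    (Continuous.aestronglyMeasurable (by fun_prop)) ?_
  filter_upwards [ae_restrict_mem measurableSet_Ioi] with v hv
  rw [norm_mul, Complex.norm_real, Complex.norm_exp]
  have h2 : (-s * (v : ℂ)).re = -s.re * v := by simp
  rw [h2]
  calc |w v| * Real.exp (-s.re * v) ≤ C * Real.exp v * Real.exp (-s.re * v) := by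
        gcongr
        exact hw v (le_of_lt hv)
    _ = C * Real.exp (-(s.re - 1) * v) := by rw [mul_assoc, ← Real.exp_add]; ring_nf

include hw in
lemma norm_densityTransform_le {s : ℂ} (hs : s ∈ openHalfPlane) :
    ‖densityTransform w s‖ ≤ C / (s.re - 1) := by
  have h1 : 1 < s.re := hs
  have h := norm_integral_le_of_norm_le (μ := volume.restrict (Set.Ioi (0 : ℝ)))
    (f := fun v : ℝ => (w v : ℂ) * Complex.exp (-s * v))
    ((integrableOn_exp_mul_Ioi (a := -(s.re - 1)) (by linarith) 0).const_mul C) (by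
      filter_upwards [ae_restrict_mem measurableSet_Ioi] with v hv
      rw [norm_mul, Complex.norm_real, Complex.norm_exp]
      have h2 : (-s * (v : ℂ)).re = -s.re * v := by simp
      rw [h2]
      calc |w v| * Real.exp (-s.re * v) ≤ C * Real.exp v * Real.exp (-s.re * v) := by
            gcongr
            exact hw v (le_of_lt hv)
        _ = C * Real.exp (-(s.re - 1) * v) := by rw [mul_assoc, ← Real.exp_add]; ring_nf)
  refine h.trans (le_of_eq ?_)
  rw [integral_const_mul, integral_exp_mul_Ioi (by linarith)]
  have : s.re - 1 ≠ 0 := by linarith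
  simp only [mul_zero, Real.exp_zero]
  field_simp

-- The density may grow like e^v, so the factor e^{-(1+δ)v} is moved into it and the Laplace
-- transform is taken at s - δ. Half the distance to the boundary, δ = (Re s - 1)/2, leaves s - δ in
-- the half-plane and makes the new density decay exponentially.
include hwc hw in
lemma hasDerivAt_densityTransform {s : ℂ} (hs : s ∈ openHalfPlane) :
    HasDerivAt (densityTransform w) (∫ v in Set.Ioi (0 : ℝ), ((-v * w v : ℝ) : ℂ) *
      Complex.exp (-s * v)) s := by
  have h1 : 1 < s.re := hs
  set δ : ℝ := (s.re - 1) / 2 with hδ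
  have hδ0 : 0 < δ := by rw [hδ]; linarith
  set D : ℝ → ℝ := fun v => w v * Real.exp (-(1 + δ) * v) with hD
  have hDle : ∀ v, 0 ≤ v → |D v| ≤ C * Real.exp (-δ * v) := by
    intro v hv
    rw [hD]
    simp only
    rw [abs_mul, Real.abs_exp]
    calc |w v| * Real.exp (-(1 + δ) * v) ≤ C * Real.exp v * Real.exp (-(1 + δ) * v) := by
          gcongr
          exact hw v hv
      _ = C * Real.exp (-δ * v) := by rw [mul_assoc, ← Real.exp_add]; ring_nf
  have hDc : Continuous D := by rw [hD]; fun_prop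
  have hI : IntegrableOn D (Set.Ioi 0) := by
    refine Integrable.mono' ((integrableOn_exp_mul_Ioi (a := -δ) (by linarith) 0).const_mul C)
      hDc.aestronglyMeasurable ?_
    filter_upwards [ae_restrict_mem measurableSet_Ioi] with v hv using hDle v (le_of_lt hv)
  have hI1 : IntegrableOn (fun v => -v * D v) (Set.Ioi 0) := by
    refine Integrable.mono' ((integrableOn_mul_exp_neg hδ0).const_mul C)
      (Continuous.aestronglyMeasurable (by fun_prop)) ?_
    filter_upwards [ae_restrict_mem measurableSet_Ioi] with v hv
    have hv0 : 0 ≤ v := le_of_lt hv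
    rw [norm_mul, norm_neg, Real.norm_eq_abs, Real.norm_eq_abs, abs_of_nonneg hv0]
    have := mul_le_mul_of_nonneg_left (hDle v hv0) hv0
    linarith
  have hshift : s - δ ∈ openHalfPlane := by
    change 1 < (s - δ).re
    simp
    rw [hδ]; linarith
  have h2 := (hasDerivAt_laplaceShift hI hI1 hshift).comp s ((hasDerivAt_id s).sub_const (δ : ℂ))
  rw [mul_one] at h2
  have key : ∀ (z : ℂ) (v : ℝ), Complex.exp (-(z - δ - 1) * v)
      * (Real.exp (-(1 + δ) * v) : ℂ) = Complex.exp (-z * v) := by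
    intro z v
    rw [Complex.ofReal_exp, ← Complex.exp_add]
    congr 1
    push_cast
    ring
  refine (h2.congr_deriv ?_).congr_of_eventuallyEq (Filter.Eventually.of_forall fun z => ?_)
  · unfold laplaceShift
    refine integral_congr_ae (Filter.Eventually.of_forall fun v => ?_)
    simp only
    rw [← key s v, hD]
    push_cast
    ring
  · simp only [Function.comp, id]
    unfold laplaceShift densityTransform
    refine integral_congr_ae (Filter.Eventually.of_forall fun v => ?_)
    simp only
    rw [← key z v, hD]
    push_cast
    ring

lemma mainTerm_of_nonneg {u : ℝ} (hu : 0 ≤ u) :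
    mainTerm w u = Real.exp (-u) * ∫ v in (0 : ℝ)..u, w v := by
  rw [mainTerm, max_eq_left hu]

include hw in
lemma abs_mainTerm_le (u : ℝ) : |mainTerm w u| ≤ C := by
  have h := abs_primitive_le hw (le_max_right u 0)
  rw [mainTerm, abs_mul, Real.abs_exp]
  calc _ ≤ Real.exp (-(max u 0)) * (C * Real.exp (max u 0)) := by gcongr
    _ = C * (Real.exp (-(max u 0)) * Real.exp (max u 0)) := by ring
    _ = C := by rw [← Real.exp_add]; simp

-- On u ≥ 0 the function g satisfies g' = -g + e^{-u}w(u), with both terms at most C; the truncation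
-- u ↦ max(u, 0) does not increase distances.
include hwc hw in
lemma mainTerm_lipschitz (u v : ℝ) : |mainTerm w u - mainTerm w v| ≤ 2 * C * |u - v| := by
  have hC : 0 ≤ C := (abs_nonneg _).trans (abs_mainTerm_le hw 0)
  set g : ℝ → ℝ := fun u => Real.exp (-u) * ∫ v in (0 : ℝ)..u, w v with hg
  have hd : ∀ u, HasDerivAt g (-g u + Real.exp (-u) * w u) u := by
    intro u
    have h1 : HasDerivAt (fun u => ∫ v in (0 : ℝ)..u, w v) (w u) u :=
      intervalIntegral.integral_hasDerivAt_right (hwc.intervalIntegrable _ _)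
        (hwc.stronglyMeasurableAtFilter _ _) hwc.continuousAt
    have h2 : HasDerivAt (fun u : ℝ => Real.exp (-u)) (-Real.exp (-u)) u := by
      simpa using (hasDerivAt_id u).neg.exp
    refine (h2.fun_mul h1).congr_deriv ?_
    rw [hg]
    ring
  have h := (convex_Ici (0 : ℝ)).norm_image_sub_le_of_norm_hasDerivWithin_le (f := g) (C := 2 * C)
    (fun x _ => (hd x).hasDerivWithinAt) (fun x hx => ?_)
    (x := max v 0) (le_max_right v 0) (y := max u 0) (le_max_right u 0)
  · have h3 : ‖max u 0 - max v 0‖ ≤ |u - v| := abs_max_sub_max_le_abs u v 0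
    exact h.trans (mul_le_mul_of_nonneg_left h3 (by positivity))
  · have hx0 : 0 ≤ x := hx
    have h4 := abs_mainTerm_le hw x
    rw [mainTerm_of_nonneg hx0] at h4
    have h5 : |Real.exp (-x) * w x| ≤ C := by
      rw [abs_mul, Real.abs_exp]
      calc _ ≤ Real.exp (-x) * (C * Real.exp x) := by gcongr; exact hw x hx0
        _ = C * (Real.exp (-x) * Real.exp x) := by ring
        _ = C := by rw [← Real.exp_add]; simp
    refine (norm_add_le _ _).trans ?_
    rw [norm_neg]
    have h6 : ‖g x‖ ≤ C := h4
    have h7 : ‖Real.exp (-x) * w x‖ ≤ C := h5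
    linarith

-- Integration by parts for the primitive Q of w: both boundary terms vanish, since Q(0) = 0 and
-- |Q(u)| ≤ C e^u while Re s > 1.
include hwc hw in
lemma densityTransform_eq_laplaceShift {s : ℂ} (hs : s ∈ openHalfPlane) :
    densityTransform w s = s * laplaceShift (mainTerm w) s := by
  have h1 : 1 < s.re := hs
  have hC : 0 ≤ C := (abs_nonneg _).trans (abs_mainTerm_le hw 0)
  set Q : ℝ → ℝ := fun u => ∫ v in (0 : ℝ)..u, w v with hQ
  have hQd : ∀ u, HasDerivAt Q (w u) u := fun u =>
    intervalIntegral.integral_hasDerivAt_right (hwc.intervalIntegrable _ _)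
        (hwc.stronglyMeasurableAtFilter _ _) hwc.continuousAt
  have hmc : Continuous (mainTerm w) := by
    have : LipschitzWith (2 * C).toNNReal (mainTerm w) := by
      refine LipschitzWith.of_dist_le_mul fun u v => ?_
      rw [Real.dist_eq, Real.dist_eq, Real.coe_toNNReal _ (by positivity)]
      exact mainTerm_lipschitz hwc hw u v
    exact this.continuous
  have heq : ∀ u ∈ Set.Ioi (0 : ℝ), (mainTerm w u : ℂ) * Complex.exp (-(s - 1) * u)
      = (Q u : ℂ) * Complex.exp (-s * u) := by
    intro u hu
    rw [mainTerm_of_nonneg (le_of_lt hu), Complex.ofReal_mul, Complex.ofReal_exp, mul_assoc,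
      mul_left_comm, ← Complex.exp_add]
    congr 2
    push_cast
    ring
  have hint1 := integrableOn_of_bounded_laplace hmc (abs_mainTerm_le hw) hs
  have hint2 : IntegrableOn (fun u : ℝ => (Q u : ℂ) * Complex.exp (-s * u)) (Set.Ioi 0) :=
    hint1.congr_fun heq measurableSet_Ioi
  have hint3 := integrableOn_density_mul_exp hwc hw hs
  have hd : ∀ u : ℝ, HasDerivAt (fun u : ℝ => (Q u : ℂ) * Complex.exp (-s * u))
      ((w u : ℂ) * Complex.exp (-s * u) - s * ((Q u : ℂ) * Complex.exp (-s * u))) u := by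
    intro u
    have h2 : HasDerivAt (fun u : ℝ => Complex.exp (-s * u)) (Complex.exp (-s * u) * (-s)) u := by
      have : HasDerivAt (fun u : ℝ => -s * (u : ℂ)) (-s) u := by
        simpa using (Complex.ofRealCLM.hasDerivAt (x := u)).const_mul (-s)
      exact this.cexp
    refine ((hQd u).ofReal_comp.fun_mul h2).congr_deriv ?_
    ring
  have hlim : Tendsto (fun u : ℝ => (Q u : ℂ) * Complex.exp (-s * u)) atTop (𝓝 0) := by
    rw [tendsto_zero_iff_norm_tendsto_zero]
    have h3 : Tendsto (fun u : ℝ => C * Real.exp (-((s.re - 1) * u))) atTop (𝓝 (C * 0)) :=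
      (Real.tendsto_exp_neg_atTop_nhds_zero.comp
        (tendsto_id.const_mul_atTop (by linarith : 0 < s.re - 1))).const_mul C
    rw [mul_zero] at h3
    refine squeeze_zero' (Filter.Eventually.of_forall fun u => norm_nonneg _) ?_ h3
    filter_upwards [eventually_ge_atTop 0] with u hu
    rw [norm_mul, Complex.norm_real, Complex.norm_exp]
    have h2 : (-s * (u : ℂ)).re = -s.re * u := by simp
    rw [h2]
    calc ‖Q u‖ * Real.exp (-s.re * u) ≤ C * Real.exp u * Real.exp (-s.re * u) := by
          gcongr
          exact abs_primitive_le hw hu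
      _ = _ := by rw [mul_assoc, ← Real.exp_add]; ring_nf
  have h := integral_Ioi_of_hasDerivAt_of_tendsto (a := (0 : ℝ))
    (hd 0).continuousAt.continuousWithinAt (fun u _ => hd u)
    (hint3.sub (hint2.const_mul s)) hlim
  rw [integral_sub hint3 (hint2.const_mul s), integral_const_mul] at h
  have hQ0 : Q 0 = 0 := by simp [hQ]
  rw [hQ0, Complex.ofReal_zero, zero_mul, sub_zero, sub_eq_zero] at h
  unfold densityTransform laplaceShift
  rw [h, setIntegral_congr_fun measurableSet_Ioi heq]

include hwc hw in
theorem isMainTerm_mainTerm : IsMainTerm (mainTerm w) (densityTransform w) where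
  zero_of_neg u hu := by rw [mainTerm, max_eq_right hu.le]; simp
  bounded_lipschitz := by
    have hC : 0 ≤ C := (abs_nonneg _).trans (abs_mainTerm_le hw 0)
    exact ⟨2 * C, fun u => (abs_mainTerm_le hw u).trans (by linarith), mainTerm_lipschitz hwc hw⟩
  eq_laplace s hs := densityTransform_eq_laplaceShift hwc hw hs
  differentiableOn s hs :=
    (hasDerivAt_densityTransform hwc hw hs).differentiableAt.differentiableWithinAt
  pole_bound := ⟨C, fun _ hs => norm_densityTransform_le hw hs⟩

end Density

/-! #### The main term of the counting function of the integers -/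

lemma densityTransform_const_mul_exp (a : ℝ) {s : ℂ} (hs : s ∈ openHalfPlane) :
    densityTransform (fun v => a * Real.exp v) s = a / (s - 1) := by
  have h1 : 1 < s.re := hs
  have h2 : ∀ v : ℝ, ((a * Real.exp v : ℝ) : ℂ) * Complex.exp (-s * v)
      = a * Complex.exp ((1 - s) * v) := by
    intro v
    rw [Complex.ofReal_mul, Complex.ofReal_exp, mul_assoc, ← Complex.exp_add]
    ring_nf
  unfold densityTransform
  simp_rw [h2]
  rw [integral_const_mul, integral_exp_mul_complex_Ioi (by simpa using h1)]
  have h3 := sub_one_ne_zero_of_mem_openHalfPlane hs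
  have h4 : 1 - s ≠ 0 := by rw [← neg_sub]; exact neg_ne_zero.2 h3
  simp only [Complex.ofReal_zero, mul_zero, Complex.exp_zero]
  rw [← neg_sub s 1]
  field_simp

/-- The underlying function is a(x - 1) rather than ax: its transform is exactly a/(s - 1), and the
difference is bounded. -/
theorem isMainTerm_linear (a : ℝ) :
    IsMainTerm (mainTerm fun v => a * Real.exp v) (fun s => a / (s - 1)) := by
  have h := isMainTerm_mainTerm (w := fun v => a * Real.exp v) (by fun_prop) (C := |a|)
    fun v _ => by rw [abs_mul, Real.abs_exp]
  have heq : Set.EqOn (densityTransform fun v => a * Real.exp v) (fun s => a / (s - 1))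
      openHalfPlane := fun s hs => densityTransform_const_mul_exp a hs
  refine ⟨h.zero_of_neg, h.bounded_lipschitz, fun s hs => ?_, h.differentiableOn.congr
    fun s hs => (heq hs).symm, ?_⟩
  · exact (heq hs).symm.trans (h.eq_laplace s hs)
  · obtain ⟨C, hC⟩ := h.pole_bound
    exact ⟨C, fun s hs => (congrArg norm (heq hs)).symm.trans_le (hC s hs)⟩

lemma mainTerm_linear {a u : ℝ} (hu : 0 ≤ u) :
    mainTerm (fun v => a * Real.exp v) u = a * (1 - Real.exp (-u)) := by
  rw [mainTerm_of_nonneg hu, intervalIntegral.integral_const_mul, integral_exp, Real.exp_zero]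
  have : Real.exp (-u) * Real.exp u = 1 := by rw [← Real.exp_add]; simp
  linear_combination a * this

/-! #### The main term of the counting function of the primes -/

/-- The density `(exp v - 1) / v`. -/
noncomputable def primeDensity : ℝ → ℝ := dslope Real.exp 0

lemma continuous_primeDensity : Continuous primeDensity := by
  rw [continuous_iff_continuousAt]
  intro v
  rcases eq_or_ne v 0 with rfl | hv
  · exact continuousAt_dslope_same.2 Real.differentiableAt_exp
  · exact (continuousAt_dslope_of_ne hv).2 Real.continuous_exp.continuousAt

lemma mul_primeDensity (v : ℝ) : v * primeDensity v = Real.exp v - 1 := by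
  have := sub_smul_dslope Real.exp 0 v
  simpa [primeDensity] using this

lemma abs_primeDensity_le {v : ℝ} (hv : 0 ≤ v) : |primeDensity v| ≤ 1 * Real.exp v := by
  rcases hv.eq_or_lt with rfl | hv
  · simp [primeDensity, dslope_same]
  · have h := mul_primeDensity v
    have h1 : primeDensity v = (Real.exp v - 1) / v := by field_simp; linarith
    have h2 := Real.add_one_le_exp v
    rw [h1, abs_of_nonneg (div_nonneg (by linarith) hv.le), div_le_iff₀ hv]
    have h3 := Real.add_one_le_exp (-v)
    have h4 : Real.exp (-v) * Real.exp v = 1 := by rw [← Real.exp_add]; simp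
    nlinarith [Real.exp_pos v]

/-- The transform of the main term of the counting function of the primes; it is the logarithm of
`s / (s - 1)`. -/
noncomputable def primeTransform : ℂ → ℂ := densityTransform primeDensity

theorem isMainTerm_prime : IsMainTerm (mainTerm primeDensity) primeTransform :=
  isMainTerm_mainTerm continuous_primeDensity fun _ hv => abs_primeDensity_le hv

lemma norm_primeTransform_le {s : ℂ} (hs : s ∈ openHalfPlane) :
    ‖primeTransform s‖ ≤ 1 / (s.re - 1) :=
  norm_densityTransform_le (fun _ hv => abs_primeDensity_le hv) hs

/-- Differentiation brings down -v, which cancels the denominator of (e^v - 1)/v and leaves two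
elementary integrals. -/
lemma hasDerivAt_primeTransform {s : ℂ} (hs : s ∈ openHalfPlane) :
    HasDerivAt primeTransform (s⁻¹ - (s - 1)⁻¹) s := by
  have h1 : 1 < s.re := hs
  refine (hasDerivAt_densityTransform continuous_primeDensity
    (fun _ hv => abs_primeDensity_le hv) hs).congr_deriv ?_
  have h2 : ∀ v : ℝ, ((-v * primeDensity v : ℝ) : ℂ) * Complex.exp (-s * v)
      = Complex.exp (-s * v) - Complex.exp ((1 - s) * v) := by
    intro v
    have : -v * primeDensity v = 1 - Real.exp v := by linarith [mul_primeDensity v]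
    rw [this, Complex.ofReal_sub, Complex.ofReal_exp, sub_mul, ← Complex.exp_add,
      Complex.ofReal_one, one_mul]
    ring_nf
  simp_rw [h2]
  rw [integral_sub (integrableOn_exp_mul_complex_Ioi (by simp; linarith) 0)
    (integrableOn_exp_mul_complex_Ioi (by simpa using h1) 0),
    integral_exp_mul_complex_Ioi (by simp; linarith),
    integral_exp_mul_complex_Ioi (by simpa using h1)]
  have h3 := sub_one_ne_zero_of_mem_openHalfPlane hs
  have h4 := ne_zero_of_mem_openHalfPlane hs
  simp only [Complex.ofReal_zero, mul_zero, Complex.exp_zero]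
  rw [← neg_sub s 1]
  field_simp

/-- The product of the left side with 1 - 1/s has zero derivative, and it tends to 1 along the real
axis. No branch of the logarithm has to be chosen. -/
theorem exp_primeTransform {s : ℂ} (hs : s ∈ openHalfPlane) :
    Complex.exp (primeTransform s) = s / (s - 1) := by
  have hd : ∀ s ∈ openHalfPlane,
      HasDerivAt (fun s => Complex.exp (primeTransform s) * (1 - s⁻¹)) 0 s := by
    intro s hs
    have h3 := sub_one_ne_zero_of_mem_openHalfPlane hs
    have h4 := ne_zero_of_mem_openHalfPlane hs
    refine ((hasDerivAt_primeTransform hs).cexp.fun_mul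
      ((hasDerivAt_inv h4).const_sub 1)).congr_deriv ?_
    field_simp
    ring
  obtain ⟨c, hc⟩ := isOpen_openHalfPlane.exists_is_const_of_deriv_eq_zero
    convex_openHalfPlane.isPreconnected
    (fun s hs => (hd s hs).differentiableAt.differentiableWithinAt) (fun s hs => (hd s hs).deriv)
  have hlimA : Tendsto (fun x : ℝ => primeTransform x) atTop (𝓝 0) := by
    rw [tendsto_zero_iff_norm_tendsto_zero]
    have h1 : Tendsto (fun x : ℝ => 1 / (x - 1)) atTop (𝓝 0) := by
      have := tendsto_inv_atTop_zero.comp (tendsto_atTop_add_const_right atTop (-1 : ℝ) tendsto_id)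
      refine this.congr fun x => ?_
      simp [sub_eq_add_neg]
    refine squeeze_zero' (Filter.Eventually.of_forall fun u => norm_nonneg _) ?_ h1
    filter_upwards [eventually_gt_atTop 1] with x hx
    simpa using norm_primeTransform_le (s := x) (by simpa [openHalfPlane] using hx)
  have hlim : Tendsto (fun x : ℝ => Complex.exp (primeTransform x) * (1 - (x : ℂ)⁻¹)) atTop
      (𝓝 (Complex.exp 0 * (1 - 0))) := by
    have h2 : Tendsto (fun x : ℝ => (x : ℂ)⁻¹) atTop (𝓝 0) := by
      have := (Complex.continuous_ofReal.tendsto 0).comp tendsto_inv_atTop_zero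
      simpa [Function.comp_def] using this
    exact ((Complex.continuous_exp.tendsto 0).comp hlimA).mul (tendsto_const_nhds.sub h2)
  have hc1 : c = 1 := by
    refine tendsto_nhds_unique (f := fun _ : ℝ => c) (l := atTop) tendsto_const_nhds ?_
    simp only [Complex.exp_zero, sub_zero, mul_one] at hlim
    refine hlim.congr' ?_
    filter_upwards [eventually_gt_atTop 1] with x hx
    exact hc x (by simpa [openHalfPlane] using hx)
  have h3 := sub_one_ne_zero_of_mem_openHalfPlane hs
  have h4 := ne_zero_of_mem_openHalfPlane hs
  have h5 := hc s hs
  rw [hc1] at h5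
  field_simp at h5 ⊢
  exact h5

/-- After t = e^v, Li(e^u) has density e^v/v on [log 2, u], which differs from `primeDensity` by 1/v
≤ 1/log 2. The piece over [0, log 2] is a constant. -/
lemma abs_primitive_primeDensity_sub_logIntegral_le : ∃ C : ℝ, ∀ u : ℝ, 1 ≤ u →
    |(∫ v in (0 : ℝ)..u, primeDensity v) - logIntegral (Real.exp u)| ≤ C * u := by
  have hlog2 : 0 < Real.log 2 := Real.log_pos (by norm_num)
  have hlog2' : Real.log 2 < 1 := by linarith [Real.log_two_lt_d9]
  refine ⟨|∫ v in (0 : ℝ)..Real.log 2, primeDensity v| + 1 / Real.log 2, fun u hu => ?_⟩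
  have hpos : ∀ v ∈ Set.uIcc (Real.log 2) u, Real.log 2 ≤ v := fun v hv => by
    rw [Set.uIcc_of_le (by linarith)] at hv
    exact hv.1
  have hLi : logIntegral (Real.exp u) = ∫ v in Real.log 2..u, Real.exp v / v := by
    have h := intervalIntegral.integral_comp_mul_deriv'' (a := Real.log 2) (b := u)
      (f := Real.exp) (f' := Real.exp) (g := fun t => 1 / Real.log t)
      Real.continuous_exp.continuousOn
      (fun x _ => (Real.hasDerivAt_exp x).hasDerivWithinAt) Real.continuous_exp.continuousOn
      (by
        rintro _ ⟨v, hv, rfl⟩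
        have hv' := hpos v hv
        refine (ContinuousAt.div continuousAt_const
          (Real.continuousAt_log (Real.exp_pos v).ne') ?_).continuousWithinAt
        rw [Real.log_exp]
        linarith)
    rw [Real.exp_log two_pos] at h
    rw [logIntegral, ← h]
    refine intervalIntegral.integral_congr fun v _ => ?_
    simp only [Function.comp, Real.log_exp]
    ring
  have hint1 := continuous_primeDensity.intervalIntegrable (μ := volume) (Real.log 2) u
  have hint2 : IntervalIntegrable (fun v : ℝ => Real.exp v / v) volume (Real.log 2) u := by
    refine ContinuousOn.intervalIntegrable (ContinuousOn.div (by fun_prop) (by fun_prop) ?_)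
    intro v hv
    linarith [hpos v hv]
  rw [hLi, ← intervalIntegral.integral_add_adjacent_intervals
    (continuous_primeDensity.intervalIntegrable (μ := volume) 0 (Real.log 2)) hint1, add_sub_assoc,
    ← intervalIntegral.integral_sub hint1 hint2]
  have h3 : |∫ v in Real.log 2..u, (primeDensity v - Real.exp v / v)|
      ≤ 1 / Real.log 2 * |u - Real.log 2| := by
    refine intervalIntegral.norm_integral_le_of_norm_le_const
      (f := fun v => primeDensity v - Real.exp v / v) fun v hv => ?_
    have hv' := hpos v (Set.uIoc_subset_uIcc hv)
    have hv0 : 0 < v := by linarith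
    have h4 : primeDensity v - Real.exp v / v = -(1 / v) := by
      have := mul_primeDensity v
      field_simp
      linarith
    rw [h4, norm_neg, Real.norm_eq_abs, abs_of_pos (by positivity)]
    exact one_div_le_one_div_of_le hlog2 hv'
  rw [abs_of_nonneg (by linarith : 0 ≤ u - Real.log 2)] at h3
  have h5 : 1 / Real.log 2 * (u - Real.log 2) ≤ 1 / Real.log 2 * u := by
    gcongr
    linarith
  have h6 := abs_nonneg (∫ v in (0 : ℝ)..Real.log 2, primeDensity v)
  refine (abs_add_le _ _).trans ?_
  nlinarith

/-! ### Division by `s - 1` -/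

/-- The `n`-th derivative of the divided difference `(K s - K 1) / (s - 1)`. -/
noncomputable def dividedDifference (K : ℂ → ℂ) (n : ℕ) (s : ℂ) : ℂ :=
  ∫ u in Set.Ioc (0 : ℝ) 1, (u : ℂ) ^ n * iteratedDeriv (n + 1) K (1 + u * (s - 1))

lemma one_add_mul_mem_openHalfPlane {s : ℂ} (hs : s ∈ openHalfPlane) {u : ℝ} (hu : 0 < u) :
    1 + (u : ℂ) * (s - 1) ∈ openHalfPlane := by
  have h1 : 1 < s.re := hs
  change 1 < (1 + (u : ℂ) * (s - 1)).re
  simp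
  nlinarith

section Division

variable {K : ℂ → ℂ} (hd : DifferentiableOn ℂ K openHalfPlane) (hK : ∀ n, SubpolyUpTo n K)

include hd in
lemma aestronglyMeasurable_dividedDifference (m n : ℕ) {s : ℂ} (hs : s ∈ openHalfPlane) :
    AEStronglyMeasurable (fun u : ℝ => (u : ℂ) ^ m * iteratedDeriv n K (1 + u * (s - 1)))
      (volume.restrict (Set.Ioc (0 : ℝ) 1)) := by
  refine ContinuousOn.aestronglyMeasurable (ContinuousOn.mul (by fun_prop) ?_) measurableSet_Ioc
  exact (differentiableOn_iteratedDeriv isOpen_openHalfPlane hd n).continuousOn.comp (by fun_prop)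
    fun u hu => one_add_mul_mem_openHalfPlane hs hu.1

-- The segment from 1 to s stays in the half-plane, and the imaginary part along it never exceeds
-- that of s in modulus; so growth bounds pass from K to the divided difference.
include hK in
lemma norm_dividedDifference_kernel_le (n : ℕ) {ε : ℝ} (hε : 0 < ε) : ∃ C : ℝ, 0 ≤ C ∧
    ∀ s ∈ openHalfPlane, ∀ u ∈ Set.Ioc (0 : ℝ) 1, ∀ m : ℕ,
      ‖(u : ℂ) ^ m * iteratedDeriv n K (1 + u * (s - 1))‖ ≤ C * (1 + |s.im|) ^ ε := by
  obtain ⟨C, hC0, hC⟩ := (hK n n le_rfl).exists_nonneg hε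
  refine ⟨C, hC0, fun s hs u hu m => ?_⟩
  have h1 := hC _ (one_add_mul_mem_openHalfPlane hs hu.1)
  have h2 : |(1 + (u : ℂ) * (s - 1)).im| ≤ |s.im| := by
    simp only [Complex.add_im, Complex.one_im, Complex.mul_im, Complex.ofReal_re, Complex.sub_im,
      Complex.ofReal_im, zero_mul, add_zero, zero_add, sub_zero]
    rw [abs_mul, abs_of_pos hu.1]
    exact mul_le_of_le_one_left (abs_nonneg _) hu.2
  rw [norm_mul, norm_pow, Complex.norm_real, Real.norm_eq_abs, abs_of_pos hu.1]
  refine (mul_le_of_le_one_left (norm_nonneg _) (pow_le_one₀ hu.1.le hu.2)).trans (h1.trans ?_)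
  gcongr

include hd hK in
lemma hasDerivAt_dividedDifference (n : ℕ) {s : ℂ} (hs : s ∈ openHalfPlane) :
    HasDerivAt (dividedDifference K n) (dividedDifference K (n + 1) s) s := by
  obtain ⟨C, hC0, hC⟩ := norm_dividedDifference_kernel_le hK (n + 1) one_pos
  obtain ⟨C', hC0', hC'⟩ := norm_dividedDifference_kernel_le hK (n + 2) one_pos
  have hint : ∀ c : ℝ, Integrable (fun _ : ℝ => c) (volume.restrict (Set.Ioc (0 : ℝ) 1)) := by
    intro c
    exact integrable_const c
  refine (hasDerivAt_integral_of_dominated_loc_of_deriv_le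
    (F := fun (z : ℂ) (u : ℝ) => (u : ℂ) ^ n * iteratedDeriv (n + 1) K (1 + u * (z - 1)))
    (F' := fun (z : ℂ) (u : ℝ) => (u : ℂ) ^ (n + 1) *
      iteratedDeriv (n + 1 + 1) K (1 + u * (z - 1)))
    (s := openHalfPlane ∩ Metric.ball s 1)
    (inter_mem (isOpen_openHalfPlane.mem_nhds hs) (Metric.ball_mem_nhds s one_pos))
    (bound := fun _ => C' * (2 + |s.im|)) ?_ ?_
    (aestronglyMeasurable_dividedDifference hd _ _ hs) ?_ (hint _) ?_).2
  · filter_upwards [isOpen_openHalfPlane.mem_nhds hs] with z hz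
    exact aestronglyMeasurable_dividedDifference hd _ _ hz
  · refine Integrable.mono' (hint (C * (1 + |s.im|) ^ (1 : ℝ)))
      (aestronglyMeasurable_dividedDifference hd _ _ hs) ?_
    filter_upwards [ae_restrict_mem measurableSet_Ioc] with u hu using hC s hs u hu n
  · filter_upwards [ae_restrict_mem measurableSet_Ioc] with u hu z hz
    refine (hC' z hz.1 u hu (n + 1)).trans ?_
    rw [Real.rpow_one]
    have h1 : |(z - s).im| ≤ 1 := (Complex.abs_im_le_norm _).trans
      (mem_ball_iff_norm.1 hz.2).le
    have h2 : |z.im| ≤ |z.im - s.im| + |s.im| := by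
      simpa using abs_add_le (z.im - s.im) s.im
    rw [Complex.sub_im] at h1
    exact mul_le_mul_of_nonneg_left (by linarith) hC0'
  · filter_upwards [ae_restrict_mem measurableSet_Ioc] with u hu z hz
    have h1 : HasDerivAt (fun z : ℂ => 1 + (u : ℂ) * (z - 1)) (u : ℂ) z := by
      simpa using (((hasDerivAt_id z).sub_const 1).const_mul (u : ℂ)).const_add 1
    have h2 := (hasDerivAt_iteratedDeriv isOpen_openHalfPlane hd (n + 1)
      (one_add_mul_mem_openHalfPlane hz.1 hu.1)).comp z h1
    refine (h2.const_mul ((u : ℂ) ^ n)).congr_deriv ?_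
    ring

-- The fundamental theorem of calculus along the segment from 1 to s. At the end 1, a boundary
-- point, only the limit of K is available.
include hd hK in
lemma sub_one_mul_dividedDifference {a : ℂ} (ha : Tendsto K (𝓝[openHalfPlane] 1) (𝓝 a)) {s : ℂ}
    (hs : s ∈ openHalfPlane) : (s - 1) * dividedDifference K 0 s = K s - a := by
  obtain ⟨C, hC0, hC⟩ := norm_dividedDifference_kernel_le hK 1 one_pos
  have hder : ∀ u : ℝ, 0 < u → HasDerivAt (fun u : ℝ => K (1 + u * (s - 1)))
      (deriv K (1 + u * (s - 1)) * (s - 1)) u := by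
    intro u hu
    have h1 : HasDerivAt (fun u : ℝ => 1 + (u : ℂ) * (s - 1)) (s - 1) u := by
      simpa using ((Complex.ofRealCLM.hasDerivAt (x := u)).mul_const (s - 1)).const_add 1
    exact (hd.differentiableAt (isOpen_openHalfPlane.mem_nhds
      (one_add_mul_mem_openHalfPlane hs hu))).hasDerivAt.comp u h1
  have hmeas := aestronglyMeasurable_dividedDifference hd 0 1 hs
  have hint : IntegrableOn (fun u : ℝ => deriv K (1 + u * (s - 1))) (Set.Ioc (0 : ℝ) 1) := by
    have : IntegrableOn (fun u : ℝ => (u : ℂ) ^ 0 * iteratedDeriv 1 K (1 + u * (s - 1)))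
        (Set.Ioc (0 : ℝ) 1) := by
      refine Integrable.mono' (integrable_const (C * (1 + |s.im|) ^ (1 : ℝ))) hmeas ?_
      filter_upwards [ae_restrict_mem measurableSet_Ioc] with u hu using hC s hs u hu 0
    simpa using this
  have hlim0 : Tendsto (fun u : ℝ => K (1 + u * (s - 1))) (𝓝[>] 0) (𝓝 a) := by
    refine ha.comp (tendsto_nhdsWithin_iff.2 ⟨?_, ?_⟩)
    · have : Continuous fun u : ℝ => 1 + (u : ℂ) * (s - 1) := by fun_prop
      have h := this.tendsto 0
      simp only [Complex.ofReal_zero, zero_mul, add_zero] at h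
      exact h.mono_left nhdsWithin_le_nhds
    · filter_upwards [self_mem_nhdsWithin] with u hu using one_add_mul_mem_openHalfPlane hs hu
  have hlim1 : Tendsto (fun u : ℝ => K (1 + u * (s - 1))) (𝓝[<] 1) (𝓝 (K s)) := by
    have h := (hder 1 one_pos).continuousAt.tendsto
    simp only [Complex.ofReal_one, one_mul, add_sub_cancel] at h
    exact h.mono_left nhdsWithin_le_nhds
  have h := intervalIntegral.integral_eq_sub_of_hasDerivAt_of_tendsto zero_lt_one
    (fun u hu => hder u hu.1)
    ((intervalIntegrable_iff_integrableOn_Ioc_of_le zero_le_one).2 (hint.mul_const (s - 1)))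
    hlim0 hlim1
  rw [← h, intervalIntegral.integral_of_le zero_le_one, integral_mul_const, mul_comm]
  unfold dividedDifference
  simp

include hd hK in
lemma subpolyUpTo_dividedDifference (m n : ℕ) : SubpolyUpTo m (dividedDifference K n) := by
  have hg : ∀ n, SubpolyGrowth (dividedDifference K n) := by
    intro n ε hε
    obtain ⟨C, hC0, hC⟩ := norm_dividedDifference_kernel_le hK (n + 1) hε
    refine ⟨C, fun s hs => ?_⟩
    have := norm_setIntegral_le_of_norm_le_const (μ := volume) (s := Set.Ioc (0 : ℝ) 1)
      (C := C * (1 + |s.im|) ^ ε) (by simp) (fun u hu => hC s hs u hu n)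
    simpa [dividedDifference] using this
  induction m generalizing n with
  | zero => exact SubpolyUpTo.zero_iff.2 (hg n)
  | succ m ih =>
    exact SubpolyUpTo.succ_iff.2 ⟨hg n, (ih (n + 1)).congr fun s hs =>
      (hasDerivAt_dividedDifference hd hK n hs).deriv.symm⟩

include hd hK in
/-- Dividing out a zero at the boundary point `1` preserves subpolynomial growth. -/
theorem subpolyUpTo_div_sub_one {a : ℂ} (ha : Tendsto K (𝓝[openHalfPlane] 1) (𝓝 a)) (n : ℕ) :
    SubpolyUpTo n fun s => (K s - a) / (s - 1) := by
  refine (subpolyUpTo_dividedDifference hd hK n 0).congr fun s hs => ?_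
  have h3 := sub_one_ne_zero_of_mem_openHalfPlane hs
  rw [eq_div_iff h3, mul_comm]
  exact sub_one_mul_dividedDifference hd hK ha hs

end Division

/-! ### The zeta function and its logarithm -/

theorem exists_smoothExtension_of_subpolyUpTo {f : ℂ → ℂ}
    (hd : DifferentiableOn ℂ f openHalfPlane) (hf : ∀ n, SubpolyUpTo n f) :
    ∃ F : ℂ → ℂ, IsSmoothExtension f F ∧ ∀ n : ℕ, ∀ z ∈ closedHalfPlane,
      Tendsto (iteratedDeriv n f) (𝓝[openHalfPlane] z)
        (𝓝 (iteratedDerivWithin n F closedHalfPlane z)) := by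
  refine exists_smoothExtension hd fun n T => ?_
  obtain ⟨C, hC0, hC⟩ := (hf n n le_rfl).exists_nonneg one_pos
  refine ⟨C * (1 + T), fun s hs hT => (hC s hs).trans ?_⟩
  rw [Real.rpow_one]
  gcongr

/-- The inequality `3 + 4 cos θ + cos (2 θ) ≥ 0` for Mellin-Stieltjes transforms. -/
lemma three_four_one_mellinStieltjes {M : StieltjesFunction ℝ} {σ : ℝ}
    (hM : MellinStieltjesConvergent M σ) (t : ℝ) :
    0 ≤ 3 * (mellinStieltjes M σ).re + 4 * (mellinStieltjes M (σ + t * Complex.I)).re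
      + (mellinStieltjes M (σ + (2 * t : ℝ) * Complex.I)).re := by
  have hM1 : MellinStieltjesConvergent M (σ + t * Complex.I) := hM.mono (by simp)
  have hM2 : MellinStieltjesConvergent M (σ + (2 * t : ℝ) * Complex.I) :=
    hM.mono (le_of_eq (by simp))
  have h0 : (3 * mellinStieltjes M σ + 4 * mellinStieltjes M (σ + t * Complex.I)
      + mellinStieltjes M (σ + (2 * t : ℝ) * Complex.I)).re
      = 3 * (mellinStieltjes M σ).re + 4 * (mellinStieltjes M (σ + t * Complex.I)).re
      + (mellinStieltjes M (σ + (2 * t : ℝ) * Complex.I)).re := by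
    simp
  rw [← h0]
  unfold mellinStieltjes
  unfold MellinStieltjesConvergent at hM hM1 hM2
  have hsum : IntegrableOn (fun x : ℝ => 3 * (x : ℂ) ^ (-(σ : ℂ))
      + 4 * (x : ℂ) ^ (-((σ : ℂ) + t * Complex.I))) (Set.Ici 1) M.measure :=
    (hM.const_mul 3).add (hM1.const_mul 4)
  rw [← integral_const_mul, ← integral_const_mul,
    ← integral_add (hM.const_mul 3) (hM1.const_mul 4), ← integral_add hsum hM2]
  have hre := integral_re (𝕜 := ℂ) (hsum.add hM2)
  refine le_of_le_of_eq ?_ hre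
  refine setIntegral_nonneg measurableSet_Ici fun x hx => ?_
  have h3 : ∀ τ : ℝ, ((x : ℂ) ^ (-((σ : ℂ) + τ * Complex.I))).re
      = Real.exp (-σ * Real.log x) * Real.cos (τ * Real.log x) := by
    intro τ
    rw [cpow_neg_eq_exp hx, Complex.exp_re]
    simp
  have h4 := h3 0
  simp only [Complex.ofReal_zero, zero_mul, add_zero, Real.cos_zero, mul_one] at h4
  have h5 : RCLike.re (3 * (x : ℂ) ^ (-(σ : ℂ)) + 4 * (x : ℂ) ^ (-((σ : ℂ) + t * Complex.I))
      + (x : ℂ) ^ (-((σ : ℂ) + (2 * t : ℝ) * Complex.I)))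
      = Real.exp (-σ * Real.log x) * (2 * (1 + Real.cos (t * Real.log x)) ^ 2) := by
    have h6 : RCLike.re (3 * (x : ℂ) ^ (-(σ : ℂ)) + 4 * (x : ℂ) ^ (-((σ : ℂ) + t * Complex.I))
        + (x : ℂ) ^ (-((σ : ℂ) + (2 * t : ℝ) * Complex.I)))
        = 3 * ((x : ℂ) ^ (-(σ : ℂ))).re + 4 * ((x : ℂ) ^ (-((σ : ℂ) + t * Complex.I))).re
        + ((x : ℂ) ^ (-((σ : ℂ) + (2 * t : ℝ) * Complex.I))).re := by
      simp only [RCLike.re_to_complex, Complex.add_re, Complex.mul_re, Complex.re_ofNat,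
        Complex.im_ofNat, zero_mul, sub_zero]
    rw [h6, h3, h3, h4, mul_assoc 2, Real.cos_two_mul]
    ring
  change 0 ≤ RCLike.re (3 * (x : ℂ) ^ (-(σ : ℂ)) + 4 * (x : ℂ) ^ (-((σ : ℂ) + t * Complex.I))
      + (x : ℂ) ^ (-((σ : ℂ) + (2 * t : ℝ) * Complex.I)))
  rw [h5]
  positivity

lemma ofReal_mem_openHalfPlane {σ : ℝ} (hσ : 1 < σ) : (σ : ℂ) ∈ openHalfPlane := by
  simpa [openHalfPlane] using hσ

lemma add_ofReal_mem_openHalfPlane {s : ℂ} (hs : s ∈ openHalfPlane) {η : ℝ} (hη : 0 ≤ η) :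
    s + η ∈ openHalfPlane := by
  have h1 : 1 < s.re := hs
  change 1 < (s + η).re
  simp
  linarith

namespace BeurlingSystem

variable (B : BeurlingSystem)

lemma norm_zeta_le (s : ℂ) : ‖B.zeta s‖ ≤ (B.zeta s.re).re := norm_mellinStieltjes_le B.N s

lemma norm_zeta_eq {s : ℂ} (hs : s ∈ openHalfPlane) :
    ‖B.zeta s‖ = Real.exp (mellinStieltjes B.P s).re := by
  rw [B.zeta_eq_exp s hs, Complex.norm_exp]

/-- The 3-4-1 inequality for dΠ, exponentiated through log |ζ| = Re ∫ x^{-s} dΠ. -/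
theorem one_le_zeta_pow_mul {σ : ℝ} (hσ : 1 < σ) (t : ℝ) :
    1 ≤ (B.zeta σ).re ^ 3 * ‖B.zeta (σ + t * Complex.I)‖ ^ 4
      * ‖B.zeta (σ + (2 * t : ℝ) * Complex.I)‖ := by
  have h0 : (B.zeta σ).re = ‖B.zeta σ‖ := by
    have h1 : B.zeta σ = ((B.zeta σ).re : ℂ) := mellinStieltjes_ofReal_re B.N σ
    have h2 := B.one_le_zeta_re hσ
    conv_rhs => rw [h1, Complex.norm_real, Real.norm_eq_abs, abs_of_pos (by linarith)]
  have hmem : ∀ τ : ℝ, (σ : ℂ) + τ * Complex.I ∈ openHalfPlane := fun τ => by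
    simpa [openHalfPlane] using hσ
  rw [h0, B.norm_zeta_eq (ofReal_mem_openHalfPlane hσ), B.norm_zeta_eq (hmem t),
    B.norm_zeta_eq (hmem _), ← Real.exp_nat_mul, ← Real.exp_nat_mul, ← Real.exp_add,
    ← Real.exp_add]
  refine Real.one_le_exp ?_
  have := three_four_one_mellinStieltjes (B.convergent_P σ (ofReal_mem_openHalfPlane hσ)) t
  push_cast at this ⊢
  linarith

lemma exp_neg_le_norm_zeta {σ : ℝ} (hσ : 1 < σ) {s : ℂ} (hs : σ ≤ s.re) :
    Real.exp (-(mellinStieltjes B.P σ).re) ≤ ‖B.zeta s‖ := by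
  have hs1 : s ∈ openHalfPlane := lt_of_lt_of_le hσ hs
  rw [B.norm_zeta_eq hs1]
  refine Real.exp_le_exp.2 ?_
  have h1 := norm_mellinStieltjes_le B.P s
  have h2 := mellinStieltjes_re_antitone (B.convergent_P σ (ofReal_mem_openHalfPlane hσ)) hs
  have h3 := (abs_le.1 (Complex.abs_re_le_norm (mellinStieltjes B.P s))).1
  linarith

/-- The logarithm of `(s - 1) ζ(s) / s`. -/
noncomputable def logRemainder (s : ℂ) : ℂ := mellinStieltjes B.P s - primeTransform s

lemma differentiableOn_logRemainder : DifferentiableOn ℂ B.logRemainder openHalfPlane :=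
  differentiableOn_mellinStieltjes_sub B.convergent_P isMainTerm_prime

lemma exp_logRemainder {s : ℂ} (hs : s ∈ openHalfPlane) :
    Complex.exp (B.logRemainder s) = (s - 1) * B.zeta s / s := by
  have h3 := sub_one_ne_zero_of_mem_openHalfPlane hs
  have h4 := ne_zero_of_mem_openHalfPlane hs
  rw [logRemainder, Complex.exp_sub, ← B.zeta_eq_exp s hs, exp_primeTransform hs]
  field_simp

lemma zeta_eq_mul_exp_logRemainder {s : ℂ} (hs : s ∈ openHalfPlane) :
    B.zeta s = s / (s - 1) * Complex.exp (B.logRemainder s) := by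
  have h3 := sub_one_ne_zero_of_mem_openHalfPlane hs
  have h4 := ne_zero_of_mem_openHalfPlane hs
  rw [B.exp_logRemainder hs]
  field_simp

lemma differentiableOn_zetaMinusPole (a : ℝ) :
    DifferentiableOn ℂ (B.zetaMinusPole a) openHalfPlane := by
  refine B.differentiableOn_zeta.sub (DifferentiableOn.div (by fun_prop) (by fun_prop) ?_)
  exact fun s hs => sub_one_ne_zero_of_mem_openHalfPlane hs

lemma norm_exp_logRemainder_le {b : ℝ}
    (hb : ∀ σ : ℝ, 1 < σ → (B.zeta σ).re ≤ b * (1 + 1 / (σ - 1))) {s : ℂ}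
    (hs : s ∈ openHalfPlane) :
    ‖Complex.exp (B.logRemainder s)‖ ≤ 2 * b * (1 + 1 / (s.re - 1)) := by
  have hs1 := norm_ge_of_mem_openHalfPlane hs
  have h1 : ‖s - 1‖ ≤ 2 * ‖s‖ := by
    have := norm_sub_le s 1
    rw [norm_one] at this
    linarith
  have h2 := (B.norm_zeta_le s).trans (hb s.re hs)
  rw [B.exp_logRemainder hs, norm_div, norm_mul, div_le_iff₀ (by linarith)]
  have h3 := mul_le_mul h1 h2 (norm_nonneg _) (by positivity)
  linarith

/-- Compare s with s + η, where η = (1 + |t|)^{-ε}. Since the derivative of L is O((1 + |t|)^ε), L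
changes by a bounded amount, so e^L changes by a bounded factor; and at s + η positivity gives |e^L|
= O(1 + 1/η). -/
lemma subpolyGrowth_exp_logRemainder (hf : SubpolyUpTo 1 B.logRemainder) :
    SubpolyGrowth fun s => Complex.exp (B.logRemainder s) := by
  obtain ⟨C, hC0, hC⟩ := hf.growth.exists_nonneg one_pos
  have hzeta : ∀ σ : ℝ, 1 < σ → (B.zeta σ).re ≤ Real.exp C * (1 + 1 / (σ - 1)) := by
    intro σ hσ
    have hσ' := ofReal_mem_openHalfPlane hσ
    have h1 := hC σ hσ'
    simp only [Complex.ofReal_im, abs_zero, add_zero, Real.one_rpow, mul_one] at h1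
    refine (Complex.re_le_norm _).trans ?_
    rw [B.zeta_eq_mul_exp_logRemainder hσ', norm_mul, mul_comm]
    have h2 : ‖(σ : ℂ) / (σ - 1)‖ = 1 + 1 / (σ - 1) := by
      rw [show (σ : ℂ) / (σ - 1) = ((σ / (σ - 1) : ℝ) : ℂ) by push_cast; rfl, Complex.norm_real,
        Real.norm_eq_abs, abs_of_pos (div_pos (by linarith) (by linarith))]
      have : σ - 1 ≠ 0 := by linarith
      field_simp
      ring
    rw [h2, Complex.norm_exp]
    have h3 : 0 ≤ 1 / (σ - 1) := one_div_nonneg.2 (by linarith)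
    gcongr
    exact (Complex.re_le_norm _).trans h1
  intro ε hε
  obtain ⟨C₁, hC₁0, hC₁⟩ := (SubpolyUpTo.succ_iff.1 hf).2.growth.exists_nonneg hε
  refine ⟨4 * Real.exp C * Real.exp C₁, fun s hs => ?_⟩
  have hs1 : 1 < s.re := hs
  set P := 1 + |s.im| with hP
  have hP1 : 1 ≤ P := by rw [hP]; linarith [abs_nonneg s.im]
  have hP0 : 0 < P := by linarith
  have hPε : 1 ≤ P ^ ε := Real.one_le_rpow hP1 hε.le
  set η : ℝ := (P ^ ε)⁻¹ with hη
  have hη0 : 0 < η := by positivity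
  have h1 := norm_le_norm_add_horizontal B.differentiableOn_logRemainder hs (C := C₁ * P ^ ε)
    (fun z hz him => by have := hC₁ z hz; rwa [him] at this) hη0.le
  rw [mul_assoc, hη, mul_inv_cancel₀ (by positivity), mul_one, ← hη] at h1
  have h2 := B.norm_exp_logRemainder_le hzeta (add_ofReal_mem_openHalfPlane hs hη0.le)
  have h3 : 1 / ((s + η).re - 1) ≤ P ^ ε := by
    have : (s + η).re = s.re + η := by simp
    rw [this, ← inv_inv (P ^ ε), ← hη, ← one_div]
    exact one_div_le_one_div_of_le hη0 (by linarith)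
  have h4 : Complex.exp (B.logRemainder s) = Complex.exp (B.logRemainder (s + η))
      * Complex.exp (-(B.logRemainder (s + η) - B.logRemainder s)) := by
    rw [← Complex.exp_add]; ring_nf
  have h5 : ‖Complex.exp (-(B.logRemainder (s + η) - B.logRemainder s))‖ ≤ Real.exp C₁ := by
    rw [Complex.norm_exp]
    refine Real.exp_le_exp.2 ((Complex.re_le_norm _).trans ?_)
    rwa [norm_neg]
  simp only
  rw [h4, norm_mul]
  have h6 : ‖Complex.exp (B.logRemainder (s + η))‖ ≤ 4 * Real.exp C * P ^ ε := by
    refine h2.trans ?_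
    have : 0 < Real.exp C := Real.exp_pos C
    nlinarith
  calc _ ≤ 4 * Real.exp C * P ^ ε * Real.exp C₁ :=
        mul_le_mul h6 h5 (norm_nonneg _) (by positivity)
    _ = _ := by ring

/-- Regularity of `log ζ` implies regularity of `ζ`. -/
theorem subpolyUpTo_zetaMinusPole_of_logRemainder (hf : ∀ n, SubpolyUpTo n B.logRemainder) :
    ∃ a : ℝ, 0 < a ∧ ∀ n, SubpolyUpTo n (B.zetaMinusPole a) := by
  set K : ℂ → ℂ := fun s => Complex.exp (B.logRemainder s) with hK
  have hKd : DifferentiableOn ℂ K openHalfPlane := B.differentiableOn_logRemainder.cexp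
  have hKs : ∀ n, SubpolyUpTo n K := fun n => SubpolyUpTo.exp B.differentiableOn_logRemainder (hf n)
    (B.subpolyGrowth_exp_logRemainder (hf 1))
  obtain ⟨F, -, hF⟩ := exists_smoothExtension_of_subpolyUpTo B.differentiableOn_logRemainder hf
  have hlim := hF 0 1 (by simp [closedHalfPlane])
  simp only [iteratedDeriv_zero, iteratedDerivWithin_zero] at hlim
  have hKlim : Tendsto K (𝓝[openHalfPlane] 1) (𝓝 (Complex.exp (F 1))) :=
    (Complex.continuous_exp.tendsto _).comp hlim
  -- The density is the boundary value of (s - 1)ζ(s)/s at 1. It is real and nonnegative as a limit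
  -- along the real axis, and nonzero because it is an exponential.
  obtain ⟨a, ha0, ha⟩ : ∃ a : ℝ, 0 < a ∧ Complex.exp (F 1) = a := by
    have hpath : Tendsto (fun σ : ℝ => (σ : ℂ)) (𝓝[>] 1) (𝓝[openHalfPlane] 1) := by
      refine tendsto_nhdsWithin_iff.2 ⟨?_, ?_⟩
      · have := Complex.continuous_ofReal.tendsto 1
        rw [Complex.ofReal_one] at this
        exact this.mono_left nhdsWithin_le_nhds
      · filter_upwards [self_mem_nhdsWithin] with σ hσ using ofReal_mem_openHalfPlane hσ
    have hlimK := hKlim.comp hpath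
    have hreal : ∀ σ : ℝ, 1 < σ → K σ = ((K σ).re : ℂ) ∧ 0 ≤ (K σ).re := by
      intro σ hσ
      have h1 : B.zeta σ = ((B.zeta σ).re : ℂ) := mellinStieltjes_ofReal_re B.N σ
      have h2 : K σ = (((σ - 1) * (B.zeta σ).re / σ : ℝ) : ℂ) := by
        rw [hK]
        simp only
        rw [B.exp_logRemainder (ofReal_mem_openHalfPlane hσ), h1]
        push_cast
        rfl
      have h3 := B.one_le_zeta_re hσ
      rw [h2, Complex.ofReal_re]
      exact ⟨rfl, div_nonneg (mul_nonneg (by linarith) (by linarith)) (by linarith)⟩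
    have hre := (Complex.continuous_re.tendsto _).comp hlimK
    have him := (Complex.continuous_im.tendsto _).comp hlimK
    have him0 : (Complex.exp (F 1)).im = 0 := by
      refine tendsto_nhds_unique him (tendsto_const_nhds.congr' ?_)
      filter_upwards [self_mem_nhdsWithin] with σ hσ
      have := congrArg Complex.im (hreal σ hσ).1
      simpa using this.symm
    have hre0 : 0 ≤ (Complex.exp (F 1)).re := by
      refine ge_of_tendsto hre ?_
      filter_upwards [self_mem_nhdsWithin] with σ hσ using (hreal σ hσ).2
    have heq : Complex.exp (F 1) = ((Complex.exp (F 1)).re : ℂ) := by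
      apply Complex.ext <;> simp [him0]
    refine ⟨(Complex.exp (F 1)).re, lt_of_le_of_ne hre0 fun h => ?_, heq⟩
    rw [← h, Complex.ofReal_zero] at heq
    exact Complex.exp_ne_zero _ heq
  rw [ha] at hKlim
  -- Uses ζ - a/(s - 1) = K + (K - a)/(s - 1), which follows from ζ = K s/(s - 1).
  refine ⟨a, ha0, fun n => (SubpolyUpTo.add hKd ?_ (hKs n)
    (subpolyUpTo_div_sub_one hKd hKs hKlim n)).congr fun s hs => ?_⟩
  · exact (hKd.sub_const _).fun_div (by fun_prop) fun s hs => sub_one_ne_zero_of_mem_openHalfPlane hs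
  · have h3 := sub_one_ne_zero_of_mem_openHalfPlane hs
    simp only
    rw [zetaMinusPole, B.zeta_eq_mul_exp_logRemainder hs]
    simp only [hK]
    field_simp
    ring

end BeurlingSystem

/-! ### Lower bounds for ζ and the passage from ζ to log ζ. -/

namespace BeurlingSystem

variable (B : BeurlingSystem) {a : ℝ}

lemma exp_logRemainder_eq (a : ℝ) {s : ℂ} (hs : s ∈ openHalfPlane) :
    Complex.exp (B.logRemainder s) = B.zetaMinusPole a s * (1 + -1 * s⁻¹) + a * s⁻¹ := by
  have h3 := sub_one_ne_zero_of_mem_openHalfPlane hs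
  have h4 := ne_zero_of_mem_openHalfPlane hs
  rw [B.exp_logRemainder hs, zetaMinusPole]
  field_simp
  ring

lemma subpolyUpTo_exp_logRemainder {n : ℕ} (hG : SubpolyUpTo n (B.zetaMinusPole a)) :
    SubpolyUpTo n fun s => Complex.exp (B.logRemainder s) := by
  have hinv := differentiableOn_inv_openHalfPlane
  have h1 : SubpolyUpTo n fun s : ℂ => 1 + -1 * s⁻¹ :=
    SubpolyUpTo.add (differentiableOn_const 1) (hinv.const_mul (-1)) (SubpolyUpTo.const 1)
      (SubpolyUpTo.const_mul hinv (subpolyUpTo_inv_id n) (-1))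
  have h1d : DifferentiableOn ℂ (fun s : ℂ => 1 + -1 * s⁻¹) openHalfPlane :=
    (hinv.const_mul (-1)).const_add 1
  exact (SubpolyUpTo.add ((B.differentiableOn_zetaMinusPole a).mul h1d) (hinv.const_mul (a : ℂ))
    (SubpolyUpTo.mul (B.differentiableOn_zetaMinusPole a) h1d hG h1)
    (SubpolyUpTo.const_mul hinv (subpolyUpTo_inv_id n) a)).congr fun s hs =>
      (B.exp_logRemainder_eq a hs).symm

/-- Near 1 one has e^L = a + (G - a)(s - 1)/s with G bounded, and δ is chosen so that the second
term is at most a/2. -/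
lemma exists_lower_bound_near_one (ha : 0 < a) (hG : SubpolyGrowth (B.zetaMinusPole a)) :
    ∃ δ : ℝ, 0 < δ ∧ δ ≤ 1 ∧ ∀ s ∈ openHalfPlane, ‖s - 1‖ ≤ δ →
      a / 2 ≤ ‖Complex.exp (B.logRemainder s)‖ := by
  obtain ⟨C, hC0, hC⟩ := hG.exists_nonneg one_pos
  refine ⟨min 1 (a / (2 * (2 * C + a))), by positivity, min_le_left _ _, fun s hs hδ => ?_⟩
  have h1 : ‖s - 1‖ ≤ 1 := hδ.trans (min_le_left _ _)
  have h2 : ‖s - 1‖ ≤ a / (2 * (2 * C + a)) := hδ.trans (min_le_right _ _)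
  have h4 := ne_zero_of_mem_openHalfPlane hs
  have h5 : |s.im| ≤ 1 := by
    have := Complex.abs_im_le_norm (s - 1)
    simp only [Complex.sub_im, Complex.one_im, sub_zero] at this
    linarith
  have h6 : ‖B.zetaMinusPole a s‖ ≤ 2 * C := by
    refine (hC s hs).trans ?_
    rw [Real.rpow_one]
    nlinarith
  have h7 : Complex.exp (B.logRemainder s) = a + (B.zetaMinusPole a s - a) * ((s - 1) * s⁻¹) := by
    rw [B.exp_logRemainder_eq a hs]
    field_simp
    ring
  have h8 : ‖(B.zetaMinusPole a s - a) * ((s - 1) * s⁻¹)‖ ≤ a / 2 := by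
    rw [norm_mul, norm_mul, norm_inv]
    have h9 : ‖B.zetaMinusPole a s - a‖ ≤ 2 * C + a := by
      refine (norm_sub_le _ _).trans ?_
      rw [Complex.norm_real, Real.norm_eq_abs, abs_of_pos ha]
      linarith
    have h10 : ‖s‖⁻¹ ≤ 1 := inv_le_one_of_one_le₀ (norm_ge_of_mem_openHalfPlane hs).le
    calc _ ≤ (2 * C + a) * (a / (2 * (2 * C + a)) * 1) := by gcongr
      _ = a / 2 := by
        have : 2 * C + a ≠ 0 := by positivity
        field_simp
  have h11 := norm_sub_norm_le (a : ℂ) (-((B.zetaMinusPole a s - a) * ((s - 1) * s⁻¹)))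
  rw [sub_neg_eq_add, ← h7, norm_neg, Complex.norm_real, Real.norm_eq_abs, abs_of_pos ha] at h11
  linarith

lemma norm_zeta_le_norm_exp_logRemainder {δ : ℝ} (hδ : 0 < δ) {s : ℂ} (hs : s ∈ openHalfPlane)
    (h : δ ≤ ‖s - 1‖) :
    ‖B.zeta s‖ ≤ (1 + 1 / δ) * ‖Complex.exp (B.logRemainder s)‖ := by
  have h4 : ‖s‖ ≤ (1 + 1 / δ) * ‖s - 1‖ := by
    have h1 : ‖s‖ ≤ ‖s - 1‖ + 1 := by simpa using norm_add_le (s - 1) 1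
    have h2 : 1 ≤ 1 / δ * ‖s - 1‖ := by
      rw [one_div, ← div_eq_inv_mul, one_le_div hδ]
      exact h
    linarith
  have h5 : 0 < ‖s - 1‖ := by linarith
  rw [B.zeta_eq_mul_exp_logRemainder hs, norm_mul, norm_div]
  gcongr
  rwa [div_le_iff₀ h5]

/-- A lower bound off the real axis, obtained from the `3-4-1` inequality at `s + η` and
horizontal continuity. -/
lemma exists_lower_bound_of_abs_im (ha : 0 < a) (hG : ∀ n, SubpolyUpTo n (B.zetaMinusPole a))
    {δ ε : ℝ} (hδ : 0 < δ) (hε : 0 < ε) :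
    ∃ c : ℝ, 0 < c ∧ ∀ s ∈ openHalfPlane, δ ≤ |s.im| →
      1 ≤ c * (1 + |s.im|) ^ (4 * ε) * ‖Complex.exp (B.logRemainder s)‖ := by
  obtain ⟨C₀, hC₀0, hC₀⟩ := (hG 0).growth.exists_nonneg one_pos
  obtain ⟨C₂, hC₂0, hC₂⟩ := (hG 0).growth.exists_nonneg hε
  obtain ⟨C₃', hC₃0', hC₃'⟩ := ((SubpolyUpTo.succ_iff.1
    (B.subpolyUpTo_exp_logRemainder (hG 1))).2).growth.exists_nonneg hε
  set C₃ := C₃' + 1 with hC₃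
  have hC₃1 : 1 ≤ C₃ := by linarith
  set b := C₀ + a with hb
  have hb0 : 0 < b := by positivity
  set c₂ := C₂ * 2 ^ ε + a / δ with hc₂
  have hc₂0 : 0 < c₂ := by positivity
  set κ := 1 + 1 / δ with hκ
  have hκ0 : 0 < κ := by positivity
  have hzeta : ∀ σ : ℝ, 1 < σ → (B.zeta σ).re ≤ b * (1 + 1 / (σ - 1)) := by
    intro σ hσ
    have h1 := hC₀ σ (ofReal_mem_openHalfPlane hσ)
    simp only [Complex.ofReal_im, abs_zero, add_zero, Real.one_rpow, mul_one] at h1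
    have h2 : (B.zeta σ).re = (B.zetaMinusPole a σ).re + a / (σ - 1) := by
      rw [zetaMinusPole, show (a : ℂ) / (σ - 1) = ((a / (σ - 1) : ℝ) : ℂ) by push_cast; rfl,
        Complex.sub_re, Complex.ofReal_re]
      ring
    have h3 := (Complex.re_le_norm _).trans h1
    have h4 : 0 ≤ 1 / (σ - 1) := one_div_nonneg.2 (by linarith)
    rw [h2, hb, div_eq_mul_one_div]
    nlinarith
  -- With k = |e^L| at s + η and X = (1 + |t|)^ε, the 3-4-1 inequality reads dη³ ≤ k⁴X. The constant
  -- e below is fixed so that η = e/X⁵ gives (2C₃Xη)⁴X ≤ dη³, hence k ≥ 2C₃Xη.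
  set d : ℝ := (8 * b ^ 3 * c₂ * κ ^ 4)⁻¹ with hd
  have hd0 : 0 < d := by positivity
  set e : ℝ := min 1 (d / (16 * C₃ ^ 4)) with he
  have he0 : 0 < e := by positivity
  refine ⟨(C₃ * e)⁻¹, by positivity, fun s hs him => ?_⟩
  have hs1 : 1 < s.re := hs
  set P := 1 + |s.im| with hP
  have hP1 : 1 ≤ P := by rw [hP]; linarith [abs_nonneg s.im]
  have hP0 : 0 < P := by linarith
  set X := P ^ ε with hX
  have hX1 : 1 ≤ X := Real.one_le_rpow hP1 hε.le
  have hX0 : 0 < X := by linarith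
  have hX4 : P ^ (4 * ε) = X ^ 4 := by
    rw [hX, mul_comm, Real.rpow_mul hP0.le]
    norm_cast
  set η : ℝ := e / X ^ 5 with hη
  have hη0 : 0 < η := by positivity
  have hη1 : η ≤ 1 := by
    rw [hη, div_le_one (by positivity)]
    exact (min_le_left _ _).trans (one_le_pow₀ hX1)
  have hs' := add_ofReal_mem_openHalfPlane hs hη0.le
  set z : ℂ := s + η with hz
  have hzre : z.re = s.re + η := by simp [hz]
  have hzim : z.im = s.im := by simp [hz]
  set k := ‖Complex.exp (B.logRemainder z)‖ with hk
  have h341 := B.one_le_zeta_pow_mul (σ := z.re) hs' z.im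
  rw [Complex.re_add_im] at h341
  have hb1 : (B.zeta z.re).re ≤ 2 * b / η := by
    refine (hzeta z.re hs').trans ?_
    have h1 : 1 / (z.re - 1) ≤ 1 / η := one_div_le_one_div_of_le hη0 (by linarith)
    have h2 : 1 ≤ 1 / η := by rwa [le_div_iff₀ hη0, one_mul]
    calc b * (1 + 1 / (z.re - 1)) ≤ b * (1 / η + 1 / η) := by gcongr
      _ = 2 * b / η := by ring
  have hb2 : ‖B.zeta (z.re + (2 * z.im : ℝ) * Complex.I)‖ ≤ c₂ * X := by
    set y : ℂ := z.re + (2 * z.im : ℝ) * Complex.I with hy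
    have hyre : y.re = z.re := by simp [hy]
    have hyim : y.im = 2 * s.im := by simp [hy, hzim]
    have hym : y ∈ openHalfPlane := by change 1 < y.re; rw [hyre]; exact hs'
    have h1 := hC₂ y hym
    have h2 : (1 + |y.im|) ^ ε ≤ 2 ^ ε * X := by
      rw [hX, ← Real.mul_rpow (by norm_num) hP0.le]
      refine Real.rpow_le_rpow (by positivity) ?_ hε.le
      rw [hyim, abs_mul, abs_two, hP]
      linarith
    have h3 : δ ≤ ‖y - 1‖ := by
      have h4 := Complex.abs_im_le_norm (y - 1)
      simp only [Complex.sub_im, Complex.one_im, sub_zero] at h4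
      rw [hyim, abs_mul, abs_two] at h4
      linarith [abs_nonneg s.im]
    have h5 : B.zeta y = B.zetaMinusPole a y + a / (y - 1) := by rw [zetaMinusPole]; ring
    have h6 : ‖(a : ℂ) / (y - 1)‖ ≤ a / δ := by
      rw [norm_div, Complex.norm_real, Real.norm_eq_abs, abs_of_pos ha]
      gcongr
    rw [h5]
    refine (norm_add_le _ _).trans ?_
    have h7 : C₂ * (1 + |y.im|) ^ ε ≤ C₂ * (2 ^ ε * X) := by gcongr
    have h8 : a / δ * 1 ≤ a / δ * X := by gcongr
    rw [hc₂]
    linarith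
  have hb3 : ‖B.zeta z‖ ≤ κ * k := by
    refine B.norm_zeta_le_norm_exp_logRemainder hδ hs' ?_
    have h4 := Complex.abs_im_le_norm (z - 1)
    simp only [Complex.sub_im, Complex.one_im, sub_zero] at h4
    rw [hzim] at h4
    linarith
  have hk0 : 0 ≤ k := norm_nonneg _
  have h1 : 1 ≤ (2 * b / η) ^ 3 * (κ * k) ^ 4 * (c₂ * X) := by
    refine h341.trans ?_
    have h0 : 0 ≤ (B.zeta z.re).re := by linarith [B.one_le_zeta_re (σ := z.re) hs']
    gcongr
  have h2 : d * η ^ 3 ≤ k ^ 4 * X := by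
    have h3 : (2 * b / η) ^ 3 * (κ * k) ^ 4 * (c₂ * X) = k ^ 4 * X / (d * η ^ 3) := by
      rw [hd]
      field_simp
      ring
    rwa [h3, one_le_div (by positivity)] at h1
  have h3 : (2 * C₃ * X * η) ^ 4 ≤ k ^ 4 := by
    have h4 : e * (16 * C₃ ^ 4) ≤ d := by
      rw [← le_div_iff₀ (by positivity)]
      exact min_le_right _ _
    have h5 : (2 * C₃ * X * η) ^ 4 * X = e * (16 * C₃ ^ 4) * η ^ 3 := by
      have : X ^ 5 * η = e := by rw [hη]; field_simp
      linear_combination 16 * C₃ ^ 4 * η ^ 3 * this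
    have h6 : (2 * C₃ * X * η) ^ 4 * X ≤ k ^ 4 * X := by
      rw [h5]
      exact (mul_le_mul_of_nonneg_right h4 (by positivity)).trans h2
    exact le_of_mul_le_mul_right h6 hX0
  have h4 : 2 * C₃ * X * η ≤ k := le_of_pow_le_pow_left₀ (by norm_num) hk0 h3
  -- Going back from s + η to s costs at most C₃Xη, half of the lower bound for k. What remains is
  -- C₃Xη = C₃e X^{-4}, whence the exponent 4ε.
  have h5 := norm_le_norm_add_horizontal (g := fun s => Complex.exp (B.logRemainder s))
    B.differentiableOn_logRemainder.cexp hs (C := C₃ * X)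
    (fun z hz him => by
      have h6 := hC₃' z hz
      rw [him] at h6
      refine h6.trans ?_
      gcongr
      linarith) hη0.le
  have h6 : k ≤ ‖Complex.exp (B.logRemainder s)‖ + C₃ * X * η := by
    have := norm_sub_norm_le (Complex.exp (B.logRemainder z)) (Complex.exp (B.logRemainder s))
    linarith
  have h7 : C₃ * X * η ≤ ‖Complex.exp (B.logRemainder s)‖ := by linarith
  rw [hX4]
  calc (1 : ℝ) = (C₃ * e)⁻¹ * X ^ 4 * (C₃ * X * η) := by
        rw [hη]
        field_simp
    _ ≤ _ := by gcongr

/-- Three regions cover the half-plane: |t| ≥ δ/2, where the 3-4-1 bound applies (with ε/4, because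
of its exponent 4ε); σ ≥ 1 + δ/2, where log |ζ| is bounded below by absolute convergence; and a
remaining box inside the disc of radius δ about 1. -/
lemma subpolyGrowth_inv_exp_logRemainder (ha : 0 < a)
    (hG : ∀ n, SubpolyUpTo n (B.zetaMinusPole a)) :
    SubpolyGrowth fun s => (Complex.exp (B.logRemainder s))⁻¹ := by
  obtain ⟨δ, hδ0, hδ1, hδ⟩ := B.exists_lower_bound_near_one ha (hG 0).growth
  intro ε hε
  obtain ⟨c, hc0, hc⟩ := B.exists_lower_bound_of_abs_im ha hG (half_pos hδ0)
    (by positivity : 0 < ε / 4)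
  rw [mul_div_cancel₀ ε (by norm_num : (4 : ℝ) ≠ 0)] at hc
  set q := Real.exp (mellinStieltjes B.P (1 + δ / 2 : ℝ)).re * (1 + 1 / (δ / 2)) with hq
  have hq0 : 0 < q := by positivity
  refine ⟨c + 2 / a + q, fun s hs => ?_⟩
  have hs1 : 1 < s.re := hs
  have hP := one_le_one_add_abs_rpow s.im hε.le
  set X := (1 + |s.im|) ^ ε with hX
  have hX0 : 0 < X := by linarith
  have hk : 0 < ‖Complex.exp (B.logRemainder s)‖ := norm_pos_iff.2 (Complex.exp_ne_zero _)
  simp only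
  rw [norm_inv, inv_le_iff_one_le_mul₀ hk]
  have hcX : 0 ≤ c * X * ‖Complex.exp (B.logRemainder s)‖ := by positivity
  have haX : 0 ≤ 2 / a * X * ‖Complex.exp (B.logRemainder s)‖ := by positivity
  have hqX : 0 ≤ q * X * ‖Complex.exp (B.logRemainder s)‖ := by positivity
  have hsum : (c + 2 / a + q) * X * ‖Complex.exp (B.logRemainder s)‖
      = c * X * ‖Complex.exp (B.logRemainder s)‖ + 2 / a * X * ‖Complex.exp (B.logRemainder s)‖
        + q * X * ‖Complex.exp (B.logRemainder s)‖ := by ring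
  rw [hsum]
  rcases le_total (δ / 2) |s.im| with h1 | h1
  · have := hc s hs h1
    linarith
  rcases le_total (1 + δ / 2) s.re with h2 | h2
  · have h3 := B.exp_neg_le_norm_zeta (by linarith : 1 < 1 + δ / 2) h2
    have h4 : δ / 2 ≤ ‖s - 1‖ := by
      have := (le_abs_self _).trans (Complex.abs_re_le_norm (s - 1))
      simp only [Complex.sub_re, Complex.one_re] at this
      linarith
    have h5 := h3.trans (B.norm_zeta_le_norm_exp_logRemainder (half_pos hδ0) hs h4)
    rw [Real.exp_neg, inv_le_iff_one_le_mul₀ (Real.exp_pos _)] at h5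
    have h6 : q * 1 * ‖Complex.exp (B.logRemainder s)‖
        ≤ q * X * ‖Complex.exp (B.logRemainder s)‖ := by gcongr
    have h7 : 1 ≤ q * 1 * ‖Complex.exp (B.logRemainder s)‖ := by
      rw [hq]
      linarith
    linarith
  · have h3 : ‖s - 1‖ ≤ δ := by
      have := Complex.norm_le_abs_re_add_abs_im (s - 1)
      simp only [Complex.sub_re, Complex.one_re, Complex.sub_im, Complex.one_im, sub_zero] at this
      rw [abs_of_pos (by linarith)] at this
      linarith
    have h4 := hδ s hs h3
    have h5 : 1 ≤ 2 / a * 1 * ‖Complex.exp (B.logRemainder s)‖ := by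
      calc (1 : ℝ) = 2 / a * 1 * (a / 2) := by field_simp
        _ ≤ _ := by gcongr
    have h6 : 2 / a * 1 * ‖Complex.exp (B.logRemainder s)‖
        ≤ 2 / a * X * ‖Complex.exp (B.logRemainder s)‖ := by gcongr
    linarith

/-- Regularity of `ζ` implies regularity of `log ζ`. -/
theorem subpolyUpTo_logRemainder_of_zetaMinusPole (ha : 0 < a)
    (hG : ∀ n, SubpolyUpTo n (B.zetaMinusPole a)) (n : ℕ) : SubpolyUpTo n B.logRemainder := by
  have hfd := B.differentiableOn_logRemainder
  have hKd : DifferentiableOn ℂ (fun s => Complex.exp (B.logRemainder s)) openHalfPlane := hfd.cexp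
  have h0 : ∀ s ∈ openHalfPlane, Complex.exp (B.logRemainder s) ≠ 0 :=
    fun s _ => Complex.exp_ne_zero _
  -- L' = K'/K with K = e^L, so all derivatives of L except L itself come from K and its inverse.
  have hderiv : ∀ n, SubpolyUpTo n (deriv B.logRemainder) := by
    intro n
    have hK := B.subpolyUpTo_exp_logRemainder (hG (n + 1))
    refine (SubpolyUpTo.mul (hKd.deriv isOpen_openHalfPlane) (hKd.fun_inv h0)
      (SubpolyUpTo.succ_iff.1 hK).2 (SubpolyUpTo.inv hKd h0 (hK.mono n.le_succ)
        (B.subpolyGrowth_inv_exp_logRemainder ha hG))).congr fun s hs => ?_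
    have h := (hfd.differentiableAt (isOpen_openHalfPlane.mem_nhds hs)).hasDerivAt.cexp
    simp only
    rw [h.deriv]
    have := h0 s hs
    field_simp
  -- L is recovered from L' along the horizontal segment from s to s + 1; at s + 1 the real part
  -- exceeds 2 and L is bounded by absolute convergence.
  have hg : SubpolyGrowth B.logRemainder := by
    intro ε hε
    obtain ⟨C, hC0, hC⟩ := (hderiv 0).growth.exists_nonneg hε
    have hT := mellinStieltjes_ofReal_re_nonneg B.P 2
    refine ⟨C + ((mellinStieltjes B.P (2 : ℝ)).re + 1), fun s hs => ?_⟩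
    have hs1 : 1 < s.re := hs
    have h1 := norm_le_norm_add_horizontal hfd hs (C := C * (1 + |s.im|) ^ ε)
      (fun z hz him => by have := hC z hz; rwa [him] at this) zero_le_one
    have hP := one_le_one_add_abs_rpow s.im hε.le
    have hre : (s + (1 : ℝ)).re = s.re + 1 := by simp
    have h2 : ‖B.logRemainder (s + (1 : ℝ))‖ ≤ (mellinStieltjes B.P (2 : ℝ)).re + 1 := by
      refine (norm_sub_le _ _).trans (add_le_add ?_ ?_)
      · refine (norm_mellinStieltjes_le B.P _).trans ?_
        refine mellinStieltjes_re_antitone (B.convergent_P (2 : ℝ) (by norm_num)) ?_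
        rw [hre]; linarith
      · refine (norm_primeTransform_le (add_ofReal_mem_openHalfPlane hs zero_le_one)).trans ?_
        rw [hre, div_le_one (by linarith)]
        linarith
    have h3 := norm_sub_norm_le (B.logRemainder s) (B.logRemainder (s + (1 : ℝ)))
    rw [norm_sub_rev] at h3
    have h4 : ((mellinStieltjes B.P (2 : ℝ)).re + 1) * 1
        ≤ ((mellinStieltjes B.P (2 : ℝ)).re + 1) * (1 + |s.im|) ^ ε := by gcongr
    rw [add_mul]
    linarith
  exact (SubpolyUpTo.succ_iff.2 ⟨hg, hderiv n⟩).mono n.le_succ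

end BeurlingSystem

/-! ### Rapid decay and boundary bounds -/

/-- `D u` is `O (u⁻¹ ^ p)` at infinity for every `p`. -/
def RapidDecay (D : ℝ → ℝ) : Prop := ∀ p : ℕ, ∃ C : ℝ, ∀ᶠ u in atTop, u ^ p * |D u| ≤ C

lemma RapidDecay.of_sub {D E : ℝ → ℝ} (hD : RapidDecay D) (h : RapidDecay fun u => E u - D u) :
    RapidDecay E := by
  intro p
  obtain ⟨C, hC⟩ := hD p
  obtain ⟨C', hC'⟩ := h p
  refine ⟨C + C', ?_⟩
  filter_upwards [hC, hC', eventually_ge_atTop 0] with u h1 h2 h3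
  have h4 : |E u| ≤ |D u| + |E u - D u| := by
    have := abs_add_le (D u) (E u - D u)
    rwa [add_sub_cancel] at this
  have h5 := mul_le_mul_of_nonneg_left h4 (pow_nonneg h3 p)
  linarith

lemma RapidDecay.of_le {E : ℝ → ℝ} {C : ℝ} (h : ∀ u : ℝ, 1 ≤ u → |E u| ≤ C * u * Real.exp (-u)) :
    RapidDecay E := by
  intro p
  have h1 := (Real.tendsto_pow_mul_exp_neg_atTop_nhds_zero (p + 1)).const_mul C
  rw [mul_zero] at h1
  refine ⟨1, ?_⟩
  filter_upwards [h1.eventually_le_const zero_lt_one, eventually_ge_atTop 1] with u h2 h3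
  have h4 := mul_le_mul_of_nonneg_left (h u h3) (pow_nonneg (zero_le_one.trans h3) p)
  refine h4.trans (le_of_eq_of_le ?_ h2)
  ring

/-- Corrections O(u e^{-u}), that is O(log x) before normalization, are invisible to every power of
u; this allows replacing ax and Li(x) by main terms with exact transforms. -/
lemma rapidDecay_iff_of_le {D E : ℝ → ℝ} {C : ℝ}
    (h : ∀ u : ℝ, 1 ≤ u → |E u - D u| ≤ C * u * Real.exp (-u)) : RapidDecay D ↔ RapidDecay E :=
  ⟨fun hD => hD.of_sub (RapidDecay.of_le h), fun hE => hE.of_sub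
    (RapidDecay.of_le fun u hu => by rw [abs_sub_comm]; exact h u hu)⟩

lemma isBigO_div_log_pow_iff {g : ℝ → ℝ} (n : ℕ) :
    g =O[atTop] (fun x : ℝ => x / Real.log x ^ n) ↔
      ∃ C : ℝ, ∀ᶠ u in atTop, u ^ n * |g (Real.exp u) * Real.exp (-u)| ≤ C := by
  constructor
  · intro h
    obtain ⟨C, hC⟩ := h.bound
    refine ⟨C, ?_⟩
    filter_upwards [Real.tendsto_exp_atTop.eventually hC, eventually_gt_atTop 0] with u h1 h2
    rw [Real.log_exp, Real.norm_eq_abs, Real.norm_eq_abs,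
      abs_of_pos (div_pos (Real.exp_pos u) (by positivity : 0 < u ^ n))] at h1
    rw [abs_mul, Real.abs_exp]
    calc u ^ n * (|g (Real.exp u)| * Real.exp (-u))
        ≤ u ^ n * (C * (Real.exp u / u ^ n) * Real.exp (-u)) := by gcongr
      _ = C * (Real.exp u * Real.exp (-u)) := by field_simp
      _ = C := by rw [← Real.exp_add]; simp
  · rintro ⟨C, hC⟩
    refine IsBigO.of_bound C ?_
    filter_upwards [Real.tendsto_log_atTop.eventually hC, eventually_gt_atTop 1] with x h1 h2
    have hx : 0 < x := by linarith
    have hl : 0 < Real.log x := Real.log_pos h2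
    rw [Real.exp_neg, Real.exp_log hx, abs_mul, abs_of_pos (inv_pos.2 hx)] at h1
    rw [Real.norm_eq_abs, Real.norm_eq_abs, abs_of_pos (by positivity : 0 < x / Real.log x ^ n),
      mul_div_assoc', le_div_iff₀ (by positivity)]
    calc |g x| * Real.log x ^ n = Real.log x ^ n * (|g x| * x⁻¹) * x := by field_simp
      _ ≤ C * x := by gcongr

lemma forall_isBigO_iff_rapidDecay {g : ℝ → ℝ} :
    (∀ n : ℕ, g =O[atTop] (fun x : ℝ => x / Real.log x ^ n)) ↔
      RapidDecay fun u => g (Real.exp u) * Real.exp (-u) :=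
  forall_congr' isBigO_div_log_pow_iff

/-- An eventual bound becomes one on all of [1, ∞): on the initial interval M is bounded by
monotonicity and m is bounded outright. -/
lemma rapidDecay_iff_of_isMainTerm {M : StieltjesFunction ℝ} {m : ℝ → ℝ} {A : ℂ → ℂ}
    (hM0 : ∀ x < 1, M x = 0) (hm : IsMainTerm m A) :
    RapidDecay (fun u => normalizedCount M u - m u) ↔
      ∀ p : ℕ, ∃ C : ℝ, ∀ u : ℝ, 1 ≤ u → u ^ p * |normalizedCount M u - m u| ≤ C := by
  refine forall_congr' fun p => ⟨?_, fun ⟨C, hC⟩ => ⟨C, (eventually_ge_atTop 1).mono hC⟩⟩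
  rintro ⟨C, hC⟩
  obtain ⟨U, hU⟩ := eventually_atTop.1 hC
  obtain ⟨Cm, hCm, -⟩ := hm.bounded_lipschitz
  have hCm0 : 0 ≤ Cm := (abs_nonneg _).trans (hCm 0)
  have hpos : ∀ x, 0 ≤ M x := StieltjesFunction.nonneg_of_support hM0
  refine ⟨|C| + |U| ^ p * (M (Real.exp U) + Cm), fun u hu => ?_⟩
  have h0 : 0 ≤ |U| ^ p * (M (Real.exp U) + Cm) :=
    mul_nonneg (by positivity) (add_nonneg (hpos _) hCm0)
  rcases le_total U u with h | h
  · have := (hU u h).trans (le_abs_self C)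
    linarith
  · have h1 : |normalizedCount M u| ≤ M (Real.exp U) := by
      rw [normalizedCount, abs_mul, Real.abs_exp, abs_of_nonneg (hpos _)]
      have h2 : Real.exp (-u) ≤ 1 := Real.exp_le_one_iff.2 (by linarith)
      exact (mul_le_of_le_one_right (hpos _) h2).trans (M.mono (Real.exp_le_exp.2 h))
    have h3 : |normalizedCount M u - m u| ≤ M (Real.exp U) + Cm :=
      (abs_sub _ _).trans (add_le_add h1 (hCm u))
    have h4 : u ^ p ≤ |U| ^ p :=
      pow_le_pow_left₀ (by linarith) (h.trans (le_abs_self U)) p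
    have h5 := mul_le_mul h4 h3 (abs_nonneg _) (by positivity)
    linarith [abs_nonneg C]

/-- The weights (1 + |t|)^ε and 1 + |t|^ε are comparable, with constants 2^ε and 2. -/
lemma forall_subpolyUpTo_iff {f : ℂ → ℂ} :
    (∀ n, SubpolyUpTo n f) ↔ ∀ ε : ℝ, 0 < ε → ∀ n : ℕ, ∃ C : ℝ, ∀ σ t : ℝ, 1 < σ →
      ‖iteratedDeriv n f ((σ : ℂ) + (t : ℂ) * Complex.I)‖ ≤ C * (1 + |t| ^ ε) := by
  constructor
  · intro h ε hε n
    obtain ⟨C, hC0, hC⟩ := (h n n le_rfl).exists_nonneg hε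
    refine ⟨C * 2 ^ ε, fun σ t hσ => ?_⟩
    have h1 := hC (σ + t * Complex.I) (by simpa [openHalfPlane] using hσ)
    have him : ((σ : ℂ) + t * Complex.I).im = t := by simp
    rw [him] at h1
    refine h1.trans ?_
    rw [mul_assoc]
    refine mul_le_mul_of_nonneg_left ?_ hC0
    have h2 : 0 ≤ |t| ^ ε := by positivity
    have h3 : (0 : ℝ) ≤ 2 ^ ε := by positivity
    rcases le_total |t| 1 with h4 | h4
    · calc (1 + |t|) ^ ε ≤ 2 ^ ε := Real.rpow_le_rpow (by positivity) (by linarith) hε.le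
        _ ≤ _ := by nlinarith
    · calc (1 + |t|) ^ ε ≤ (2 * |t|) ^ ε := Real.rpow_le_rpow (by positivity) (by linarith) hε.le
        _ = 2 ^ ε * |t| ^ ε := Real.mul_rpow (by norm_num) (abs_nonneg t)
        _ ≤ _ := by nlinarith
  · intro h n j _ ε hε
    obtain ⟨C, hC⟩ := h ε hε j
    refine ⟨|C| * 2, fun s hs => ?_⟩
    have h1 := hC s.re s.im hs
    rw [Complex.re_add_im] at h1
    have h2 := one_le_one_add_abs_rpow s.im hε.le
    have h3 : |s.im| ^ ε ≤ (1 + |s.im|) ^ ε :=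
      Real.rpow_le_rpow (abs_nonneg _) (by linarith) hε.le
    refine h1.trans ?_
    rw [mul_assoc]
    exact mul_le_mul (le_abs_self C) (by linarith) (by positivity) (abs_nonneg C)

lemma one_add_mul_I_mem_closedHalfPlane (t : ℝ) : 1 + (t : ℂ) * Complex.I ∈ closedHalfPlane := by
  simp [closedHalfPlane]

/-- The growth bound with ε = 1 passes to the limit at the boundary. One exponent for all n is what
the Tauberian theorem requires. -/
lemma norm_boundary_le {f F : ℂ → ℂ} (hf : ∀ n, SubpolyUpTo n f)
    (hF : ∀ n : ℕ, ∀ z ∈ closedHalfPlane, Tendsto (iteratedDeriv n f) (𝓝[openHalfPlane] z)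
      (𝓝 (iteratedDerivWithin n F closedHalfPlane z))) (n : ℕ) :
    ∃ C : ℝ, ∀ t : ℝ,
      ‖iteratedDerivWithin n F closedHalfPlane (1 + (t : ℂ) * Complex.I)‖ ≤ C * (1 + |t|) := by
  obtain ⟨C, hC⟩ := (hf n n le_rfl) 1 one_pos
  refine ⟨C, fun t => ?_⟩
  set z : ℂ := 1 + (t : ℂ) * Complex.I with hz
  have hzm := one_add_mul_I_mem_closedHalfPlane t
  have hne : (𝓝[openHalfPlane] z).NeBot := by
    rw [← mem_closure_iff_nhdsWithin_neBot, closure_openHalfPlane]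
    exact hzm
  have h1 : Tendsto (fun s : ℂ => C * (1 + |s.im|)) (𝓝[openHalfPlane] z) (𝓝 (C * (1 + |z.im|))) := by
    have : Continuous fun s : ℂ => C * (1 + |s.im|) := by fun_prop
    exact (this.tendsto z).mono_left nhdsWithin_le_nhds
  have hzim : z.im = t := by simp [hz]
  rw [hzim] at h1
  refine le_of_tendsto_of_tendsto (hF n z hzm).norm h1 ?_
  filter_upwards [self_mem_nhdsWithin] with s hs
  simpa using hC s hs

lemma exists_pow_bound_of_isBigO {g : ℝ → ℂ} (hg : Continuous g) {ε : ℝ} {k : ℕ} (hk : ε ≤ k)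
    (h : g =O[cocompact ℝ] fun t : ℝ => |t| ^ ε) : ∃ C : ℝ, ∀ t, ‖g t‖ ≤ C * (1 + |t|) ^ k := by
  obtain ⟨C, hC⟩ := h.bound
  obtain ⟨S, hS, hSC⟩ := (hasBasis_cocompact.eventually_iff).1
    (hC.and (tendsto_norm_cocompact_atTop.eventually_ge_atTop 1))
  obtain ⟨C', hC'⟩ := hS.exists_bound_of_continuousOn hg.continuousOn
  refine ⟨|C| + |C'|, fun t => ?_⟩
  have hp : 1 ≤ (1 + |t|) ^ k := one_le_pow₀ (by linarith [abs_nonneg t])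
  by_cases ht : t ∈ S
  · have h1 := (hC' t ht).trans (le_abs_self C')
    nlinarith [abs_nonneg C, abs_nonneg C']
  · obtain ⟨h1, h2⟩ := hSC ht
    rw [Real.norm_eq_abs] at h2
    have h3 : ‖|t| ^ ε‖ ≤ (1 + |t|) ^ k := by
      rw [Real.norm_eq_abs, abs_of_nonneg (by positivity)]
      calc |t| ^ ε ≤ |t| ^ (k : ℝ) := Real.rpow_le_rpow_of_exponent_le h2 hk
        _ = |t| ^ k := Real.rpow_natCast _ _
        _ ≤ (1 + |t|) ^ k := pow_le_pow_left₀ (abs_nonneg t) (by linarith) k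
    have h4 : C * ‖|t| ^ ε‖ ≤ |C| * (1 + |t|) ^ k :=
      mul_le_mul (le_abs_self C) h3 (norm_nonneg _) (abs_nonneg C)
    nlinarith [abs_nonneg C']

/-! ### The four statements in terms of normalized remainders and subpolynomial growth. -/

namespace BeurlingSystem

variable (B : BeurlingSystem)

lemma forall_isBigO_N_iff (a : ℝ) :
    (∀ n : ℕ, (fun x : ℝ => B.N x - a * x) =O[atTop] (fun x : ℝ => x / Real.log x ^ n)) ↔
      ∀ p : ℕ, ∃ C : ℝ, ∀ u : ℝ, 1 ≤ u →
        u ^ p * |normalizedCount B.N u - mainTerm (fun v => a * Real.exp v) u| ≤ C := by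
  rw [forall_isBigO_iff_rapidDecay,
    ← rapidDecay_iff_of_isMainTerm B.N_support (isMainTerm_linear a)]
  refine rapidDecay_iff_of_le (C := |a|) fun u hu => ?_
  have h1 : Real.exp u * Real.exp (-u) = 1 := by rw [← Real.exp_add]; simp
  rw [mainTerm_linear (by linarith), normalizedCount]
  have h2 : B.N (Real.exp u) * Real.exp (-u) - a * (1 - Real.exp (-u))
      - (B.N (Real.exp u) - a * Real.exp u) * Real.exp (-u) = a * Real.exp (-u) := by
    linear_combination a * h1
  rw [h2, abs_mul, Real.abs_exp]
  have h3 : |a| * 1 ≤ |a| * u := by gcongr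
  rw [mul_one] at h3
  gcongr

lemma forall_isBigO_P_iff :
    (∀ n : ℕ, (fun x : ℝ => B.P x - logIntegral x) =O[atTop] (fun x : ℝ => x / Real.log x ^ n)) ↔
      ∀ p : ℕ, ∃ C : ℝ, ∀ u : ℝ, 1 ≤ u →
        u ^ p * |normalizedCount B.P u - mainTerm primeDensity u| ≤ C := by
  rw [forall_isBigO_iff_rapidDecay,
    ← rapidDecay_iff_of_isMainTerm B.P_support isMainTerm_prime]
  obtain ⟨C, hC⟩ := abs_primitive_primeDensity_sub_logIntegral_le
  refine rapidDecay_iff_of_le (C := C) fun u hu => ?_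
  rw [mainTerm_of_nonneg (by linarith), normalizedCount]
  have h2 : B.P (Real.exp u) * Real.exp (-u)
      - Real.exp (-u) * (∫ v in (0 : ℝ)..u, primeDensity v)
      - (B.P (Real.exp u) - logIntegral (Real.exp u)) * Real.exp (-u)
      = -(((∫ v in (0 : ℝ)..u, primeDensity v) - logIntegral (Real.exp u)) * Real.exp (-u)) := by
    ring
  rw [h2, abs_neg, abs_mul, Real.abs_exp]
  exact mul_le_mul_of_nonneg_right (hC u hu) (Real.exp_pos _).le

theorem subpolyUpTo_zetaMinusPole_of_isBigO {a : ℝ}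
    (h : ∀ n : ℕ, (fun x : ℝ => B.N x - a * x) =O[atTop] (fun x : ℝ => x / Real.log x ^ n))
    (n : ℕ) : SubpolyUpTo n (B.zetaMinusPole a) :=
  subpolyUpTo_of_decay B.N_support B.zeta_convergent (isMainTerm_linear a)
    ((B.forall_isBigO_N_iff a).1 h) n

theorem isBigO_of_isSmoothExtension {a ε : ℝ} {F : ℂ → ℂ}
    (hF : IsSmoothExtension (B.zetaMinusPole a) F)
    (h : ∀ n : ℕ, (fun t : ℝ => iteratedDerivWithin n F closedHalfPlane (1 + (t : ℂ) * Complex.I))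
      =O[cocompact ℝ] (fun t : ℝ => |t| ^ ε)) (n : ℕ) :
    (fun x : ℝ => B.N x - a * x) =O[atTop] (fun x : ℝ => x / Real.log x ^ n) := by
  obtain ⟨k, hk⟩ := exists_nat_ge ε
  refine (B.forall_isBigO_N_iff a).2 (decay_of_smoothExtension B.N_support B.zeta_convergent
    (isMainTerm_linear a) hF (k := k) fun n => exists_pow_bound_of_isBigO ?_ hk (h n)) n
  exact (hF.differentiableOn_iteratedDerivWithin (B.differentiableOn_zetaMinusPole a)
    n).continuousOn.comp_continuous (by fun_prop) one_add_mul_I_mem_closedHalfPlane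

theorem exists_isSmoothExtension_of_subpolyUpTo {a : ℝ}
    (h : ∀ n, SubpolyUpTo n (B.zetaMinusPole a)) :
    ∃ F : ℂ → ℂ, IsSmoothExtension (B.zetaMinusPole a) F ∧ ∃ ε : ℝ, 0 < ε ∧ ∀ n : ℕ,
      (fun t : ℝ => iteratedDerivWithin n F closedHalfPlane (1 + (t : ℂ) * Complex.I))
        =O[cocompact ℝ] (fun t : ℝ => |t| ^ ε) := by
  obtain ⟨F, hF, hlim⟩ :=
    exists_smoothExtension_of_subpolyUpTo (B.differentiableOn_zetaMinusPole a) h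
  refine ⟨F, hF, 1, one_pos, fun n => ?_⟩
  obtain ⟨C, hC⟩ := norm_boundary_le h hlim n
  refine IsBigO.of_bound (|C| * 2) ?_
  filter_upwards [tendsto_norm_cocompact_atTop.eventually_ge_atTop 1] with t ht
  rw [Real.norm_eq_abs] at ht
  rw [Real.rpow_one, Real.norm_eq_abs, abs_abs, mul_assoc]
  exact (hC t).trans (mul_le_mul (le_abs_self C) (by linarith) (by positivity) (abs_nonneg C))

theorem isBigO_P_of_subpolyUpTo_logRemainder (h : ∀ n, SubpolyUpTo n B.logRemainder) (n : ℕ) :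
    (fun x : ℝ => B.P x - logIntegral x) =O[atTop] (fun x : ℝ => x / Real.log x ^ n) := by
  obtain ⟨F, hF, hlim⟩ :=
    exists_smoothExtension_of_subpolyUpTo B.differentiableOn_logRemainder h
  refine B.forall_isBigO_P_iff.2 (decay_of_smoothExtension B.P_support B.convergent_P
    isMainTerm_prime hF (k := 1) fun n => ?_) n
  simpa only [pow_one] using norm_boundary_le h hlim n

theorem subpolyUpTo_logRemainder_of_isBigO_P
    (h : ∀ n : ℕ, (fun x : ℝ => B.P x - logIntegral x)
      =O[atTop] (fun x : ℝ => x / Real.log x ^ n)) (n : ℕ) : SubpolyUpTo n B.logRemainder :=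
  subpolyUpTo_of_decay B.P_support B.convergent_P isMainTerm_prime
    (B.forall_isBigO_P_iff.1 h) n

end BeurlingSystem

theorem theorem4p1 (B : BeurlingSystem) :
    List.TFAE [
      -- (i)
      ∃ a : ℝ, 0 < a ∧ ∀ n : ℕ,
        (fun x : ℝ => B.N x - a * x) =O[atTop] (fun x : ℝ => x / Real.log x ^ n),
      -- (ii)
      ∃ a : ℝ, 0 < a ∧ ∃ F : ℂ → ℂ, IsSmoothExtension (B.zetaMinusPole a) F ∧
        ∃ ε : ℝ, 0 < ε ∧ ∀ n : ℕ,
          (fun t : ℝ => iteratedDerivWithin n F closedHalfPlane (1 + (t : ℂ) * Complex.I))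
            =O[cocompact ℝ] (fun t : ℝ => |t| ^ ε),
      -- (iii)
      ∃ a : ℝ, 0 < a ∧ ∀ ε : ℝ, 0 < ε → ∀ n : ℕ, ∃ C : ℝ, ∀ σ t : ℝ, 1 < σ →
        ‖iteratedDeriv n (B.zetaMinusPole a) ((σ : ℂ) + (t : ℂ) * Complex.I)‖
          ≤ C * (1 + |t| ^ ε),
      -- (iv)
      ∀ n : ℕ,
        (fun x : ℝ => B.P x - logIntegral x) =O[atTop] (fun x : ℝ => x / Real.log x ^ n)] := by
  -- The cycle (i), (iii), (ii) concerns N alone, with the same a throughout. Statement (iv) is tied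
  -- to (iii) through the logarithm, and there a is recovered as a boundary value.
  tfae_have 1 → 3 := by
    rintro ⟨a, ha, h⟩
    exact ⟨a, ha, forall_subpolyUpTo_iff.1 (B.subpolyUpTo_zetaMinusPole_of_isBigO h)⟩
  tfae_have 3 → 2 := by
    rintro ⟨a, ha, h⟩
    exact ⟨a, ha, B.exists_isSmoothExtension_of_subpolyUpTo (forall_subpolyUpTo_iff.2 h)⟩
  tfae_have 2 → 1 := by
    rintro ⟨a, ha, F, hF, ε, -, h⟩
    exact ⟨a, ha, B.isBigO_of_isSmoothExtension hF h⟩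
  tfae_have 3 → 4 := by
    rintro ⟨a, ha, h⟩
    exact B.isBigO_P_of_subpolyUpTo_logRemainder
      (B.subpolyUpTo_logRemainder_of_zetaMinusPole ha (forall_subpolyUpTo_iff.2 h))
  tfae_have 4 → 3 := by
    intro h
    obtain ⟨a, ha, hG⟩ := B.subpolyUpTo_zetaMinusPole_of_logRemainder
      (B.subpolyUpTo_logRemainder_of_isBigO_P h)
    exact ⟨a, ha, forall_subpolyUpTo_iff.1 hG⟩
  tfae_finish
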